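/- **Setting.** For $n=2j\in\mathbb N$ let $J_1,J_2,J_3$ be the angular momentum matrices of the spin-$j$ representation of $SU(2)$ on $\mathbb C^{n+1}$ in the standard basis, $J_\pm=J_1\pm iJ_2$. The rotation $g=\exp(v\cdot L)\in SO(3)$, $v\in\mathbb R^3$, where $L_1,L_2,L_3$ are the standard infinitesimal rotations, acts on operators by $P^g=e^{-iv\cdot J}Pe^{iv\cdot J}$ and on functions on $S^2$ by $f^g(\mathbf n)=f(g^{-1}\mathbf n)$. A *symbol correspondence* is an injective linear map $P\mapsto W_P$ from $M_{\mathbb C}(n+1)$ to smooth functions $S^2\to\mathbb C$ with $W_{P^g}=(W_P)^g$ for all $g\in SO(3)$, $W_{P^*}=\overline{W_P}$ and $\frac1{4\pi}\int_{S^2}W_P\,dS=\frac1{n+1}\operatorname{tr}P$. Its twisted product is defined on symbols by $W_P\star W_Q=W_{PQ}$. Put $\beta_{l,m}=\sqrt{(l+m)(l-m+1)}$. For $-l\le m\le l$ let $\mathbf e^j(l,l)=(-1)^lJ_+^l/\|J_+^l\|$ (Hilbert–Schmidt norm, $l\le n$), $\mathbf e^j(l,m-1)=[J_-,\mathbf e^j(l,m)]/\beta_{l,m}$,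 and let the spherical harmonics be $Y_l^l=(-1)^l\frac{\sqrt{(2l+1)!}}{l!\,2^l}(x+iy)^l$, $Y_l^{m-1}=J_-(Y_l^m)/\beta_{l,m}$, where here $J_-$ is the derivation with $J_-x=-z$, $J_-y=iz$, $J_-z=x-iy$. The correspondence $W$ has *characteristic numbers* $c_1,\dots,c_n\in\mathbb R\setminus\{0\}$ if $W_P(g\mathbf n_0)=\operatorname{tr}(PK^g)$ for all $P$ and all $g\in SO(3)$, where $\mathbf n_0=(0,0,1)$ and $K=\frac1{n+1}I+\sum_{l=1}^n c_l\sqrt{\tfrac{2l+1}{n+1}}\,\mathbf e^j(l,0)$. Given $\mathcal C:\{(n,l)\in\mathbb N^2: n\ge l>0\}\to\mathbb R\setminus\{0\}$, let $\mathbf W_{\mathcal C}$ be the sequence, indexed by $n\in\mathbb N$, of symbol correspondences with characteristic numbers $c^n_l=\mathcal C(n,l)$ (and $c_0^n=1$), with twisted products $\star^n$. Let $\{\cdot,\cdot\}$ be the Poisson bracket of the area form of $S^2$, so that $\{x,y\}=z$ and cyclically. The sequence is of *Poisson type* if, for all $l_1,l_2\in\mathbb N$, $|m_1|\le l_1$,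 $|m_2|\le l_2$, with $f=Y_{l_1}^{m_1}$, $g=Y_{l_2}^{m_2}$, uniformly on $S^2$ as $n\to\infty$: (i) $f\star^n g-g\star^n f\to0$; (ii) $f\star^n g+g\star^n f\to2fg$; (iii) $n(f\star^n g-g\star^n f)\to2i\{f,g\}$. It is of *anti-Poisson type* if (i), (ii) hold and (iii) holds with limit $-2i\{f,g\}$. It is of *pure-Poisson* (*pure-anti-Poisson*) type if it is of Poisson (anti-Poisson) type and moreover (iv) $n(f\star^n g+g\star^n f-2fg)\to0$ uniformly on $S^2$ for all such $f,g$. **Theorem.** For every $\mathcal C$: 1. $\mathbf W_{\mathcal C}$ is of Poisson type if and only if $\lim_{n\to\infty}c_l^n=1$ for all $l\in\mathbb N$. 2. $\mathbf W_{\mathcal C}$ is of anti-Poisson type if and only if $\lim_{n\to\infty}c_l^n=(-1)^l$ for all $l\in\mathbb N$. 3. $\mathbf W_{\mathcal C}$ is of pure-Poisson type (resp. pure-anti-Poisson type) if and only if $\lim_{n\to\infty}n\,(c_l^n-f(l))=0$ for all $l\in\mathbb N$, where $f(l)=1$ (resp. $f(l)=(-1)^l$). Consequently, generic sequences are neither of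 Poisson nor of anti-Poisson type: the set of $\mathcal C$ for which $\mathbf W_{\mathcal C}$ is of neither type is residual (its complement is meagre) in $(\mathbb R\setminus\{0\})^{\{n\ge l>0\}}$ with the product topology; the same holds within the Stratonovich–Weyl sequences, $c_l^n=\pm1$, in $\{\pm1\}^{\{n\ge l>0\}}$; and if the signs $c_l^n$, $n\ge l>0$, are independent and uniformly distributed on $\{\pm1\}$, then $\mathbf W_{\mathcal C}$ is almost surely of neither type. -/

import Mathlib

open MeasureTheory Filter Topology
open scoped Matrix Manifold ContDiff

noncomputable section

namespace SpinSymbol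

/-! ### The spin-`j` system, `n = 2j`, in the standard basis `|j,j⟩, |j,j-1⟩, …, |j,-j⟩` -/

/-- Operators on the spin-`j` Hilbert space `ℂ^(n+1)`, `n = 2j`. -/
abbrev Op (n : ℕ) : Type := Matrix (Fin (n + 1)) (Fin (n + 1)) ℂ

/-- The raising operator `J₊`. -/
def Jplus (n : ℕ) : Op n :=
  Matrix.of fun i k => if (i : ℕ) + 1 = k then ((√((k : ℝ) * ((n : ℝ) + 1 - k)) : ℝ) : ℂ) else 0

/-- The lowering operator `J₋`, the adjoint of `J₊`. -/
def Jminus (n : ℕ) : Op n := (Jplus n)ᴴ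

/-- The angular momentum operators `J₁, J₂, J₃`. -/
def J (n : ℕ) : Fin 3 → Op n :=
  ![(1 / 2 : ℂ) • (Jplus n + Jminus n),
    (1 / (2 * Complex.I)) • (Jplus n - Jminus n),
    Matrix.diagonal fun i => (n : ℂ) / 2 - ((i : ℕ) : ℂ)]

/-- The unitary operator `exp (-i v·J)` representing the spinor rotation
`exp (-(i/2) v·σ) ∈ SU(2)`. Every element of `SU(2)` is of that form. -/
def spinRot (n : ℕ) (v : Fin 3 → ℝ) : Op n :=
  NormedSpace.exp ((-Complex.I) • ∑ k, (v k : ℂ) • J n k)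

/-- The infinitesimal rotations `L₁, L₂, L₃`, a basis of the Lie algebra of `SO(3)`. -/
def L : Fin 3 → Matrix (Fin 3) (Fin 3) ℝ :=
  ![!![0, 0, 0; 0, 0, -1; 0, 1, 0],
    !![0, 0, 1; 0, 0, 0; -1, 0, 0],
    !![0, -1, 0; 1, 0, 0; 0, 0, 0]]

/-- The rotation `exp (v·L) ∈ SO(3)`, by the angle `|v|` around the axis `v`; the image of
`exp (-(i/2) v·σ)` under the covering `SU(2) → SO(3)`. Every rotation is of that form. -/
def rot (v : Fin 3 → ℝ) : Matrix (Fin 3) (Fin 3) ℝ :=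
  NormedSpace.exp (∑ k, v k • L k)

/-- The conjugate `P^g = φ_j(g) P φ_j(g)⁻¹`, where `g` is the rotation `exp (v·L)`. -/
def conjOp {n : ℕ} (v : Fin 3 → ℝ) (P : Op n) : Op n :=
  spinRot n v * P * spinRot n (-v)

/-- The coefficient `β_{l,m} = √((l+m)(l-m+1))` of the lowering operators. -/
def beta (l : ℕ) (m : ℤ) : ℝ := √(((l : ℝ) + m) * ((l : ℝ) - m + 1))

/-- The matrices `e^j(l, l-k)`: `e^j(l,l) = (-1)^l J₊^l / ‖J₊^l‖` for the Hilbert-Schmidt norm,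
`e^j(l,m-1) = [J₋, e^j(l,m)] / β_{l,m}`. -/
def coupledAux (n l : ℕ) : ℕ → Op n
  | 0 => (((-1) ^ l / √(Complex.re (Matrix.trace (Jminus n ^ l * Jplus n ^ l))) : ℝ) : ℂ) •
      Jplus n ^ l
  | k + 1 => ((1 / beta l ((l : ℤ) - k) : ℝ) : ℂ) •
      (Jminus n * coupledAux n l k - coupledAux n l k * Jminus n)

/-- The coupled standard basis `e^j(l,m)`, `-l ≤ m ≤ l ≤ n`, of the operator space. -/
def coupled (n l : ℕ) (m : ℤ) : Op n := coupledAux n l ((l : ℤ) - m).toNat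

/-! ### The sphere, its Poisson bracket, and spherical harmonics -/

/-- Euclidean 3-space. -/
abbrev E3 : Type := EuclideanSpace ℝ (Fin 3)

/-- The unit sphere. -/
abbrev S2 : Type := Metric.sphere (0 : E3) 1

instance : Fact (Module.finrank ℝ E3 = 2 + 1) := ⟨by simp⟩

/-- The north pole `(0,0,1)`. -/
def northPole : S2 := ⟨!₂[0, 0, 1], by simp [EuclideanSpace.norm_eq, Fin.sum_univ_three]⟩

/-- The radial projection of `E3 \ {0}` onto the sphere (with a dummy value at `0`). -/
def radialProj (x : E3) : S2 :=
  if h : x = 0 then northPole else ⟨‖x‖⁻¹ • x, by simp [norm_smul, h]⟩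

/-- The `k`-th component of the gradient of `f` at `p ∈ S²`, a tangent vector of the sphere:
the partial derivative of the extension of `f` that is constant on rays. -/
def grad (f : S2 → ℂ) (p : S2) (k : Fin 3) : ℂ :=
  fderiv ℝ (fun x : E3 => f (radialProj x)) (p : E3) (EuclideanSpace.single k 1)

/-- The Poisson bracket of the area form `ω = x dy∧dz + y dz∧dx + z dx∧dy` of the sphere:
the Hamiltonian field of `f`, with `ω(X_f, ·) + df = 0`, is `X_f(p) = p × ∇f(p)`, and
`{f, g}(p) = X_f(g)(p) = p · (∇f(p) × ∇g(p))`. -/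
def poisson (f g : S2 → ℂ) (p : S2) : ℂ :=
  (fun k => ((p : E3) k : ℂ)) ⬝ᵥ (crossProduct (grad f p) (grad g p))

/-- The lowering operator `J₋ = J₁ - i J₂` on polynomials in `x, y, z`, where `J_k = i L_k` acts as
a derivation: `J₋ x = -z`, `J₋ y = i z`, `J₋ z = x - i y`. -/
def lowering : Derivation ℂ (MvPolynomial (Fin 3) ℂ) (MvPolynomial (Fin 3) ℂ) :=
  MvPolynomial.mkDerivation ℂ
    ![-MvPolynomial.X 2, Complex.I • MvPolynomial.X 2,
      MvPolynomial.X 0 - Complex.I • MvPolynomial.X 1]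

/-- The polynomials `Y_{l, l-k}`: `Y_{l,l} = (-1)^l (x+iy)^l / λ_l` with
`λ_l = ‖(x+iy)^l‖ = l! 2^l / √((2l+1)!)` for the normalized `L²` norm of the sphere,
`Y_{l,m-1} = J₋ Y_{l,m} / β_{l,m}`. -/
def harmonicAux (l : ℕ) : ℕ → MvPolynomial (Fin 3) ℂ
  | 0 => (((-1) ^ l / ((l.factorial : ℝ) * 2 ^ l / √((2 * l + 1).factorial : ℝ)) : ℝ) : ℂ) •
      (MvPolynomial.X 0 + Complex.I • MvPolynomial.X 1) ^ l
  | k + 1 => ((1 / beta l ((l : ℤ) - k) : ℝ) : ℂ) • lowering (harmonicAux l k)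

/-- The spherical harmonic `Y_l^m`, `-l ≤ m ≤ l`, as a function on the sphere. -/
def Y (l : ℕ) (m : ℤ) (p : S2) : ℂ :=
  MvPolynomial.eval (fun k => ((p : E3) k : ℂ)) (harmonicAux l ((l : ℤ) - m).toNat)

/-! ### Symbol correspondences and twisted products -/

/-- A symbol correspondence for the spin-`j` system, `n = 2j`. -/
structure SymbolCorrespondence (n : ℕ) where
  /-- the symbol map `P ↦ W_P` -/
  symbol : Op n →ₗ[ℂ] (S2 → ℂ)
  smooth : ∀ P, ContMDiff (𝓡 2) 𝓘(ℝ, ℂ) ∞ (symbol P)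
  injective : Function.Injective symbol
  /-- `W_{P^g}(g x) = W_P(x)` for every rotation `g` -/
  equivariant : ∀ (P : Op n) (v : Fin 3 → ℝ) (x y : S2),
    (y : E3).ofLp = rot v *ᵥ (x : E3).ofLp → symbol (conjOp v P) y = symbol P x
  real : ∀ (P : Op n) (x : S2), symbol Pᴴ x = starRingEnd ℂ (symbol P x)
  /-- the normalized integral over the sphere of the symbol is the normalized trace -/
  normalized : ∀ P : Op n,
    (1 / (4 * (Real.pi : ℂ))) * ∫ x, symbol P x ∂(volume : Measure E3).toSphere =
      (1 / ((n : ℂ) + 1)) * P.trace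

/-- The operator kernel `K = I/(n+1) + ∑_{l=1}^n c_l √((2l+1)/(n+1)) e^j(l,0)`. -/
def kernel (n : ℕ) (c : ℕ → ℝ) : Op n :=
  (1 / ((n : ℂ) + 1)) • (1 : Op n) +
    ∑ l ∈ Finset.Icc 1 n, ((c l * √((2 * (l : ℝ) + 1) / ((n : ℝ) + 1)) : ℝ) : ℂ) • coupled n l 0

/-- `W` has the characteristic numbers `c_1, …, c_n`: for the operator kernel `K` that they define,
`W_P(g n₀) = trace (P K^g)` for all operators `P` and rotations `g`, with `n₀` the north pole. -/
def SymbolCorrespondence.HasCharacteristicNumbers {n : ℕ} (W : SymbolCorrespondence n)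
    (c : ℕ → ℝ) : Prop :=
  ∀ (P : Op n) (v : Fin 3 → ℝ) (x : S2), (x : E3).ofLp = rot v *ᵥ (northPole : E3).ofLp →
    W.symbol P x = (P * conjOp v (kernel n c)).trace

/-- The twisted product of symbols, `W_P ⋆ W_Q = W_{PQ}` (a dummy value is taken at functions that
are not symbols of an operator). -/
def SymbolCorrespondence.star {n : ℕ} (W : SymbolCorrespondence n) (f g : S2 → ℂ) : S2 → ℂ :=
  W.symbol (Function.invFun W.symbol f * Function.invFun W.symbol g)

/-! ### Sequences of symbol correspondences -/

/-- The index set `Δ⁺(ℕ²) = {(n,l) | n ≥ l > 0}`. -/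
abbrev DeltaPlus : Type := {q : ℕ × ℕ // 0 < q.2 ∧ q.2 ≤ q.1}

/-- The numbers `c_l^n`: `c_l^n = C(n,l)` for `n ≥ l > 0`, and `c_0^n = 1`
(with a dummy value for `l > n`). -/
def charNum (C : DeltaPlus → ℝˣ) (n l : ℕ) : ℝ :=
  if h : 0 < l ∧ l ≤ n then ((C ⟨(n, l), h⟩ : ℝˣ) : ℝ) else 1

/-- `W` is the symbol correspondence sequence `W_C` with characteristic numbers `C`. -/
def IsSequenceOf (W : ∀ n, SymbolCorrespondence n) (C : DeltaPlus → ℝˣ) : Prop :=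
  ∀ n, (W n).HasCharacteristicNumbers (charNum C n)

/-- Properties (i) and (ii), and the property that `n` times the twisted commutator of `Y_{l₁}^{m₁}`
and `Y_{l₂}^{m₂}` tends to `2 i s {Y_{l₁}^{m₁}, Y_{l₂}^{m₂}}`; all limits are uniform on the
sphere. -/
structure IsPoissonTypeWithSign (s : ℂ) (W : ∀ n, SymbolCorrespondence n) : Prop where
  commutator : ∀ (l₁ l₂ : ℕ) (m₁ m₂ : ℤ), |m₁| ≤ l₁ → |m₂| ≤ l₂ →
    TendstoUniformly
      (fun n p => (W n).star (Y l₁ m₁) (Y l₂ m₂) p - (W n).star (Y l₂ m₂) (Y l₁ m₁) p)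
      (fun _ => 0) atTop
  anticommutator : ∀ (l₁ l₂ : ℕ) (m₁ m₂ : ℤ), |m₁| ≤ l₁ → |m₂| ≤ l₂ →
    TendstoUniformly
      (fun n p => (W n).star (Y l₁ m₁) (Y l₂ m₂) p + (W n).star (Y l₂ m₂) (Y l₁ m₁) p)
      (fun p => 2 * Y l₁ m₁ p * Y l₂ m₂ p) atTop
  bracket : ∀ (l₁ l₂ : ℕ) (m₁ m₂ : ℤ), |m₁| ≤ l₁ → |m₂| ≤ l₂ →
    TendstoUniformly
      (fun (n : ℕ) p => (n : ℂ) *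
        ((W n).star (Y l₁ m₁) (Y l₂ m₂) p - (W n).star (Y l₂ m₂) (Y l₁ m₁) p))
      (fun p => s * (2 * Complex.I * poisson (Y l₁ m₁) (Y l₂ m₂) p)) atTop

/-- Poisson type. -/
def IsPoissonType (W : ∀ n, SymbolCorrespondence n) : Prop := IsPoissonTypeWithSign 1 W

/-- Anti-Poisson type. -/
def IsAntiPoissonType (W : ∀ n, SymbolCorrespondence n) : Prop := IsPoissonTypeWithSign (-1) W

/-- Property (iv): `n (f ⋆ g + g ⋆ f - 2 f g) → 0` uniformly for spherical harmonics `f`, `g`. -/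
def IsPure (W : ∀ n, SymbolCorrespondence n) : Prop :=
  ∀ (l₁ l₂ : ℕ) (m₁ m₂ : ℤ), |m₁| ≤ l₁ → |m₂| ≤ l₂ →
    TendstoUniformly
      (fun (n : ℕ) p => (n : ℂ) *
        ((W n).star (Y l₁ m₁) (Y l₂ m₂) p + (W n).star (Y l₂ m₂) (Y l₁ m₁) p
          - 2 * Y l₁ m₁ p * Y l₂ m₂ p))
      (fun _ => 0) atTop

/-- Pure-Poisson type. -/
def IsPurePoissonType (W : ∀ n, SymbolCorrespondence n) : Prop := IsPoissonType W ∧ IsPure W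

/-- Pure-anti-Poisson type. -/
def IsPureAntiPoissonType (W : ∀ n, SymbolCorrespondence n) : Prop :=
  IsAntiPoissonType W ∧ IsPure W

/-- Signs as nonzero real numbers. A sequence of symbol correspondences is of Stratonovich-Weyl type
when its characteristic numbers are signs. -/
def ofSigns (ε : DeltaPlus → ℤˣ) : DeltaPlus → ℝˣ :=
  fun q => Units.map (Int.castRingHom ℝ : ℤ →* ℝ) (ε q)

/-- The law of a family of independent signs, each `1` or `-1` with probability `1/2`. -/
def randomSigns : Measure (DeltaPlus → ℤˣ) :=
  Measure.infinitePi fun _ => (PMF.uniformOfFintype ℤˣ).toMeasure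

end SpinSymbol

end

open SpinSymbol

/-! Everything is reduced to the operators `bOp n l k = [J₋, ·]^k (2J₊/(n+1))^l` and the polynomials
`bPoly l k = J₋^k (x+iy)^l`, which up to normalization are the spherical harmonics. Moving a
rotation from the kernel `K` to `J₊` turns `J₊` into `a·J` with `a` isotropic. Since `K` commutes
with diagonal matrices, the trace of `(a·J)^l K` depends on `a` only through `(a 2)^l`, and `a 2` is
the value of `x+iy` at the rotated pole. So the symbol of `J₊^l` is a multiple of `(x+iy)^l`, and
infinitesimal equivariance gives one scalar `d n l` with `W (bOp n l k) = d n l * bPoly l k` for all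
`k` (`exists_symbol_bOp`). For `l ≤ n`, `d n l = c_l^n * ratioNum n l` with `ratioNum = 1 +
O(1/n²)`, so `d` and `c` satisfy the same limit conditions, also at order `1/n`.

Sufficiency: products of the `bOp` are combinations of `bOp` with coefficients polynomial in
`1/(n+1)`, and to first order they follow the law `F G + i {F, G}/(n+1)` on the sphere
(`Expn.mul_mem`). It is enough to multiply by `J₊, J₃, J₋`; Leibniz rules for the lowering operator
do the rest. Commutators are exactly `1/(n+1)` times such an expansion (`Expn.comm_basis_mem`), so
(iii) needs no rate of convergence of `c_l^n`. If `d n l → s^l` with `s = ±1`, homogeneity turns the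
limit of a symbol into the leading polynomial evaluated at `s p`. For `s = -1` this is the antipodal
map, which reverses the Poisson bracket. In the anticommutator the first-order terms cancel, so (iv)
measures only how fast `d n l` approaches `s^l`.

Necessity: the bracket of `Y_1^1` and `Y_1^0` forces `d n 1 → s`. Powers of `J₊` multiply exactly,
so the anticommutator of `Y_1^1` and `Y_l^l` is governed by `d n (l+1) / (d n 1 * d n l)`, and
induction on `l` gives all limits. Under (iv) the same recursion works at order `1/n`, started by
the Casimir identity `bOp_casimir`.

Genericity: a type forces convergence of `c_1^n` to `1` or `-1`, which generic or random sequences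
violate infinitely often. -/

noncomputable section

namespace SpinSymbol

/-! ### Commutator calculus in an algebra with raising, lowering and Cartan elements. -/

section Ladder

variable {R : Type*} [Ring R] [Algebra ℂ R]

/-- The inner derivation `x ↦ [f, x]`. -/
def innerDer (f : R) : R →ₗ[ℂ] R := LinearMap.mulLeft ℂ f - LinearMap.mulRight ℂ f

theorem innerDer_apply (f x : R) : innerDer f x = f * x - x * f := rfl

theorem innerDer_mul (f x y : R) : innerDer f (x * y) = innerDer f x * y + x * innerDer f y := by
  simp only [innerDer_apply]; noncomm_ring

theorem innerDer_self_pow (f : R) (l : ℕ) : innerDer f (f ^ l) = 0 := by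
  rw [innerDer_apply, ← pow_succ, ← pow_succ', sub_self]

/-- The Leibniz rule for a product whose first factor is killed by the third power. -/
theorem iterate_leibniz (D : R →ₗ[ℂ] R) (hD : ∀ x y, D (x * y) = D x * y + x * D y) (u w : R)
    (hu : D (D (D u)) = 0) (k : ℕ) :
    D^[k + 2] (u * w) = u * D^[k + 2] w + ((k : ℂ) + 2) • (D u * D^[k + 1] w) +
      (((k : ℂ) + 2) * (k + 1) / 2) • (D (D u) * D^[k] w) := by
  induction k with
  | zero =>
    simp only [Function.iterate_succ, Function.iterate_zero, Function.comp, id, hD, map_add,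
      zero_add, Nat.cast_zero]
    module
  | succ k ih =>
    rw [Function.iterate_succ_apply', ih]
    simp only [map_add, map_smul, hD, hu, ← Function.iterate_succ_apply' D]
    push_cast
    simp only [zero_mul, zero_add, Nat.succ_eq_add_one]
    module

variable {e f h : R}

theorem cartan_mul_pow
    (he : h * e = e * h + e) (l : ℕ) : h * e ^ l = e ^ l * h + (l : ℂ) • e ^ l := by
  induction l with
  | zero => simp
  | succ l ih =>
    rw [pow_succ, ← mul_assoc, ih, add_mul, mul_assoc, he]
    simp only [mul_add, smul_mul_assoc, mul_assoc]
    push_cast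
    module

theorem innerDer_raise
    (hef : e * f = f * e + (2 : ℂ) • h) : innerDer f e = (-2 : ℂ) • h := by
  rw [innerDer_apply, hef]; module

theorem innerDer_cartan
    (hf : h * f = f * h - f) : innerDer f h = f := by
  rw [innerDer_apply, hf]; abel

theorem innerDer_pow_succ
    (he : h * e = e * h + e) (hef : e * f = f * e + (2 : ℂ) • h) (l : ℕ) :
    innerDer f (e ^ (l + 1)) = (-2 * ((l : ℂ) + 1)) • (h * e ^ l) + ((l : ℂ) * (l + 1)) • e ^ l := by
  induction l with
  | zero => simp [innerDer_raise hef]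
  | succ l ih =>
    rw [pow_succ' e (l + 1), innerDer_mul, ih, innerDer_raise hef]
    have : e * (h * e ^ l) = h * e ^ (l + 1) - e ^ (l + 1) := by
      rw [← mul_assoc, eq_sub_of_add_eq he.symm, sub_mul, mul_assoc, ← pow_succ']
    simp only [mul_add, mul_smul_comm, smul_mul_assoc, this, ← pow_succ']
    push_cast
    module

/-- The decomposition of `h e^l` into irreducible components. -/
theorem cartan_mul_pow_eq
    (he : h * e = e * h + e) (hef : e * f = f * e + (2 : ℂ) • h) (l : ℕ) :
    h * e ^ l = (-1 / (2 * ((l : ℂ) + 1))) • innerDer f (e ^ (l + 1)) + ((l : ℂ) / 2) • e ^ l := by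
  have hl : (l : ℂ) + 1 ≠ 0 := Nat.cast_add_one_ne_zero l
  rw [innerDer_pow_succ he hef]
  match_scalars <;> field_simp
  ring

/-- The decomposition of `f e^l` into irreducible components. -/
theorem lower_mul_pow_eq
    (he : h * e = e * h + e) (hf : h * f = f * h - f) (hef : e * f = f * e + (2 : ℂ) • h)
    {C : ℂ} (hC : f * e + h * h + h = C • (1 : R)) (l : ℕ) :
    f * e ^ l = (-1 / ((4 * (l : ℂ) + 2) * (l + 1))) • innerDer f (innerDer f (e ^ (l + 1))) +
      (1 / 2 : ℂ) • innerDer f (e ^ l) +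
      ((l : ℂ) * (4 * C + 1 - (l : ℂ) ^ 2) / (4 * l + 2)) • e ^ (l - 1) := by
  have hl : (l : ℂ) + 1 ≠ 0 := Nat.cast_add_one_ne_zero l
  have hl' : 4 * (l : ℂ) + 2 ≠ 0 := by
    have : ((4 * l + 2 : ℕ) : ℂ) ≠ 0 := Nat.cast_ne_zero.mpr (by omega)
    simpa using this
  cases l with
  | zero =>
    -- At `l = 0` the truncated exponent `l - 1` is harmless, because its coefficient vanishes.
    simp only [Nat.cast_zero, zero_add, pow_one, innerDer_raise hef, map_smul, innerDer_cartan hf]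
    simp only [pow_zero, innerDer_apply, mul_one, one_mul, sub_self]
    module
  | succ l =>
    rw [innerDer_pow_succ he hef (l + 1)]
    simp only [map_add, map_smul, innerDer_mul, innerDer_cartan hf, innerDer_pow_succ he hef l,
      mul_add, mul_smul_comm, Nat.add_sub_cancel]
    -- The Casimir relation removes the only term quadratic in `h`; both sides are then combinations
    -- of `f * e ^ (l + 1)`, `h * e ^ l` and `e ^ l`.
    have h1 : h * (h * e ^ l) = C • e ^ l - f * e ^ (l + 1) - h * e ^ l := by
      have := congrArg (· * e ^ l) hC
      simp only [add_mul, smul_mul_assoc, one_mul, mul_assoc, ← pow_succ'] at this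
      rw [← this]; abel
    rw [h1]
    push_cast at hl hl' ⊢
    match_scalars <;> field_simp <;> ring

theorem innerDer_iterate_three
    (hf : h * f = f * h - f) (hef : e * f = f * e + (2 : ℂ) • h) :
    innerDer f (innerDer f (innerDer f e)) = 0 := by
  rw [innerDer_raise hef, map_smul, innerDer_cartan hf, map_smul]
  simp [innerDer_apply]

/-- In `e * e ^ l` only the Leibniz term in which the new factor `e` absorbs two derivatives
survives; the others apply more than `2 * l` derivatives to `e ^ l`. -/
theorem innerDer_iterate_top
    (hf : h * f = f * h - f) (hef : e * f = f * e + (2 : ℂ) • h) (l : ℕ) :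
    (innerDer f)^[2 * l] (e ^ l) = (((2 * l).factorial : ℂ) * (-1) ^ l) • f ^ l ∧
      (innerDer f)^[2 * l + 1] (e ^ l) = 0 := by
  induction l with
  | zero => simp [innerDer_apply]
  | succ l ih =>
    have key := iterate_leibniz (innerDer f) (innerDer_mul f) e (e ^ l)
      (innerDer_iterate_three hf hef)
    have z2 : (innerDer f)^[2 * l + 2] (e ^ l) = 0 := by
      rw [Function.iterate_succ_apply', ih.2, map_zero]
    have z3 : (innerDer f)^[2 * l + 3] (e ^ l) = 0 := by
      rw [Function.iterate_succ_apply', z2, map_zero]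
    have e2 : innerDer f (innerDer f e) = (-2 : ℂ) • f := by
      rw [innerDer_raise hef, map_smul, innerDer_cartan hf]
    constructor
    · rw [pow_succ', mul_add_one, key, z2, ih.1, ih.2, e2]
      simp only [mul_zero, smul_zero, zero_add, smul_mul_smul_comm, ← pow_succ', smul_smul]
      congr 1
      rw [show (2 * l + 2).factorial = (2 * l + 2) * ((2 * l + 1) * (2 * l).factorial) from rfl]
      push_cast
      ring
    · have := key (2 * l + 1)
      rw [z2, z3, ih.2] at this
      simpa [pow_succ', mul_add_one, add_assoc] using this

end Ladder

/-! ### Relations between the angular momentum operators -/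

section Spin

variable (n : ℕ)

/-- The operator `J₃`. -/
def Jthree : Op n := Matrix.diagonal fun i => (n : ℂ) / 2 - ((i : ℕ) : ℂ)

theorem Jplus_apply (i k : Fin (n + 1)) :
    Jplus n i k = if (i : ℕ) + 1 = k then ((√((k : ℝ) * ((n : ℝ) + 1 - k)) : ℝ) : ℂ) else 0 := rfl

theorem Jminus_apply (i k : Fin (n + 1)) :
    Jminus n i k = if (k : ℕ) + 1 = i then ((√((i : ℝ) * ((n : ℝ) + 1 - i)) : ℝ) : ℂ) else 0 := by
  rw [Jminus, Matrix.conjTranspose_apply, Jplus_apply]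
  split_ifs <;> simp

theorem coef_mul_self (k : Fin (n + 1)) :
    ((√((k : ℝ) * ((n : ℝ) + 1 - k)) : ℝ) : ℂ) * ((√((k : ℝ) * ((n : ℝ) + 1 - k)) : ℝ) : ℂ) =
      (k : ℂ) * ((n : ℂ) + 1 - k) := by
  rw [← Complex.ofReal_mul, Real.mul_self_sqrt]
  · push_cast; ring
  · have : ((k : ℕ) : ℝ) ≤ n := by exact_mod_cast Nat.lt_succ_iff.mp k.2
    exact mul_nonneg (by positivity) (by linarith)

theorem Jplus_mul_Jminus :
    Jplus n * Jminus n = Matrix.diagonal fun i : Fin (n + 1) => (((i : ℕ) : ℂ) + 1) * (n - (i : ℕ)) := by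
  ext i k
  rw [Matrix.mul_apply, Matrix.diagonal_apply]
  simp only [Jplus_apply, Jminus_apply]
  by_cases hi : (i : ℕ) < n
  · rw [Finset.sum_eq_single ⟨(i : ℕ) + 1, by omega⟩]
    · by_cases hik : i = k
      · subst hik
        simp only [if_true]
        rw [coef_mul_self n ⟨(i : ℕ) + 1, by omega⟩]
        push_cast
        ring
      · have : ¬ (k : ℕ) + 1 = (i : ℕ) + 1 := fun h => hik (Fin.ext (by omega))
        rw [if_neg this, if_neg hik, mul_zero]
    · intro j _ hj
      rw [if_neg (fun h => hj (Fin.ext h.symm)), zero_mul]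
    · simp
  · have hin : (i : ℕ) = n := by omega
    rw [Finset.sum_eq_zero]
    · simp [hin]
    · intro j _
      rw [if_neg (by omega), zero_mul]

theorem Jminus_mul_Jplus :
    Jminus n * Jplus n = Matrix.diagonal fun i : Fin (n + 1) => ((i : ℕ) : ℂ) * ((n : ℂ) + 1 - (i : ℕ)) := by
  ext i k
  rw [Matrix.mul_apply, Matrix.diagonal_apply]
  simp only [Jplus_apply, Jminus_apply]
  by_cases hi : 0 < (i : ℕ)
  · rw [Finset.sum_eq_single ⟨(i : ℕ) - 1, by omega⟩]
    · have h1 : (i : ℕ) - 1 + 1 = i := by omega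
      by_cases hik : i = k
      · subst hik
        simp only [h1, if_true]
        rw [coef_mul_self n i]
      · have : ¬ (i : ℕ) = k := fun h => hik (Fin.ext h)
        simp [hik, this, h1]
    · intro j _ hj
      rw [if_neg (fun h => hj (Fin.ext (by simp only; omega))), zero_mul]
    · simp
  · have hin : (i : ℕ) = 0 := by omega
    rw [Finset.sum_eq_zero]
    · simp [hin]
    · intro j _
      rw [if_neg (by omega), zero_mul]

theorem Jthree_mul_Jplus : Jthree n * Jplus n = Jplus n * Jthree n + Jplus n := by
  ext i k
  simp only [Jthree, Matrix.diagonal_mul, Matrix.mul_diagonal, Matrix.add_apply, Jplus_apply]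
  split_ifs with h
  · have : ((k : ℕ) : ℂ) = (i : ℕ) + 1 := by rw [← h]; push_cast; ring
    rw [this]; ring
  · simp

theorem Jthree_mul_Jminus : Jthree n * Jminus n = Jminus n * Jthree n - Jminus n := by
  ext i k
  simp only [Jthree, Matrix.diagonal_mul, Matrix.mul_diagonal, Matrix.sub_apply, Jminus_apply]
  split_ifs with h
  · have : ((i : ℕ) : ℂ) = (k : ℕ) + 1 := by rw [← h]; push_cast; ring
    rw [this]; ring
  · simp

theorem Jplus_mul_Jminus_comm :
    Jplus n * Jminus n = Jminus n * Jplus n + (2 : ℂ) • Jthree n := by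
  rw [Jplus_mul_Jminus, Jminus_mul_Jplus, Jthree, ← Matrix.diagonal_smul, Matrix.diagonal_add]
  congr 1
  ext i
  simp only [Pi.smul_apply, smul_eq_mul]
  ring

/-- With `C = ((n+1)² - 1)/4` one has `4C + 1 = (n+1)²`, which makes `1/(n+1)` the natural expansion
parameter. -/
theorem casimir :
    Jminus n * Jplus n + Jthree n * Jthree n + Jthree n =
      ((((n : ℂ) + 1) ^ 2 - 1) / 4) • (1 : Op n) := by
  rw [Jminus_mul_Jplus, Jthree, Matrix.diagonal_mul_diagonal, Matrix.diagonal_add,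
    Matrix.diagonal_add, ← Matrix.diagonal_one, ← Matrix.diagonal_smul]
  congr 1
  ext i
  simp only [Pi.smul_apply, smul_eq_mul]
  ring

/-- The operator `[J₋, ·]`. -/
abbrev adMinus : Op n →ₗ[ℂ] Op n := innerDer (Jminus n)

theorem trace_adMinus (A : Op n) : (adMinus n A).trace = 0 := by
  rw [innerDer_apply, Matrix.trace_sub, Matrix.trace_mul_comm, sub_self]

theorem trace_adMinus_mul (A B : Op n) :
    (adMinus n A * B).trace = -(A * adMinus n B).trace := by
  rw [eq_neg_iff_add_eq_zero, ← Matrix.trace_add, ← innerDer_mul, trace_adMinus]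

theorem trace_adMinus_iterate_mul (k : ℕ) (A B : Op n) :
    ((adMinus n)^[k] A * B).trace = (-1) ^ k * (A * (adMinus n)^[k] B).trace := by
  induction k generalizing B with
  | zero => simp
  | succ k ih =>
    rw [Function.iterate_succ_apply', trace_adMinus_mul, ih, Function.iterate_succ_apply, pow_succ]
    ring

/-- In the decomposition of `J₋ J₊^(l+1)`, the terms in the image of `[J₋, ·]` have trace zero
against `J₋^l`, which commutes with `J₋`. Only the multiple of `J₊^l` contributes. -/
theorem trace_pow_recursion (l : ℕ) :
    (Jminus n ^ (l + 1) * Jplus n ^ (l + 1)).trace =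
      ((l : ℂ) + 1) * (((n : ℂ) + 1) ^ 2 - ((l : ℂ) + 1) ^ 2) / (4 * l + 6) *
        (Jminus n ^ l * Jplus n ^ l).trace := by
  have key := lower_mul_pow_eq (Jthree_mul_Jplus n) (Jthree_mul_Jminus n)
    (Jplus_mul_Jminus_comm n) (casimir n) (l + 1)
  have z : ∀ A : Op n, (Jminus n ^ l * adMinus n A).trace = 0 := fun A => by
    rw [← neg_eq_zero, ← trace_adMinus_mul, innerDer_self_pow, zero_mul, Matrix.trace_zero]
  rw [pow_succ, mul_assoc, key]
  simp only [mul_add, Matrix.trace_add, mul_smul_comm, Matrix.trace_smul, z,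
    Nat.add_sub_cancel, smul_eq_mul]
  push_cast
  ring

/-- The square of the Hilbert-Schmidt norm of `J₊^l`. -/
def normSqPow (l : ℕ) : ℝ :=
  ((n : ℝ) + 1) * ∏ k ∈ Finset.range l,
    ((k : ℝ) + 1) * (((n : ℝ) + 1) ^ 2 - ((k : ℝ) + 1) ^ 2) / (4 * k + 6)

theorem trace_pow_eq (l : ℕ) : (Jminus n ^ l * Jplus n ^ l).trace = (normSqPow n l : ℂ) := by
  induction l with
  | zero => simp [normSqPow]
  | succ l ih =>
    rw [trace_pow_recursion, ih, normSqPow, normSqPow, Finset.prod_range_succ]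
    push_cast
    ring

theorem normSqPow_pos {l : ℕ} (hl : l ≤ n) : 0 < normSqPow n l := by
  refine mul_pos (by positivity) (Finset.prod_pos fun k hk => ?_)
  have hk' : (k : ℝ) + 1 ≤ n := by
    have := Finset.mem_range.mp hk
    exact_mod_cast (by omega : k + 1 ≤ n)
  have : ((k : ℝ) + 1) ^ 2 < ((n : ℝ) + 1) ^ 2 := by
    apply pow_lt_pow_left₀ <;> first | positivity | linarith
  refine div_pos (mul_pos (by positivity) (by linarith)) (by positivity)

/-- Integration by parts puts all `2 * l` derivatives on one factor, where they turn `J₊^l` into a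
multiple of `J₋^l`. -/
theorem trace_adMinus_iterate_pow_same (l : ℕ) :
    ((adMinus n)^[l] (Jplus n ^ l) * (adMinus n)^[l] (Jplus n ^ l)).trace =
      ((2 * l).factorial : ℂ) * (normSqPow n l : ℂ) := by
  rw [trace_adMinus_iterate_mul, ← Function.iterate_add_apply, ← two_mul,
    (innerDer_iterate_top (Jthree_mul_Jminus n) (Jplus_mul_Jminus_comm n) l).1, mul_smul_comm,
    Matrix.trace_smul, Matrix.trace_mul_comm, trace_pow_eq, smul_eq_mul]
  have : ((-1 : ℂ) ^ l) * (-1) ^ l = 1 := by rw [← mul_pow]; simp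
  linear_combination ((2 * l).factorial : ℂ) * (normSqPow n l : ℂ) * this

theorem adMinus_iterate_eq_zero {l k : ℕ} (hk : 2 * l < k) :
    (adMinus n)^[k] (Jplus n ^ l) = 0 := by
  obtain ⟨r, rfl⟩ := Nat.exists_eq_add_of_lt hk
  rw [show 2 * l + r + 1 = r + (2 * l + 1) by ring, Function.iterate_add_apply,
    (innerDer_iterate_top (Jthree_mul_Jminus n) (Jplus_mul_Jminus_comm n) l).2]
  exact Function.iterate_fixed (map_zero _) r

/-- All `l + l'` derivatives can be put on the factor of smaller degree, and they annihilate it. -/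
theorem trace_adMinus_iterate_pow_ne {l l' : ℕ} (h : l ≠ l') :
    ((adMinus n)^[l] (Jplus n ^ l) * (adMinus n)^[l'] (Jplus n ^ l')).trace = 0 := by
  wlog hlt : l < l' generalizing l l'
  · rw [Matrix.trace_mul_comm]
    exact this h.symm (by omega)
  rw [Matrix.trace_mul_comm, trace_adMinus_iterate_mul, ← Function.iterate_add_apply,
    adMinus_iterate_eq_zero n (by omega), mul_zero, Matrix.trace_zero, mul_zero]

end Spin

/-! ### One-parameter groups -/

/-- A linear map that intertwines two infinitesimal actions intertwines their exponentials. -/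
theorem exp_intertwine {𝔸 𝔹 : Type*} [NormedRing 𝔸] [NormedAlgebra ℝ 𝔸] [CompleteSpace 𝔸]
    [NormedRing 𝔹] [NormedAlgebra ℝ 𝔹] [CompleteSpace 𝔹] (X Y : 𝔸) (A : 𝔹) (ψ : 𝔹 →L[ℝ] 𝔸)
    (h : ∀ M, X * ψ M - ψ M * Y = ψ (A * M)) (M : 𝔹) :
    NormedSpace.exp X * ψ M = ψ (NormedSpace.exp A * M) * NormedSpace.exp Y := by
  let _ := NormedAlgebra.restrictScalars ℚ ℝ 𝔸
  -- This curve is constant: the hypothesis `h`, applied along `exp (tA) M`, says that its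
  -- derivative vanishes.
  let F : ℝ → 𝔸 := fun t => NormedSpace.exp (t • (-X)) * ψ (NormedSpace.exp (t • A) * M) *
    NormedSpace.exp (t • Y)
  have hF : ∀ t, HasDerivAt F 0 t := fun t => by
    have h1 := hasDerivAt_exp_smul_const (-X) t
    have h2 : HasDerivAt (fun t : ℝ => ψ (NormedSpace.exp (t • A) * M))
        (ψ (A * NormedSpace.exp (t • A) * M)) t :=
      ψ.hasFDerivAt.comp_hasDerivAt t ((hasDerivAt_exp_smul_const' A t).mul_const M)
    have h3 := hasDerivAt_exp_smul_const' Y t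
    refine ((h1.mul h2).mul h3).congr_deriv ?_
    rw [mul_assoc A, ← h]
    simp only [Pi.mul_apply]
    noncomm_ring
  have key := is_const_of_deriv_eq_zero (fun t => (hF t).differentiableAt)
    (fun t => (hF t).deriv) 0 1
  simp only [F, zero_smul, NormedSpace.exp_zero, one_mul, mul_one, one_smul] at key
  have hX : NormedSpace.exp X * NormedSpace.exp (-X) = 1 := by
    rw [← NormedSpace.exp_add_of_commute ((Commute.refl X).neg_right), add_neg_cancel,
      NormedSpace.exp_zero]
  rw [key, mul_assoc, ← mul_assoc, ← mul_assoc, hX, one_mul]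

section Rotation

attribute [local instance] Matrix.linftyOpNormedRing Matrix.linftyOpNormedAlgebra

variable (n : ℕ)

/-- The operator `w·J`. -/
def dotJ (w : Fin 3 → ℂ) : Op n := ∑ k, w k • J n k

theorem dotJ_eq (w : Fin 3 → ℂ) : dotJ n w = w 2 • Jthree n + ((w 0 - Complex.I * w 1) / 2) • Jplus n
    + ((w 0 + Complex.I * w 1) / 2) • Jminus n := by
  have h2 : J n 2 = Jthree n := rfl
  have h0 : J n 0 = (1 / 2 : ℂ) • (Jplus n + Jminus n) := rfl
  have h1 : J n 1 = (1 / (2 * Complex.I)) • (Jplus n - Jminus n) := rfl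
  have hI : (1 / (2 * Complex.I)) = -Complex.I / 2 := by
    field_simp; simp
  rw [dotJ, Fin.sum_univ_three, h0, h1, h2, hI]
  module

theorem J_comm_zero_one : J n 0 * J n 1 - J n 1 * J n 0 = Complex.I • J n 2 := by
  have := Jplus_mul_Jminus_comm n
  have h0 : J n 0 = dotJ n ![1, 0, 0] := by simp [dotJ, Fin.sum_univ_three]
  have h1 : J n 1 = dotJ n ![0, 1, 0] := by simp [dotJ, Fin.sum_univ_three]
  have h2 : J n 2 = Jthree n := rfl
  rw [h0, h1, h2, dotJ_eq, dotJ_eq]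
  simp only [Matrix.cons_val, Matrix.cons_val_zero, Matrix.cons_val_one, zero_smul, zero_add,
    mul_add, add_mul, smul_mul_assoc, mul_smul_comm, smul_smul, this, smul_add]
  module

theorem J_comm_one_two : J n 1 * J n 2 - J n 2 * J n 1 = Complex.I • J n 0 := by
  have h0 : J n 0 = dotJ n ![1, 0, 0] := by simp [dotJ, Fin.sum_univ_three]
  have h1 : J n 1 = dotJ n ![0, 1, 0] := by simp [dotJ, Fin.sum_univ_three]
  have h2 : J n 2 = Jthree n := rfl
  rw [h0, h1, h2, dotJ_eq, dotJ_eq]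
  simp only [Matrix.cons_val, Matrix.cons_val_zero, Matrix.cons_val_one, zero_smul, zero_add,
    mul_add, add_mul, smul_mul_assoc, mul_smul_comm, smul_smul, Jthree_mul_Jplus,
    Jthree_mul_Jminus, smul_add]
  match_scalars <;> ring_nf

theorem J_comm_two_zero : J n 2 * J n 0 - J n 0 * J n 2 = Complex.I • J n 1 := by
  have h0 : J n 0 = dotJ n ![1, 0, 0] := by simp [dotJ, Fin.sum_univ_three]
  have h1 : J n 1 = dotJ n ![0, 1, 0] := by simp [dotJ, Fin.sum_univ_three]
  have h2 : J n 2 = Jthree n := rfl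
  rw [h0, h1, h2, dotJ_eq, dotJ_eq]
  simp only [Matrix.cons_val, Matrix.cons_val_zero, Matrix.cons_val_one, zero_smul, zero_add,
    mul_add, add_mul, smul_mul_assoc, mul_smul_comm, smul_smul, Jthree_mul_Jplus,
    Jthree_mul_Jminus, smul_add]
  match_scalars <;> ring_nf
  all_goals simp
  all_goals ring

theorem sum_smul_L (v : Fin 3 → ℝ) :
    ∑ k, v k • L k = !![0, -v 2, v 1; v 2, 0, -v 0; -v 1, v 0, 0] := by
  simp only [Fin.sum_univ_three, L]
  ext i j
  fin_cases i <;> fin_cases j <;> simp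

/-- The infinitesimal covering `su(2) → so(3)`. -/
theorem dotJ_comm (v w : Fin 3 → ℝ) :
    ((-Complex.I) • dotJ n fun k => (v k : ℂ)) * dotJ n (fun k => (w k : ℂ)) -
      dotJ n (fun k => (w k : ℂ)) * ((-Complex.I) • dotJ n fun k => (v k : ℂ)) =
      dotJ n fun k => (((∑ k, v k • L k) *ᵥ w) k : ℝ) := by
  have e01 := eq_add_of_sub_eq (J_comm_zero_one n)
  have e12 := eq_add_of_sub_eq (J_comm_one_two n)
  have e20 := eq_add_of_sub_eq (J_comm_two_zero n)
  rw [sum_smul_L]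
  simp only [dotJ, Fin.sum_univ_three, Matrix.mulVec, dotProduct, Matrix.of_apply, Matrix.cons_val,
    Matrix.cons_val_zero, Matrix.cons_val_one, add_mul, mul_add, smul_mul_assoc, mul_smul_comm,
    smul_add, e01, e12, e20]
  push_cast
  match_scalars <;> ring_nf
  all_goals simp
  all_goals ring

theorem rot_neg (v : Fin 3 → ℝ) : rot (-v) = (rot v)ᵀ := by
  rw [rot, rot, ← Matrix.exp_transpose]
  congr 1
  rw [sum_smul_L, sum_smul_L]
  ext i j
  fin_cases i <;> fin_cases j <;> simp

theorem rot_mul_rot_neg (v : Fin 3 → ℝ) : rot v * rot (-v) = 1 := by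
  rw [rot, rot, ← Matrix.exp_add_of_commute]
  · simp
  · simp only [Pi.neg_apply, neg_smul, Finset.sum_neg_distrib]
    exact (Commute.refl _).neg_right

theorem spinRot_neg_eq (v : Fin 3 → ℝ) :
    spinRot n (-v) = NormedSpace.exp (-((-Complex.I) • dotJ n fun k => (v k : ℂ))) := by
  rw [spinRot]
  congr 1
  simp [dotJ, Finset.sum_neg_distrib]

theorem spinRot_mul_spinRot_neg (v : Fin 3 → ℝ) : spinRot n v * spinRot n (-v) = 1 := by
  rw [spinRot_neg_eq, spinRot, ← Matrix.exp_add_of_commute]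
  · simp [dotJ]
  · exact (Commute.refl _).neg_right

theorem spinRot_neg_mul_spinRot (v : Fin 3 → ℝ) : spinRot n (-v) * spinRot n v = 1 := by
  simpa using spinRot_mul_spinRot_neg n (-v)

/-- The covering `SU(2) → SO(3)`. -/
theorem spinRot_mul_dotJ (v w : Fin 3 → ℝ) :
    spinRot n v * dotJ n (fun k => (w k : ℂ)) =
      dotJ n (fun k => ((rot v *ᵥ w) k : ℝ)) * spinRot n v := by
  let ψ : Matrix (Fin 3) (Fin 3) ℝ →ₗ[ℝ] Op n :=
    { toFun := fun M => dotJ n fun k => (((M *ᵥ w) k : ℝ) : ℂ)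
      map_add' := fun M M' => by
        simp only [dotJ, Matrix.add_mulVec, Pi.add_apply, Complex.ofReal_add, add_smul,
          Finset.sum_add_distrib]
      map_smul' := fun r M => by
        simp only [dotJ, Matrix.smul_mulVec, Pi.smul_apply, smul_eq_mul, Complex.ofReal_mul,
          Finset.smul_sum, mul_smul, RingHom.id_apply, Complex.coe_smul] }
  have key := exp_intertwine ((-Complex.I) • dotJ n fun k => (v k : ℂ))
    ((-Complex.I) • dotJ n fun k => (v k : ℂ)) (∑ k, v k • L k)
    (LinearMap.toContinuousLinearMap ψ)
    (fun M => by
      simp only [LinearMap.coe_toContinuousLinearMap', ψ, LinearMap.coe_mk, AddHom.coe_mk]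
      rw [dotJ_comm, ← Matrix.mulVec_mulVec]) 1
  simp only [LinearMap.coe_toContinuousLinearMap', ψ, LinearMap.coe_mk, AddHom.coe_mk,
    Matrix.one_mulVec, mul_one] at key
  exact key

/-- In spherical coordinates `θ`, `φ`, the point is reached from the pole by the rotation through
`θ` about the horizontal axis `(-sin φ, cos φ, 0)`. -/
theorem exists_rot_northPole (x : S2) :
    ∃ v, (x : E3).ofLp = rot v *ᵥ (northPole : E3).ofLp := by
  have hx : (x : E3) 0 ^ 2 + (x : E3) 1 ^ 2 + (x : E3) 2 ^ 2 = 1 := by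
    have := x.2
    rw [mem_sphere_zero_iff_norm, EuclideanSpace.norm_eq, Real.sqrt_eq_one,
      Fin.sum_univ_three] at this
    simpa using this
  set z : ℂ := ⟨(x : E3) 0, (x : E3) 1⟩ with hz
  set θ := Real.arccos ((x : E3) 2)
  have hc : Real.cos θ = (x : E3) 2 :=
    Real.cos_arccos (by nlinarith [sq_nonneg ((x : E3) 0), sq_nonneg ((x : E3) 1)])
      (by nlinarith [sq_nonneg ((x : E3) 0), sq_nonneg ((x : E3) 1)])
  have hs : Real.sin θ = ‖z‖ := by
    rw [Real.sin_arccos, Complex.norm_def, Complex.normSq_mk]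
    congr 1
    linarith
  have h0 : ‖z‖ * Real.cos z.arg = (x : E3) 0 := Complex.norm_mul_cos_arg z
  have h1 : ‖z‖ * Real.sin z.arg = (x : E3) 1 := Complex.norm_mul_sin_arg z
  have hcs := Real.sin_sq_add_cos_sq z.arg
  set φ := z.arg
  let m : Fin 3 → ℝ := ![Real.cos φ, Real.sin φ, 0]
  -- The plane of rotation is identified with `ℂ`, the pole being `1` and `m` being `i`, so that
  -- rotating is multiplication by `exp (iθ)`. Vectors are encoded as matrices with equal columns
  -- because `exp_intertwine` needs values in an algebra.
  let ψ : ℂ →ₗ[ℝ] Matrix (Fin 3) (Fin 3) ℝ :=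
    { toFun := fun u => u.re • Matrix.of (fun i _ => (![0, 0, 1] : Fin 3 → ℝ) i)
        + u.im • Matrix.of (fun i _ => m i)
      map_add' := fun u u' => by
        simp only [Complex.add_re, Complex.add_im, add_smul]; abel
      map_smul' := fun r u => by simp [mul_smul] }
  refine ⟨![-θ * Real.sin φ, θ * Real.cos φ, 0], ?_⟩
  have key := exp_intertwine (∑ k, (![-θ * Real.sin φ, θ * Real.cos φ, 0] : Fin 3 → ℝ) k • L k) 0
    ((θ : ℂ) * Complex.I) (LinearMap.toContinuousLinearMap ψ)
    (fun u => by
      rw [sum_smul_L]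
      ext i j
      simp only [LinearMap.coe_toContinuousLinearMap', ψ, LinearMap.coe_mk, AddHom.coe_mk, mul_zero,
        sub_zero, m]
      fin_cases i <;> simp [Matrix.mul_apply, Fin.sum_univ_three] <;>
        first | ring1 | linear_combination (-θ * u.im) * hcs) 1
  rw [NormedSpace.exp_zero, mul_one, mul_one] at key
  have hexp : NormedSpace.exp ((θ : ℂ) * Complex.I) = Complex.exp (θ * Complex.I) := by
    rw [Complex.exp_eq_exp_ℂ]
  rw [hexp, Complex.exp_mul_I, ← Complex.ofReal_cos, ← Complex.ofReal_sin] at key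
  funext i
  have ki := congrFun (congrFun key i) 0
  simp only [LinearMap.coe_toContinuousLinearMap', ψ, LinearMap.coe_mk, AddHom.coe_mk] at ki
  rw [rot, Matrix.mulVec, dotProduct]
  rw [Matrix.mul_apply] at ki
  simp only [Complex.one_re, Complex.one_im, one_smul, zero_smul, Matrix.of_apply,
    Matrix.add_apply, Matrix.smul_apply, smul_eq_mul] at ki
  refine Eq.trans ?_ (ki.symm.trans (Finset.sum_congr rfl fun j _ => ?_))
  swap
  · rw [Matrix.zero_apply, add_zero]; rfl
  fin_cases i <;> simp [m, hc, hs, h0, h1]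

end Rotation

/-! ### Symbols of the powers of the raising operator -/

section Torus

variable (n : ℕ)

/-- The diagonal matrix with entries `τ^i`. -/
def torus (τ : ℂ) : Op n := Matrix.diagonal fun i => τ ^ (i : ℕ)

theorem torus_mul_torus_inv {τ : ℂ} (hτ : τ ≠ 0) : torus n τ * torus n τ⁻¹ = 1 := by
  rw [torus, torus, Matrix.diagonal_mul_diagonal, ← Matrix.diagonal_one]
  congr 1
  ext i
  rw [← mul_pow, mul_inv_cancel₀ hτ, one_pow]

theorem Jplus_mul_torus (τ : ℂ) : Jplus n * torus n τ = τ • (torus n τ * Jplus n) := by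
  ext i k
  simp only [torus, Matrix.mul_diagonal, Matrix.smul_apply, Matrix.diagonal_mul, Jplus_apply,
    smul_eq_mul]
  split_ifs with h
  · rw [← h]; ring
  · simp

theorem torus_mul_Jminus (τ : ℂ) : torus n τ * Jminus n = τ • (Jminus n * torus n τ) := by
  ext i k
  simp only [torus, Matrix.mul_diagonal, Matrix.smul_apply, Matrix.diagonal_mul, Jminus_apply,
    smul_eq_mul]
  split_ifs with h
  · rw [← h]; ring
  · simp

theorem torus_mul_Jthree (τ : ℂ) : torus n τ * Jthree n = Jthree n * torus n τ := by
  rw [torus, Jthree, Matrix.diagonal_mul_diagonal, Matrix.diagonal_mul_diagonal]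
  congr 1
  ext i
  ring

/-- The operator has weight `l - k`; putting a power of `τ` on each side avoids a negative exponent.
For `k = l` this gives commutation with the torus. -/
theorem torus_mul_iterate (τ : ℂ) (l k : ℕ) :
    τ ^ l • (torus n τ * (adMinus n)^[k] (Jplus n ^ l)) =
      τ ^ k • ((adMinus n)^[k] (Jplus n ^ l) * torus n τ) := by
  induction k with
  | zero =>
    simp only [Function.iterate_zero, id, pow_zero, one_smul]
    induction l with
    | zero => simp
    | succ l ih =>
      rw [pow_succ (Jplus n), mul_assoc (Jplus n ^ l), Jplus_mul_torus, mul_smul_comm,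
        ← mul_assoc (Jplus n ^ l), ← ih, smul_mul_assoc, smul_smul, mul_assoc, pow_succ']
  | succ k ih =>
    rw [Function.iterate_succ_apply']
    set A := (adMinus n)^[k] (Jplus n ^ l)
    rw [innerDer_apply, mul_sub, sub_mul, ← mul_assoc, torus_mul_Jminus, smul_mul_assoc, mul_assoc,
      ← mul_assoc (torus n τ) A, smul_sub, smul_comm, ← mul_smul_comm, ih, ← smul_mul_assoc (τ ^ l),
      ih, mul_assoc A, smul_mul_assoc, mul_assoc A (torus n τ), torus_mul_Jminus]
    simp only [mul_smul_comm, smul_sub, mul_assoc, pow_succ']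
    module

variable {n}

theorem trace_conj_torus {τ : ℂ} (hτ : τ ≠ 0) {K : Op n} (hK : torus n τ * K = K * torus n τ)
    (u p q : ℂ) (l : ℕ) :
    ((u • Jthree n + p • Jplus n + q • Jminus n) ^ l * K).trace =
      ((u • Jthree n + (p * τ) • Jplus n + (q * τ⁻¹) • Jminus n) ^ l * K).trace := by
  set A := u • Jthree n + p • Jplus n + q • Jminus n
  set B := u • Jthree n + (p * τ) • Jplus n + (q * τ⁻¹) • Jminus n
  have h1 : A * torus n τ = torus n τ * B := by
    simp only [A, B, add_mul, mul_add, smul_mul_assoc, mul_smul_comm, torus_mul_Jthree,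
      Jplus_mul_torus, torus_mul_Jminus, smul_smul]
    rw [inv_mul_cancel_right₀ hτ]
  have h2 : A ^ l * torus n τ = torus n τ * B ^ l := by
    have : SemiconjBy (torus n τ) B A := h1.symm
    exact (this.pow_right l).symm
  have h3 := torus_mul_torus_inv n hτ
  calc (A ^ l * K).trace = (A ^ l * (torus n τ * torus n τ⁻¹) * K).trace := by rw [h3, mul_one]
    _ = (torus n τ * (B ^ l * torus n τ⁻¹ * K)).trace := by
      rw [← mul_assoc, h2]; simp only [mul_assoc]
    _ = (B ^ l * (torus n τ⁻¹ * (K * torus n τ))).trace := by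
      rw [Matrix.trace_mul_comm]; simp only [mul_assoc]
    _ = (B ^ l * K).trace := by
      rw [← hK, ← mul_assoc (torus n τ⁻¹), mul_eq_one_comm.mp h3, one_mul]

/-- The trace against a torus-invariant operator of a power of `a·J`, for an isotropic vector `a`,
depends only on the third coordinate of `a`. -/
theorem trace_isotropic_pow {K : Op n} (hK : ∀ τ ≠ 0, torus n τ * K = K * torus n τ) (a : Fin 3 → ℂ)
    (ha : a 0 ^ 2 + a 1 ^ 2 + a 2 ^ 2 = 0) (l : ℕ) :
    (dotJ n a ^ l * K).trace =
      a 2 ^ l * ((Jthree n + (1 / 2 : ℂ) • Jplus n + (-1 / 2 : ℂ) • Jminus n) ^ l * K).trace := by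
  rw [dotJ_eq]
  set p := (a 0 - Complex.I * a 1) / 2 with hp
  set q := (a 0 + Complex.I * a 1) / 2 with hq
  have hpq : 4 * (p * q) = -a 2 ^ 2 := by
    rw [hp, hq]
    linear_combination ha - a 1 ^ 2 * Complex.I_sq
  -- If `a 2 = 0`, then `a·J` is a multiple of `J₊` or of `J₋`. For `l > 0` the trace equals `2 ^ l`
  -- times itself under a torus conjugation, hence vanishes.
  by_cases h : a 2 = 0
  · rcases Nat.eq_zero_or_pos l with rfl | hl
    · simp
    rw [h, zero_pow hl.ne', zero_mul, zero_smul, zero_add]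
    rw [h] at hpq
    have two : (2 : ℂ) ^ l ≠ 1 := by
      intro h2
      have : (2 ^ l : ℕ) = 1 := by exact_mod_cast h2
      exact absurd this (Nat.one_lt_two_pow hl.ne').ne'
    rcases mul_eq_zero.mp (show p * q = 0 by linear_combination hpq / 4) with h0 | h0 <;> rw [h0]
    · have := trace_conj_torus (τ := 2⁻¹) (by simp) (hK _ (by simp)) 0 0 q l
      simp only [zero_smul, zero_mul, zero_add, smul_pow, mul_pow, smul_mul_assoc,
        Matrix.trace_smul, smul_eq_mul, inv_inv] at this ⊢
      have h' : (2 ^ l - 1) * (q ^ l * (Jminus n ^ l * K).trace) = 0 := by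
        linear_combination -this
      exact (mul_eq_zero.mp h').resolve_left (sub_ne_zero.mpr two)
    · have := trace_conj_torus (τ := 2) (by simp) (hK _ (by simp)) 0 p 0 l
      simp only [zero_smul, zero_mul, zero_add, add_zero, smul_pow, mul_pow, smul_mul_assoc,
        Matrix.trace_smul, smul_eq_mul] at this ⊢
      have h' : (2 ^ l - 1) * (p ^ l * (Jplus n ^ l * K).trace) = 0 := by
        linear_combination -this
      exact (mul_eq_zero.mp h').resolve_left (sub_ne_zero.mpr two)
  · have hp0 : p ≠ 0 := by
      rintro h0
      rw [h0] at hpq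
      exact h (pow_eq_zero_iff (two_ne_zero) |>.mp (by linear_combination hpq))
    -- This torus element makes the coefficient of `J₊` equal to `a 2 / 2`; isotropy then forces the
    -- coefficient of `J₋` to be `-a 2 / 2`.
    have hτ : a 2 / (2 * p) ≠ 0 := div_ne_zero h (by simp [hp0])
    have key := trace_conj_torus hτ (hK _ hτ) (a 2) p q l
    have e1 : p * (a 2 / (2 * p)) = a 2 * (1 / 2) := by field_simp
    have e2 : q * (a 2 / (2 * p))⁻¹ = a 2 * (-1 / 2) := by
      field_simp
      linear_combination hpq
    rw [key, e1, e2, ← smul_smul, ← smul_smul, ← smul_add, ← smul_add, smul_pow, smul_mul_assoc,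
      Matrix.trace_smul, smul_eq_mul]

end Torus

/-! ### Normalization constants of the coupled basis and of the spherical harmonics. -/

section Aux

/-- The matrices `e^j(l, l-k)` as multiples of iterated commutators. -/
theorem coupledAux_eq (n l k : ℕ) :
    coupledAux n l k = (((∏ j ∈ Finset.range k, 1 / beta l ((l : ℤ) - j)) *
      ((-1) ^ l / √(normSqPow n l)) : ℝ) : ℂ) • (adMinus n)^[k] (Jplus n ^ l) := by
  induction k with
  | zero => simp [coupledAux, trace_pow_eq]
  | succ k ih =>
    rw [coupledAux, ih, Function.iterate_succ_apply', innerDer_apply, mul_smul_comm, smul_mul_assoc,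
      ← smul_sub, smul_smul, Finset.prod_range_succ]
    push_cast
    congr 1
    ring

/-- The polynomial `x + iy`. -/
def xplus : MvPolynomial (Fin 3) ℂ := MvPolynomial.X 0 + Complex.I • MvPolynomial.X 1

/-- The polynomial `x - iy`. -/
def xminus : MvPolynomial (Fin 3) ℂ := MvPolynomial.X 0 - Complex.I • MvPolynomial.X 1

theorem lowering_xplus : lowering xplus = (-2 : ℂ) • MvPolynomial.X 2 := by
  simp only [xplus, lowering, map_add, Derivation.map_smul, MvPolynomial.mkDerivation_X,
    Matrix.cons_val_zero, Matrix.cons_val_one, smul_smul, Complex.I_mul_I]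
  module

theorem lowering_z : lowering (MvPolynomial.X 2) = xminus := by
  simp [lowering, MvPolynomial.mkDerivation_X, xminus]

theorem lowering_xminus : lowering xminus = 0 := by
  simp only [xminus, lowering, map_sub, Derivation.map_smul, MvPolynomial.mkDerivation_X,
    Matrix.cons_val_zero, Matrix.cons_val_one, smul_smul, Complex.I_mul_I]
  module

/-- The unnormalized spherical harmonics `J₋^k (x+iy)^l`. -/
def bPoly (l k : ℕ) : MvPolynomial (Fin 3) ℂ := lowering^[k] (xplus ^ l)

theorem lowering_bPoly (l k : ℕ) : lowering (bPoly l k) = bPoly l (k + 1) := by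
  rw [bPoly, bPoly, Function.iterate_succ_apply']

/-- The normalization of the spherical harmonics. -/
def harmonicCoef (l k : ℕ) : ℝ :=
  (∏ j ∈ Finset.range k, 1 / beta l ((l : ℤ) - j)) *
    ((-1) ^ l / ((l.factorial : ℝ) * 2 ^ l / √((2 * l + 1).factorial : ℝ)))

theorem harmonicAux_eq (l k : ℕ) : harmonicAux l k = (harmonicCoef l k : ℂ) • bPoly l k := by
  induction k with
  | zero => simp [harmonicAux, bPoly, harmonicCoef, xplus]
  | succ k ih =>
    rw [harmonicAux, ih, Derivation.map_smul, lowering_bPoly, smul_smul, harmonicCoef, harmonicCoef,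
      Finset.prod_range_succ]
    push_cast
    congr 1
    ring

theorem beta_pos {l j : ℕ} (hj : j < 2 * l) : 0 < beta l ((l : ℤ) - j) := by
  have : (j : ℝ) < 2 * l := by exact_mod_cast hj
  refine Real.sqrt_pos.mpr (mul_pos ?_ ?_) <;> push_cast
  · linarith
  · have : (0 : ℝ) ≤ j := by positivity
    linarith

theorem harmonicCoef_ne_zero {l k : ℕ} (hk : k ≤ 2 * l) : harmonicCoef l k ≠ 0 := by
  refine mul_ne_zero (Finset.prod_ne_zero_iff.mpr fun j hj => ?_) ?_
  · exact one_div_ne_zero (beta_pos (by have := Finset.mem_range.mp hj; omega)).ne'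
  · refine div_ne_zero (by simp) (div_ne_zero (by positivity) ?_)
    exact (Real.sqrt_pos.mpr (by positivity)).ne'

/-- Since `β_{l,l-j}² = (2l-j)(j+1)`, the product over `j < l` of these squares is `((2l)!/l!) *
l!`. The induction keeps both partial factorials. -/
theorem prod_beta (l : ℕ) :
    (∏ j ∈ Finset.range l, 1 / beta l ((l : ℤ) - j)) ^ 2 * ((2 * l).factorial : ℝ) = 1 := by
  have h : ∀ k ≤ l, (∏ j ∈ Finset.range k, 1 / beta l ((l : ℤ) - j)) ^ 2 *
      ((2 * l).factorial : ℝ) * k.factorial = (2 * l - k).factorial := by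
    intro k
    induction k with
    | zero => simp
    | succ k ih =>
      intro hk
      have hb : beta l ((l : ℤ) - k) ^ 2 = (2 * l - k) * (k + 1) := by
        rw [beta, Real.sq_sqrt]
        · push_cast; ring
        · have : (k : ℝ) ≤ l := by exact_mod_cast (by omega : k ≤ l)
          have h0 : (0 : ℝ) ≤ k := by positivity
          push_cast
          exact mul_nonneg (by linarith) (by linarith)
      have hb0 := (beta_pos (l := l) (j := k) (by omega)).ne'
      obtain ⟨r, hr⟩ : ∃ r, 2 * l - k = r + 1 := ⟨2 * l - k - 1, by omega⟩
      have hr' : (2 * l - k : ℝ) = r + 1 := by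
        have : (2 * l : ℕ) = k + (r + 1) := by omega
        have : (2 * l : ℝ) = k + (r + 1) := by exact_mod_cast this
        linarith
      have hr2 : 2 * l - (k + 1) = r := by omega
      have ih' := ih (by omega)
      rw [hr, Nat.factorial_succ] at ih'
      rw [hr'] at hb
      rw [Finset.prod_range_succ, hr2, Nat.factorial_succ, mul_pow, div_pow, hb]
      push_cast at ih' ⊢
      have hr0 : (r : ℝ) + 1 ≠ 0 := by positivity
      have hk0 : (k : ℝ) + 1 ≠ 0 := by positivity
      field_simp
      simp only [one_div] at ih' ⊢
      linear_combination ih'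
  have := h l le_rfl
  rw [show 2 * l - l = l by omega] at this
  have h0 : (l.factorial : ℝ) ≠ 0 := by positivity
  exact mul_right_cancel₀ h0 (by rw [this, one_mul])

end Aux

/-! ### The symbols of the coupled basis -/

/-- A point of the sphere as a point of `ℂ³`. -/
def pt (p : S2) : Fin 3 → ℂ := fun k => ((p : E3) k : ℂ)

theorem sum_pt_sq (p : S2) : pt p 0 ^ 2 + pt p 1 ^ 2 + pt p 2 ^ 2 = 1 := by
  have := p.2
  rw [mem_sphere_zero_iff_norm, EuclideanSpace.norm_eq, Real.sqrt_eq_one,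
    Fin.sum_univ_three] at this
  simp only [Real.norm_eq_abs, sq_abs] at this
  simp only [pt]
  exact_mod_cast this

theorem eval_xplus (u : Fin 3 → ℂ) : MvPolynomial.eval u xplus = u 0 + Complex.I * u 1 := by
  simp [xplus, MvPolynomial.smul_eval]

theorem eval_xminus (u : Fin 3 → ℂ) : MvPolynomial.eval u xminus = u 0 - Complex.I * u 1 := by
  simp [xminus, MvPolynomial.smul_eval]

/-- Both `x+iy` and `x-iy` vanish at the pole, so only the middle Leibniz term, with one derivative
on the new factor, survives. The value being nonzero allows scalars to be read off at the pole. -/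
theorem eval_northPole_bPoly (l : ℕ) :
    MvPolynomial.eval (pt northPole) (bPoly l l) = (l.factorial : ℂ) * (-2) ^ l := by
  have h0 : MvPolynomial.eval (pt northPole) xplus = 0 := by
    rw [eval_xplus]; simp [pt, northPole]
  have h1 : MvPolynomial.eval (pt northPole) xminus = 0 := by
    rw [eval_xminus]; simp [pt, northPole]
  have h2 : MvPolynomial.eval (pt northPole) (MvPolynomial.X 2) = 1 := by
    simp [pt, northPole]
  induction l with
  | zero => simp [bPoly]
  | succ l ih =>
    cases l with
    | zero =>
      simp [bPoly, lowering_xplus, MvPolynomial.smul_eval, pt, northPole]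
    | succ l =>
      have key := iterate_leibniz lowering.toLinearMap
        (fun x y => by simp [Derivation.leibniz]; ring) xplus (xplus ^ (l + 1))
        (by simp [lowering_xplus, lowering_z, lowering_xminus]) l
      simp only [Derivation.coeFn_coe] at key
      rw [bPoly] at ih
      rw [bPoly, pow_succ' xplus (l + 1), key, lowering_xplus, Derivation.map_smul, lowering_z]
      simp only [map_add, map_mul, MvPolynomial.smul_eval, h0, h1, h2, ih, Nat.factorial_succ (l + 1)]
      push_cast
      ring

/-- The ratio of the characteristic numbers of `W` and of `W_{(2J₊/(n+1))^l} / (x+iy)^l`. -/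
def ratioNum (n l : ℕ) : ℝ :=
  √(∏ k ∈ Finset.range l, (1 - ((k : ℝ) + 1) ^ 2 / ((n : ℝ) + 1) ^ 2))

/-- The right side collects the constants that appear when the kernel is paired with `[J₋, ·]^l
J₊^l`; the definition is the form in which the limit is visible. -/
theorem ratioNum_eq (n l : ℕ) :
    ratioNum n l = √((2 * (l : ℝ) + 1) / ((n : ℝ) + 1)) *
      (∏ j ∈ Finset.range l, 1 / beta l ((l : ℤ) - j)) * √(normSqPow n l) * (2 * l).factorial /
        (l.factorial * ((n : ℝ) + 1) ^ l) := by
  set P := ∏ j ∈ Finset.range l, 1 / beta l ((l : ℤ) - j) with hP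
  have hP0 : 0 ≤ P := Finset.prod_nonneg fun j _ => one_div_nonneg.mpr (Real.sqrt_nonneg _)
  have hP2 : P ^ 2 * ((2 * l).factorial : ℝ) = 1 := prod_beta l
  have hf : (((2 * l).factorial : ℕ) : ℝ) ≠ 0 := by positivity
  have hPs : P = √(1 / ((2 * l).factorial : ℝ)) := by
    rw [eq_comm, Real.sqrt_eq_iff_mul_self_eq (by positivity) hP0]
    field_simp
    linarith
  have hN : (n : ℝ) + 1 ≠ 0 := by positivity
  have hl : (l.factorial : ℝ) ≠ 0 := by positivity
  rw [eq_div_iff (by positivity), hPs, ratioNum]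
  rw [← Real.sqrt_mul (by positivity), ← Real.sqrt_mul (by positivity)]
  have e1 : ((l.factorial : ℝ) * ((n : ℝ) + 1) ^ l) =
      √(((l.factorial : ℝ) * ((n : ℝ) + 1) ^ l) ^ 2) := (Real.sqrt_sq (by positivity)).symm
  have e2 : ((2 * l).factorial : ℝ) = √(((2 * l).factorial : ℝ) ^ 2) :=
    (Real.sqrt_sq (by positivity)).symm
  conv_lhs => rw [e1, ← Real.sqrt_mul' _ (by positivity)]
  conv_rhs => rw [e2, ← Real.sqrt_mul' _ (by positivity)]
  rw [Real.sqrt_sq (by positivity)]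
  congr 1
  have key : ((2 * l + 1).factorial : ℝ) * ∏ k ∈ Finset.range l,
      ((k : ℝ) + 1) * (((n : ℝ) + 1) ^ 2 - ((k : ℝ) + 1) ^ 2) / (4 * k + 6) =
      (l.factorial : ℝ) ^ 2 * ((n : ℝ) + 1) ^ (2 * l) *
        ∏ k ∈ Finset.range l, (1 - ((k : ℝ) + 1) ^ 2 / ((n : ℝ) + 1) ^ 2) := by
    clear * - hN
    induction l with
    | zero => simp
    | succ l ih =>
      rw [Finset.prod_range_succ, Finset.prod_range_succ, Nat.factorial_succ l,
        show 2 * (l + 1) + 1 = (2 * l + 1) + 1 + 1 by ring, Nat.factorial_succ,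
        Nat.factorial_succ (2 * l + 1)]
      have h6 : 4 * (l : ℝ) + 6 ≠ 0 := by positivity
      set P1 := ∏ k ∈ Finset.range l,
        ((k : ℝ) + 1) * (((n : ℝ) + 1) ^ 2 - ((k : ℝ) + 1) ^ 2) / (4 * k + 6)
      set P2 := ∏ k ∈ Finset.range l, (1 - ((k : ℝ) + 1) ^ 2 / ((n : ℝ) + 1) ^ 2)
      push_cast
      have e : (1 - ((l : ℝ) + 1) ^ 2 / ((n : ℝ) + 1) ^ 2) * ((n : ℝ) + 1) ^ 2 =
        ((n : ℝ) + 1) ^ 2 - ((l : ℝ) + 1) ^ 2 := by field_simp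
      have e' : ((l : ℝ) + 1) * (((n : ℝ) + 1) ^ 2 - ((l : ℝ) + 1) ^ 2) / (4 * l + 6) *
          ((2 * l + 1 + 1 + 1) * (2 * l + 1 + 1)) =
          ((l : ℝ) + 1) ^ 2 * (((n : ℝ) + 1) ^ 2 - ((l : ℝ) + 1) ^ 2) := by
        field_simp; ring
      rw [← e] at e'
      rw [← e]
      linear_combination (((l : ℝ) + 1) ^ 2 * ((1 - ((l : ℝ) + 1) ^ 2 / ((n : ℝ) + 1) ^ 2) *
        ((n : ℝ) + 1) ^ 2)) * ih + ((2 * l + 1).factorial : ℝ) * P1 * e'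
  rw [Nat.factorial_succ] at key
  push_cast at key
  have expand : (2 * (l : ℝ) + 1) / ((n : ℝ) + 1) * (1 / ((2 * l).factorial : ℝ)) * normSqPow n l *
      ((2 * l).factorial : ℝ) ^ 2 = (2 * (l : ℝ) + 1) * ((2 * l).factorial : ℝ) *
        ∏ k ∈ Finset.range l,
          ((k : ℝ) + 1) * (((n : ℝ) + 1) ^ 2 - ((k : ℝ) + 1) ^ 2) / (4 * k + 6) := by
    rw [normSqPow]
    generalize ∏ k ∈ Finset.range l, ((k : ℝ) + 1) * (((n : ℝ) + 1) ^ 2 - ((k : ℝ) + 1) ^ 2) /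
      (4 * k + 6) = Q
    field_simp
  rw [expand, key]
  ring

theorem ratioNum_pos {n l : ℕ} (hl : l ≤ n) : 0 < ratioNum n l := by
  refine Real.sqrt_pos.mpr (Finset.prod_pos fun k hk => ?_)
  have hk' : (k : ℝ) + 1 ≤ n := by
    have := Finset.mem_range.mp hk
    exact_mod_cast (by omega : k + 1 ≤ n)
  have : ((k : ℝ) + 1) ^ 2 < ((n : ℝ) + 1) ^ 2 := by
    apply pow_lt_pow_left₀ <;> first | positivity | linarith
  rw [sub_pos, div_lt_one (by positivity)]
  exact this

/-! ### Torus invariance of the operator kernel and its pairing with weight-zero operators. -/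

section Kernel

variable {n : ℕ} {c : ℕ → ℝ}

/-- The multiple of the identity is the term `l = 0`, because `e^j(0,0) = I/√(n+1)`. -/
theorem kernel_eq (hc : c 0 = 1) : kernel n c = ∑ l ∈ Finset.range (n + 1),
    ((c l * √((2 * (l : ℝ) + 1) / ((n : ℝ) + 1)) : ℝ) : ℂ) • coupledAux n l l := by
  rw [Finset.sum_range_succ', add_comm, kernel]
  congr 1
  · rw [coupledAux_eq, hc]
    simp only [Function.iterate_zero, id, pow_zero, smul_smul]
    congr 1
    rw [← Complex.ofReal_mul, normSqPow]
    simp only [Finset.range_zero, Finset.prod_empty, CharP.cast_eq_zero, mul_zero, zero_add,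
      one_mul, mul_one]
    rw [Real.sqrt_div zero_le_one, Real.sqrt_one, div_mul_div_comm, one_mul,
      Real.mul_self_sqrt (by positivity)]
    push_cast
    ring
  · rw [Finset.range_eq_Ico, Finset.sum_Ico_add' (fun l =>
      ((c l * √((2 * (l : ℝ) + 1) / ((n : ℝ) + 1)) : ℝ) : ℂ) • coupledAux n l l)]
    refine Finset.sum_congr (by ext; simp) fun l _ => ?_
    simp [coupled]

theorem torus_mul_kernel (hc : c 0 = 1) (τ : ℂ) (hτ : τ ≠ 0) :
    torus n τ * kernel n c = kernel n c * torus n τ := by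
  rw [kernel_eq hc, Finset.mul_sum, Finset.sum_mul]
  refine Finset.sum_congr rfl fun l _ => ?_
  rw [mul_smul_comm, smul_mul_assoc, coupledAux_eq, mul_smul_comm, smul_mul_assoc]
  have := torus_mul_iterate n τ l l
  rw [smul_right_injective _ (pow_ne_zero l hτ) this]

theorem trace_mul_kernel (hc : c 0 = 1) {l : ℕ} (hl : l ≤ n) :
    ((adMinus n)^[l] (Jplus n ^ l) * kernel n c).trace =
      ((c l * ratioNum n l * (l.factorial * ((n : ℝ) + 1) ^ l) * (-1) ^ l : ℝ) : ℂ) := by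
  rw [kernel_eq hc, Finset.mul_sum, Matrix.trace_sum, Finset.sum_eq_single l]
  · rw [mul_smul_comm, coupledAux_eq, mul_smul_comm, Matrix.trace_smul, Matrix.trace_smul,
      trace_adMinus_iterate_pow_same, ratioNum_eq, smul_eq_mul, smul_eq_mul]
    have h := normSqPow_pos n hl
    have hs : √(normSqPow n l) ≠ 0 := (Real.sqrt_pos.mpr h).ne'
    have hs2 : √(normSqPow n l) ^ 2 = normSqPow n l := Real.sq_sqrt h.le
    norm_cast
    set s := √(normSqPow n l)
    rw [← hs2]
    have hN : (n : ℝ) + 1 ≠ 0 := by positivity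
    push_cast
    field_simp
  · intro l' _ hne
    rw [mul_smul_comm, coupledAux_eq, mul_smul_comm, Matrix.trace_smul, Matrix.trace_smul,
      trace_adMinus_iterate_pow_ne n hne.symm, smul_zero, smul_zero]
  · intro h
    exact absurd (Finset.mem_range.mpr (by omega)) h

end Kernel

/-! ### From equivariance to the symbols of the operators `bOp`. -/

/-- The chain rule for a polynomial along a curve. -/
theorem hasDerivAt_eval {u : ℝ → Fin 3 → ℂ} {u' : Fin 3 → ℂ} {t : ℝ}
    (hu : ∀ j, HasDerivAt (fun s => u s j) (u' j) t) (F : MvPolynomial (Fin 3) ℂ) :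
    HasDerivAt (fun s => MvPolynomial.eval (u s) F)
      (∑ j, u' j * MvPolynomial.eval (u t) (MvPolynomial.pderiv j F)) t := by
  induction F using MvPolynomial.induction_on with
  | C a => simpa using hasDerivAt_const t a
  | add p q hp hq =>
    simp only [map_add, mul_add, Finset.sum_add_distrib]
    exact hp.add hq
  | mul_X p i hp =>
    simp only [map_mul, MvPolynomial.eval_X]
    refine (hp.mul (hu i)).congr_deriv ?_
    simp only [Derivation.leibniz, smul_eq_mul, map_add, map_mul, MvPolynomial.eval_X, mul_add,
      Finset.sum_add_distrib, Finset.sum_mul]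
    rw [add_comm]
    congr 1
    · rw [Finset.sum_eq_single i]
      · simp; ring
      · intro j _ hj
        simp [MvPolynomial.pderiv_X_of_ne hj.symm]
      · simp
    · exact Finset.sum_congr rfl fun j _ => by ring

theorem lowering_eq (F : MvPolynomial (Fin 3) ℂ) :
    lowering F = -MvPolynomial.X 2 * MvPolynomial.pderiv 0 F +
      (Complex.I • MvPolynomial.X 2) * MvPolynomial.pderiv 1 F +
      (MvPolynomial.X 0 - Complex.I • MvPolynomial.X 1) * MvPolynomial.pderiv 2 F := by
  have : lowering = (-MvPolynomial.X 2 : MvPolynomial (Fin 3) ℂ) • MvPolynomial.pderiv 0 +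
      (Complex.I • MvPolynomial.X 2 : MvPolynomial (Fin 3) ℂ) • MvPolynomial.pderiv 1 +
      (MvPolynomial.X 0 - Complex.I • MvPolynomial.X 1 : MvPolynomial (Fin 3) ℂ) •
        MvPolynomial.pderiv 2 := by
    refine MvPolynomial.derivation_ext fun i => ?_
    fin_cases i <;> simp [lowering, MvPolynomial.mkDerivation_X, MvPolynomial.pderiv_X, Pi.single,
      Function.update]
  rw [this]
  simp

section Symbol

attribute [local instance] Matrix.linftyOpNormedRing Matrix.linftyOpNormedAlgebra

variable {n : ℕ} (W : SymbolCorrespondence n)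

theorem rot_mulVec_mem_sphere (v : Fin 3 → ℝ) (x : S2) :
    WithLp.toLp 2 (rot v *ᵥ (x : E3).ofLp) ∈ Metric.sphere (0 : E3) 1 := by
  have hx := x.2
  rw [mem_sphere_zero_iff_norm, EuclideanSpace.norm_eq, Real.sqrt_eq_one] at hx ⊢
  simp only [Real.norm_eq_abs, sq_abs] at hx ⊢
  have h : ∀ w : Fin 3 → ℝ, ∑ i, w i ^ 2 = w ⬝ᵥ w := fun w => by simp [dotProduct, sq]
  rw [h] at hx ⊢
  rw [Matrix.dotProduct_mulVec, Matrix.vecMul_mulVec, ← rot_neg]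
  have : rot (-v) * rot v = 1 := by simpa using rot_mul_rot_neg (-v)
  rw [this, Matrix.vecMul_one, hx]

/-- The infinitesimal form of equivariance. -/
theorem symbol_comm_dotJ {P : Op n} {F : MvPolynomial (Fin 3) ℂ}
    (h : ∀ x, W.symbol P x = MvPolynomial.eval (pt x) F) (v : Fin 3 → ℝ) (x : S2) :
    W.symbol (dotJ n (fun k => (v k : ℂ)) * P - P * dotJ n (fun k => (v k : ℂ))) x =
      -Complex.I * ∑ j, ((((∑ k, v k • L k) *ᵥ (x : E3).ofLp) j : ℝ) : ℂ) *
        MvPolynomial.eval (pt x) (MvPolynomial.pderiv j F) := by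
  set X : Op n := (-Complex.I) • dotJ n fun k => (v k : ℂ) with hX
  let φ : Op n →ₗ[ℝ] ℂ := ((LinearMap.proj x).comp W.symbol).restrictScalars ℝ
  have hφ : ∀ A, φ A = W.symbol A x := fun A => rfl
  have h1 : HasDerivAt (fun t : ℝ => φ (NormedSpace.exp (t • X) * P * NormedSpace.exp (t • (-X))))
      (φ (X * P - P * X)) 0 := by
    have e1 := (hasDerivAt_exp_smul_const X (0 : ℝ)).mul_const P
    have e2 := hasDerivAt_exp_smul_const (-X) (0 : ℝ)
    refine (LinearMap.toContinuousLinearMap φ).hasFDerivAt.comp_hasDerivAt (0 : ℝ)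
      ((e1.mul e2).congr_deriv ?_)
    simp [sub_eq_add_neg]
  let u : ℝ → Fin 3 → ℂ := fun t j => ((rot (-(t • v)) *ᵥ (x : E3).ofLp) j : ℝ)
  have hrot : ∀ t : ℝ, rot (-(t • v)) = NormedSpace.exp (t • (-∑ k, v k • L k)) := fun t => by
    rw [rot]
    congr 1
    simp only [Pi.neg_apply, Pi.smul_apply, smul_eq_mul, neg_smul, mul_smul,
      Finset.sum_neg_distrib, smul_neg, Finset.smul_sum]
  have h2 : HasDerivAt (fun t : ℝ => MvPolynomial.eval (u t) F)
      (∑ j, (((-∑ k, v k • L k) *ᵥ (x : E3).ofLp) j : ℝ) *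
        MvPolynomial.eval (u 0) (MvPolynomial.pderiv j F)) 0 := by
    refine hasDerivAt_eval (fun j => ?_) F
    let ψ : Matrix (Fin 3) (Fin 3) ℝ →ₗ[ℝ] ℝ :=
      { toFun := fun M => (M *ᵥ (x : E3).ofLp) j
        map_add' := fun M M' => by rw [Matrix.add_mulVec]; rfl
        map_smul' := fun r M => by rw [Matrix.smul_mulVec]; rfl }
    have e := (LinearMap.toContinuousLinearMap ψ).hasFDerivAt.comp_hasDerivAt (0 : ℝ)
      (hasDerivAt_exp_smul_const (-∑ k, v k • L k) (0 : ℝ))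
    have e' := e.ofReal_comp
    simp only [zero_smul, NormedSpace.exp_zero, one_mul] at e'
    refine (e'.congr_of_eventuallyEq (Eventually.of_forall fun t => ?_))
    simp only [u, hrot]
    rfl
  have heq : ∀ t : ℝ, φ (NormedSpace.exp (t • X) * P * NormedSpace.exp (t • (-X))) =
      MvPolynomial.eval (u t) F := fun t => by
    have hs1 : spinRot n (t • v) = NormedSpace.exp (t • X) := by
      rw [spinRot]
      congr 1
      simp only [hX, dotJ, Pi.smul_apply, smul_eq_mul, Complex.ofReal_mul, mul_smul,
        Finset.smul_sum, Complex.coe_smul]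
      exact Finset.sum_congr rfl fun k _ => smul_comm _ _ _
    have hs2 : spinRot n (-(t • v)) = NormedSpace.exp (t • (-X)) := by
      rw [spinRot_neg_eq]
      congr 1
      simp only [hX, dotJ, Pi.smul_apply, smul_eq_mul, Complex.ofReal_mul, mul_smul,
        Finset.smul_sum, Complex.coe_smul, smul_neg]
      congr 1
      exact Finset.sum_congr rfl fun k _ => smul_comm _ _ _
    let x' : S2 := ⟨_, rot_mulVec_mem_sphere (-(t • v)) x⟩
    have := W.equivariant P (t • v) x' x (by
      simp only [x']
      rw [Matrix.mulVec_mulVec, rot_mul_rot_neg, Matrix.one_mulVec])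
    rw [conjOp, hs1, hs2, h] at this
    exact this
  -- Both sides are the derivative at `t = 0` of one function, written as the symbol of the rotated
  -- operator and as the symbol at the inversely rotated point.
  have key := (h1.congr_of_eventuallyEq (Eventually.of_forall fun t => (heq t).symm)).unique h2
  have hu0 : u 0 = pt x := by
    funext j
    simp only [u, hrot, zero_smul, NormedSpace.exp_zero, Matrix.one_mulVec]
    rfl
  rw [hu0] at key
  have hXc : dotJ n (fun k => (v k : ℂ)) = Complex.I • X := by
    rw [hX, smul_smul]; simp
  rw [hXc, smul_mul_assoc, mul_smul_comm, ← smul_sub, map_smul, Pi.smul_apply, ← hφ, key,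
    Matrix.neg_mulVec, smul_eq_mul]
  simp only [Pi.neg_apply, Complex.ofReal_neg, neg_mul, Finset.sum_neg_distrib, mul_neg]

/-- `J₋ = J₁ - iJ₂` is not `v·J` for a real `v`, so the infinitesimal equivariance is used for two
real directions and combined linearly. -/
theorem symbol_adMinus {P : Op n} {F : MvPolynomial (Fin 3) ℂ}
    (h : ∀ x, W.symbol P x = MvPolynomial.eval (pt x) F) (x : S2) :
    W.symbol (adMinus n P) x = MvPolynomial.eval (pt x) (lowering F) := by
  have h0 := symbol_comm_dotJ W h ![1, 0, 0] x
  have h1 := symbol_comm_dotJ W h ![0, 1, 0] x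
  have hm : Jminus n = dotJ n (fun k => ((![1, 0, 0] : Fin 3 → ℝ) k : ℂ)) -
      Complex.I • dotJ n (fun k => ((![0, 1, 0] : Fin 3 → ℝ) k : ℂ)) := by
    rw [dotJ_eq, dotJ_eq]
    simp only [Matrix.cons_val, Matrix.cons_val_zero, Matrix.cons_val_one]
    match_scalars <;> ring_nf <;> simp
    all_goals ring
  rw [innerDer_apply, hm, sub_mul, mul_sub, smul_mul_assoc, mul_smul_comm, sub_sub_sub_comm,
    ← smul_sub, map_sub, map_smul, Pi.sub_apply, Pi.smul_apply, h0, h1, lowering_eq, sum_smul_L,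
    sum_smul_L]
  simp [Matrix.mulVec, dotProduct, Fin.sum_univ_three, MvPolynomial.smul_eval, pt]
  ring_nf
  simp
  ring

/-- Conjugating `J₊` instead of the kernel gives `a·J`, with `a` the first row of the rotation plus
`i` times the second. Then `trace_isotropic_pow` applies, and no decomposition into irreducible
representations is needed. -/
theorem symbol_Jplus_pow {c : ℕ → ℝ} (hc : c 0 = 1) (hW : W.HasCharacteristicNumbers c) (l : ℕ) :
    ∃ μ : ℂ, ∀ x, W.symbol (Jplus n ^ l) x = μ * MvPolynomial.eval (pt x) (xplus ^ l) := by
  refine ⟨((Jthree n + (1 / 2 : ℂ) • Jplus n + (-1 / 2 : ℂ) • Jminus n) ^ l *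
    kernel n c).trace, fun x => ?_⟩
  obtain ⟨v, hv⟩ := exists_rot_northPole x
  rw [hW _ v x hv, conjOp]
  set S := spinRot n v
  set S' := spinRot n (-v)
  have hS' : S' * S = 1 := spinRot_neg_mul_spinRot n v
  have hS : S * S' = 1 := spinRot_mul_spinRot_neg n v
  set R := rot v with hR
  let a : Fin 3 → ℂ := fun b => (R 0 b : ℂ) + Complex.I * R 1 b
  have hrow : ∀ i : Fin 3, S' * dotJ n (fun k => ((Pi.single i 1 : Fin 3 → ℝ) k : ℂ)) * S =
      dotJ n (fun b => (R i b : ℂ)) := fun i => by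
    rw [spinRot_mul_dotJ, mul_assoc, hS', mul_one, rot_neg]
    congr 1
    funext b
    rw [Matrix.mulVec_single_one, Matrix.col_apply, Matrix.transpose_apply]
  have hJ : Jplus n = dotJ n (fun k => ((Pi.single 0 1 : Fin 3 → ℝ) k : ℂ)) +
      Complex.I • dotJ n (fun k => ((Pi.single 1 1 : Fin 3 → ℝ) k : ℂ)) := by
    rw [dotJ_eq, dotJ_eq]
    simp
    match_scalars <;> ring_nf <;> simp
    ring
  have hconj : S' * Jplus n * S = dotJ n a := by
    rw [hJ, mul_add, add_mul, hrow, mul_smul_comm, smul_mul_assoc, hrow]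
    simp only [dotJ, Finset.smul_sum, ← Finset.sum_add_distrib, smul_smul, ← add_smul, a]
  have hpow : S' * Jplus n ^ l * S = dotJ n a ^ l := by
    rw [← hconj]
    have : SemiconjBy S' (Jplus n) (S' * Jplus n * S) := by
      rw [SemiconjBy, mul_assoc _ S S', hS, mul_one]
    have h := this.pow_right l
    rw [SemiconjBy] at h
    rw [h, mul_assoc, hS', mul_one]
  have hRR : R * Rᵀ = 1 := by rw [← rot_neg]; exact rot_mul_rot_neg v
  -- Orthonormal real and imaginary parts make a vector isotropic.
  have hnull : a 0 ^ 2 + a 1 ^ 2 + a 2 ^ 2 = 0 := by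
    have e00 := congrFun (congrFun hRR 0) 0
    have e11 := congrFun (congrFun hRR 1) 1
    have e01 := congrFun (congrFun hRR 0) 1
    simp only [Matrix.mul_apply, Fin.sum_univ_three, Matrix.transpose_apply, Matrix.one_apply_eq,
      Matrix.one_apply_ne (by decide : (0 : Fin 3) ≠ 1)] at e00 e11 e01
    replace e00 : (R 0 0 : ℂ) * R 0 0 + R 0 1 * R 0 1 + R 0 2 * R 0 2 = 1 := by exact_mod_cast e00
    replace e11 : (R 1 0 : ℂ) * R 1 0 + R 1 1 * R 1 1 + R 1 2 * R 1 2 = 1 := by exact_mod_cast e11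
    replace e01 : (R 0 0 : ℂ) * R 1 0 + R 0 1 * R 1 1 + R 0 2 * R 1 2 = 0 := by exact_mod_cast e01
    simp only [a]
    linear_combination e00 - e11 + 2 * Complex.I * e01 +
      ((R 1 0 : ℂ) ^ 2 + (R 1 1 : ℂ) ^ 2 + (R 1 2 : ℂ) ^ 2) * Complex.I_sq
  have ha2 : a 2 = MvPolynomial.eval (pt x) xplus := by
    rw [eval_xplus]
    simp only [pt, hv, a, Matrix.mulVec, dotProduct, Fin.sum_univ_three]
    simp [northPole]
  calc (Jplus n ^ l * (S * kernel n c * S')).trace = (S' * Jplus n ^ l * S * kernel n c).trace := by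
        rw [← mul_assoc, Matrix.trace_mul_comm]; simp only [mul_assoc]
    _ = _ := by
      rw [hpow, trace_isotropic_pow (torus_mul_kernel hc) a hnull, ha2, map_pow, mul_comm]

/-- The rescaled operators `[J₋, ·]^k (2J₊/(n+1))^l`. -/
def bOp (n l k : ℕ) : Op n := (adMinus n)^[k] (((2 / ((n : ℂ) + 1)) • Jplus n) ^ l)

theorem adMinus_bOp (n l k : ℕ) : adMinus n (bOp n l k) = bOp n l (k + 1) := by
  rw [bOp, bOp, Function.iterate_succ_apply']

theorem bOp_eq (n l k : ℕ) :
    bOp n l k = (2 / ((n : ℂ) + 1)) ^ l • (adMinus n)^[k] (Jplus n ^ l) := by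
  rw [bOp, smul_pow]
  induction k with
  | zero => rfl
  | succ k ih => rw [Function.iterate_succ_apply', ih, map_smul, Function.iterate_succ_apply']

/-- Lowering both sides carries the same scalar through all `k`. It is computed at the pole, with
trivial rotation and `k = l`, where `trace_mul_kernel` gives the left side. -/
theorem exists_symbol_bOp {c : ℕ → ℝ} (hc : c 0 = 1) (hW : W.HasCharacteristicNumbers c) :
    ∃ d : ℕ → ℂ, (∀ l k x, W.symbol (bOp n l k) x = d l * MvPolynomial.eval (pt x) (bPoly l k)) ∧
      ∀ l ≤ n, d l = ((c l * ratioNum n l : ℝ) : ℂ) := by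
  choose μ hμ using symbol_Jplus_pow W hc hW
  have h1 : ∀ l k x, W.symbol (bOp n l k) x =
      ((2 / ((n : ℂ) + 1)) ^ l * μ l) * MvPolynomial.eval (pt x) (bPoly l k) := by
    intro l k
    induction k with
    | zero =>
      intro x
      rw [bOp_eq, map_smul, Pi.smul_apply, Function.iterate_zero, id, hμ, smul_eq_mul, mul_assoc]
      rfl
    | succ k ih =>
      intro x
      have := symbol_adMinus W (P := bOp n l k)
        (F := ((2 / ((n : ℂ) + 1)) ^ l * μ l) • bPoly l k)
        (fun y => by rw [ih, MvPolynomial.smul_eval]) x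
      rw [adMinus_bOp, Derivation.map_smul, lowering_bPoly, MvPolynomial.smul_eval] at this
      exact this
  refine ⟨_, h1, fun l hl => ?_⟩
  have h2 := h1 l l northPole
  have hrot0 : rot 0 = 1 := by simp [rot]
  have hs0 : spinRot n 0 = 1 := by simp [spinRot]
  rw [hW _ 0 northPole (by rw [hrot0, Matrix.one_mulVec]), conjOp, neg_zero, hs0, one_mul, mul_one,
    bOp_eq, smul_mul_assoc, Matrix.trace_smul, trace_mul_kernel hc hl, eval_northPole_bPoly,
    smul_eq_mul] at h2
  have hf : (l.factorial : ℂ) * (-2) ^ l ≠ 0 :=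
    mul_ne_zero (by exact_mod_cast l.factorial_ne_zero) (pow_ne_zero _ (by norm_num))
  refine mul_right_cancel₀ hf (h2.symm.trans ?_)
  have hN : (n : ℂ) + 1 ≠ 0 := Nat.cast_add_one_ne_zero n
  have e : (-2 : ℂ) ^ l = 2 ^ l * (-1) ^ l := by rw [← mul_pow]; norm_num
  rw [div_pow, e]
  push_cast
  field_simp

end Symbol

/-! ### The Poisson bracket of polynomials -/

section PoissonPoly

open MvPolynomial

/-- The Poisson bracket of polynomials in `x, y, z`, with `{x, y} = z` and cyclically. -/
def poissonPoly (F G : MvPolynomial (Fin 3) ℂ) : MvPolynomial (Fin 3) ℂ :=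
  X 0 * (pderiv 1 F * pderiv 2 G - pderiv 2 F * pderiv 1 G) +
    X 1 * (pderiv 2 F * pderiv 0 G - pderiv 0 F * pderiv 2 G) +
    X 2 * (pderiv 0 F * pderiv 1 G - pderiv 1 F * pderiv 0 G)

theorem poissonPoly_add_left (F F' G : MvPolynomial (Fin 3) ℂ) :
    poissonPoly (F + F') G = poissonPoly F G + poissonPoly F' G := by
  simp only [poissonPoly, map_add]; ring

theorem poissonPoly_smul_left (a : ℂ) (F G : MvPolynomial (Fin 3) ℂ) :
    poissonPoly (a • F) G = a • poissonPoly F G := by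
  simp only [poissonPoly, Derivation.map_smul]; simp only [smul_eq_C_mul]; ring

theorem poissonPoly_comm (F G : MvPolynomial (Fin 3) ℂ) :
    poissonPoly F G = -poissonPoly G F := by
  simp only [poissonPoly]; ring

theorem poissonPoly_self (F : MvPolynomial (Fin 3) ℂ) : poissonPoly F F = 0 := by
  simp only [poissonPoly]; ring

theorem poissonPoly_add_right (F G G' : MvPolynomial (Fin 3) ℂ) :
    poissonPoly F (G + G') = poissonPoly F G + poissonPoly F G' := by
  simp only [poissonPoly, map_add]; ring

theorem poissonPoly_smul_right (a : ℂ) (F G : MvPolynomial (Fin 3) ℂ) :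
    poissonPoly F (a • G) = a • poissonPoly F G := by
  simp only [poissonPoly, Derivation.map_smul]; simp only [smul_eq_C_mul]; ring

theorem poissonPoly_mul_left (F F' G : MvPolynomial (Fin 3) ℂ) :
    poissonPoly (F * F') G = F * poissonPoly F' G + F' * poissonPoly F G := by
  simp only [poissonPoly, Derivation.leibniz, smul_eq_mul]; ring

theorem poissonPoly_mul_right (F G G' : MvPolynomial (Fin 3) ℂ) :
    poissonPoly F (G * G') = G * poissonPoly F G' + G' * poissonPoly F G := by
  simp only [poissonPoly, Derivation.leibniz, smul_eq_mul]; ring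

theorem poissonPoly_one_left (G : MvPolynomial (Fin 3) ℂ) : poissonPoly 1 G = 0 := by
  simp [poissonPoly]

theorem poissonPoly_zero_left (G : MvPolynomial (Fin 3) ℂ) : poissonPoly 0 G = 0 := by
  simp [poissonPoly]

theorem poissonPoly_zero_right (G : MvPolynomial (Fin 3) ℂ) : poissonPoly G 0 = 0 := by
  simp [poissonPoly]

theorem poissonPoly_pow_right (F G : MvPolynomial (Fin 3) ℂ) (l : ℕ) :
    poissonPoly F (G ^ l) = (l : ℂ) • (G ^ (l - 1) * poissonPoly F G) := by
  simp only [poissonPoly, Derivation.leibniz_pow, smul_eq_mul, smul_eq_C_mul, nsmul_eq_mul,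
    map_natCast]
  ring

theorem C_I_sq : (C Complex.I : MvPolynomial (Fin 3) ℂ) ^ 2 = -1 := by
  rw [← map_pow, Complex.I_sq, map_neg, map_one]

theorem poissonPoly_xplus_right :
    poissonPoly (X 2) xplus = (-Complex.I) • xplus := by
  simp only [poissonPoly, xplus, map_add, pderiv_X, smul_eq_C_mul, map_neg]
  simp [Pi.single, Function.update]
  linear_combination (X 1 : MvPolynomial (Fin 3) ℂ) * C_I_sq

theorem poissonPoly_xminus_xplus :
    poissonPoly xminus xplus = (2 * Complex.I) • X 2 := by
  simp only [poissonPoly, xplus, xminus, map_add, map_sub, pderiv_X,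
    smul_eq_C_mul, map_mul]
  simp [Pi.single, Function.update]
  have : (C 2 : MvPolynomial (Fin 3) ℂ) = 2 := map_ofNat _ _
  rw [this]
  ring

/-- The commutators of the rotation field with the partial derivatives are again derivations, hence
are determined on the variables. -/
theorem lowering_pderiv (G : MvPolynomial (Fin 3) ℂ) :
    lowering (pderiv 0 G) = pderiv 0 (lowering G) - pderiv 2 G ∧
    lowering (pderiv 1 G) = pderiv 1 (lowering G) + Complex.I • pderiv 2 G ∧
    lowering (pderiv 2 G) = pderiv 2 (lowering G) + pderiv 0 G - Complex.I • pderiv 1 G := by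
  have h0 : ⁅lowering, (pderiv 0 : Derivation ℂ (MvPolynomial (Fin 3) ℂ) _)⁆ = -pderiv 2 := by
    refine derivation_ext fun i => ?_
    rw [Derivation.commutator_apply]
    fin_cases i <;> simp [lowering, mkDerivation_X, pderiv_X, Pi.single, Function.update]
  have h1 : ⁅lowering, (pderiv 1 : Derivation ℂ (MvPolynomial (Fin 3) ℂ) _)⁆ =
      Complex.I • pderiv 2 := by
    refine derivation_ext fun i => ?_
    rw [Derivation.commutator_apply]
    fin_cases i <;> simp [lowering, mkDerivation_X, pderiv_X, Pi.single, Function.update]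
  have h2 : ⁅lowering, (pderiv 2 : Derivation ℂ (MvPolynomial (Fin 3) ℂ) _)⁆ =
      pderiv 0 - Complex.I • pderiv 1 := by
    refine derivation_ext fun i => ?_
    rw [Derivation.commutator_apply]
    fin_cases i <;> simp [lowering, mkDerivation_X, pderiv_X, Pi.single, Function.update]
  have e0 := DFunLike.congr_fun h0 G
  have e1 := DFunLike.congr_fun h1 G
  have e2 := DFunLike.congr_fun h2 G
  rw [Derivation.commutator_apply] at e0 e1 e2
  simp only [Derivation.neg_apply, Derivation.smul_apply, Derivation.sub_apply] at e0 e1 e2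
  exact ⟨by linear_combination e0, by linear_combination e1, by linear_combination e2⟩

/-- The lowering operator is a derivation of the Poisson bracket. -/
theorem lowering_poissonPoly (F G : MvPolynomial (Fin 3) ℂ) :
    lowering (poissonPoly F G) = poissonPoly (lowering F) G + poissonPoly F (lowering G) := by
  obtain ⟨f0, f1, f2⟩ := lowering_pderiv F
  obtain ⟨g0, g1, g2⟩ := lowering_pderiv G
  have hx : lowering (X 0) = -X 2 := by simp [lowering, mkDerivation_X]
  have hy : lowering (X 1) = Complex.I • X 2 := by simp [lowering, mkDerivation_X]
  have hz : lowering (X 2) = X 0 - Complex.I • X 1 := by simp [lowering, mkDerivation_X]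
  simp only [poissonPoly, map_add, map_sub, Derivation.leibniz, smul_eq_mul, f0, f1, f2, g0, g1, g2,
    hx, hy, hz, smul_eq_C_mul]
  ring

/-- The ideal of the sphere. -/
def sphereIdeal : Ideal (MvPolynomial (Fin 3) ℂ) := Ideal.span {X 0 ^ 2 + X 1 ^ 2 + X 2 ^ 2 - 1}

theorem mem_sphereIdeal {F : MvPolynomial (Fin 3) ℂ} :
    F ∈ sphereIdeal ↔ ∃ H, F = (X 0 ^ 2 + X 1 ^ 2 + X 2 ^ 2 - 1) * H := by
  rw [sphereIdeal, Ideal.mem_span_singleton]; rfl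

theorem lowering_mem_sphereIdeal {F : MvPolynomial (Fin 3) ℂ} (hF : F ∈ sphereIdeal) :
    lowering F ∈ sphereIdeal := by
  obtain ⟨H, rfl⟩ := mem_sphereIdeal.mp hF
  refine mem_sphereIdeal.mpr ⟨lowering H, ?_⟩
  have hx : lowering (X 0) = -X 2 := by simp [lowering, mkDerivation_X]
  have hy : lowering (X 1) = Complex.I • X 2 := by simp [lowering, mkDerivation_X]
  have hz : lowering (X 2) = X 0 - Complex.I • X 1 := by simp [lowering, mkDerivation_X]
  simp only [Derivation.leibniz, map_sub, map_add, Derivation.leibniz_pow, hx, hy, hz,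
    Derivation.map_one_eq_zero, smul_eq_mul, smul_eq_C_mul, nsmul_eq_mul]
  push_cast
  ring

/-- `x² + y² + z² - 1` is central for the bracket, so the ideal it generates is a Poisson ideal and
the bracket descends to the sphere. -/
theorem poissonPoly_mem_left {F : MvPolynomial (Fin 3) ℂ} (hF : F ∈ sphereIdeal)
    (G : MvPolynomial (Fin 3) ℂ) : poissonPoly F G ∈ sphereIdeal := by
  obtain ⟨H, rfl⟩ := mem_sphereIdeal.mp hF
  refine mem_sphereIdeal.mpr ⟨poissonPoly H G, ?_⟩
  have : poissonPoly (X 0 ^ 2 + X 1 ^ 2 + X 2 ^ 2 - 1) G = 0 := by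
    simp only [poissonPoly, map_sub, map_add, Derivation.leibniz_pow, pderiv_X,
      Derivation.map_one_eq_zero]
    simp [Pi.single, Function.update]
    ring
  rw [poissonPoly_mul_left, this, mul_zero, add_zero]

theorem poissonPoly_mem_right {G : MvPolynomial (Fin 3) ℂ} (hG : G ∈ sphereIdeal)
    (F : MvPolynomial (Fin 3) ℂ) : poissonPoly F G ∈ sphereIdeal := by
  rw [poissonPoly_comm]
  exact sphereIdeal.neg_mem (poissonPoly_mem_left hG F)

theorem eval_eq_zero_of_mem {F : MvPolynomial (Fin 3) ℂ} (hF : F ∈ sphereIdeal) {u : Fin 3 → ℂ}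
    (hu : u 0 ^ 2 + u 1 ^ 2 + u 2 ^ 2 = 1) : eval u F = 0 := by
  obtain ⟨H, rfl⟩ := mem_sphereIdeal.mp hF
  simp [hu]

end PoissonPoly

/-! ### Expansions of sequences of operators to first order in `1/(n+1)` -/

/-- Triples `(A, F, F')` of a sequence of operators and two polynomials, where `F + F'/(n+1)` is
meant to be the expansion of `A n` in powers of `1/(n+1)`. -/
abbrev Expn : Type := (∀ n, Op n) × MvPolynomial (Fin 3) ℂ × MvPolynomial (Fin 3) ℂ

namespace Expn

/-- The product of expansions: `F ⋆ G = F G + i {F, G} / (n+1)`. -/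
def mul (a b : Expn) : Expn :=
  (fun n => a.1 n * b.1 n, a.2.1 * b.2.1,
    a.2.1 * b.2.2 + a.2.2 * b.2.1 + Complex.I • poissonPoly a.2.1 b.2.1)

theorem mul_def (a b : Expn) : mul a b = (fun n => a.1 n * b.1 n, a.2.1 * b.2.1,
    a.2.1 * b.2.2 + a.2.2 * b.2.1 + Complex.I • poissonPoly a.2.1 b.2.1) := rfl

theorem mul_add (a b c : Expn) : mul a (b + c) = mul a b + mul a c := by
  refine Prod.ext (funext fun n => Matrix.mul_add _ _ _) (Prod.ext (_root_.mul_add _ _ _) ?_)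
  simp only [mul_def, Prod.snd_add, Prod.fst_add, poissonPoly_add_right, smul_add]
  ring

theorem add_mul (a b c : Expn) : mul (a + b) c = mul a c + mul b c := by
  refine Prod.ext (funext fun n => Matrix.add_mul _ _ _) (Prod.ext (_root_.add_mul _ _ _) ?_)
  simp only [mul_def, Prod.snd_add, Prod.fst_add, poissonPoly_add_left, smul_add]
  ring

theorem mul_smul (r : ℂ) (a b : Expn) : mul a (r • b) = r • mul a b := by
  refine Prod.ext (funext fun n => ?_) (Prod.ext ?_ ?_)
  · simp only [mul_def, Prod.smul_fst, Pi.smul_apply, Matrix.mul_smul]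
  · simp only [mul_def, Prod.smul_snd, Prod.smul_fst, mul_smul_comm]
  simp only [mul_def, Prod.smul_snd, Prod.smul_fst, poissonPoly_smul_right, smul_add,
    mul_smul_comm, smul_comm r]

theorem smul_mul (r : ℂ) (a b : Expn) : mul (r • a) b = r • mul a b := by
  refine Prod.ext (funext fun n => ?_) (Prod.ext ?_ ?_)
  · simp only [mul_def, Prod.smul_fst, Pi.smul_apply, Matrix.smul_mul]
  · simp only [mul_def, Prod.smul_snd, Prod.smul_fst, smul_mul_assoc]
  simp only [mul_def, Prod.smul_snd, Prod.smul_fst, poissonPoly_smul_left, smul_add,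
    smul_mul_assoc, smul_comm r]

/-- Modulo `1/(n+1)²`, associativity only requires that the bracket be a derivation in each
argument. -/
theorem mul_assoc (a b c : Expn) : mul (mul a b) c = mul a (mul b c) := by
  refine Prod.ext (funext fun n => Matrix.mul_assoc _ _ _)
    (Prod.ext (_root_.mul_assoc _ _ _) ?_)
  simp only [mul_def, poissonPoly_mul_left, poissonPoly_mul_right, MvPolynomial.smul_eq_C_mul]
  ring

/-- The product of an expansion with `1/(n+1)`. -/
def shift : Expn →ₗ[ℂ] Expn where
  toFun a := (fun n : ℕ => (1 / ((n : ℂ) + 1)) • a.1 n, 0, a.2.1)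
  map_add' a b := by
    refine Prod.ext (funext fun n => smul_add _ _ _) (Prod.ext ?_ rfl)
    simp
  map_smul' r a := by
    refine Prod.ext (funext fun n => smul_comm (1 / ((n : ℂ) + 1)) r (a.1 n)) (Prod.ext ?_ rfl)
    simp

theorem shift_apply (a : Expn) :
    shift a = (fun n : ℕ => (1 / ((n : ℂ) + 1)) • a.1 n, 0, a.2.1) := rfl

theorem shift_mul (a b : Expn) : mul (shift a) b = shift (mul a b) := by
  refine Prod.ext (funext fun n => Matrix.smul_mul _ _ _) (Prod.ext ?_ ?_)
  · simp [mul_def, shift_apply]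
  · simp [mul_def, shift_apply, poissonPoly_zero_left]

theorem mul_shift (a b : Expn) : mul a (shift b) = shift (mul a b) := by
  refine Prod.ext (funext fun n => Matrix.mul_smul _ _ _) (Prod.ext ?_ ?_)
  · simp [mul_def, shift_apply]
  · simp [mul_def, shift_apply, poissonPoly_zero_right]

/-- The action of the lowering operator on expansions. -/
def lower : Expn →ₗ[ℂ] Expn where
  toFun a := (fun n => adMinus n (a.1 n), lowering a.2.1, lowering a.2.2)
  map_add' a b := by
    refine Prod.ext (funext fun n => map_add _ _ _) (Prod.ext (map_add _ _ _) (map_add _ _ _))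
  map_smul' r a := by
    refine Prod.ext (funext fun n => map_smul (adMinus n) r (a.1 n))
      (Prod.ext (Derivation.map_smul _ _ _) (Derivation.map_smul _ _ _))

theorem lower_apply (a : Expn) :
    lower a = (fun n => adMinus n (a.1 n), lowering a.2.1, lowering a.2.2) := rfl

theorem lower_mul (a b : Expn) : lower (mul a b) = mul (lower a) b + mul a (lower b) := by
  refine Prod.ext (funext fun n => innerDer_mul _ _ _) (Prod.ext ?_ ?_)
  · simp only [lower_apply, mul_def, Derivation.leibniz, smul_eq_mul, Prod.snd_add, Prod.fst_add]
    ring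
  · simp only [lower_apply, mul_def, Derivation.leibniz, smul_eq_mul, Prod.snd_add, map_add,
      Derivation.map_smul, lowering_poissonPoly, smul_add]
    ring

theorem lower_shift (a : Expn) : lower (shift a) = shift (lower a) := by
  refine Prod.ext (funext fun n => map_smul _ _ _) (Prod.ext ?_ rfl)
  simp [lower_apply, shift_apply]

/-- The expansion of the sequence of operators that quantizes a spherical harmonic. -/
def basis (l k : ℕ) : Expn := (fun n => bOp n l k, bPoly l k, 0)

theorem lower_basis (l k : ℕ) : lower (basis l k) = basis l (k + 1) :=
  Prod.ext (funext fun n => adMinus_bOp n l k) (Prod.ext (lowering_bPoly l k) (map_zero _))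

/-- The expansions of sequences in the span of the operators `bOp n l k`, with coefficients
polynomial in `1/(n+1)`. -/
def expansions : Submodule ℂ Expn :=
  Submodule.span ℂ ({a | ∃ r l k, a = (shift^[r]) (basis l k)} ∪
    -- A function on the sphere determines a polynomial only modulo `sphereIdeal`. These triples
    -- absorb the ambiguity, which arises when the Casimir relation is used in products with `J₋`.
    {a | a.1 = 0 ∧ a.2.1 ∈ sphereIdeal ∧ a.2.2 ∈ sphereIdeal})

theorem basis_mem (l k : ℕ) : basis l k ∈ expansions :=
  Submodule.subset_span (Or.inl ⟨0, l, k, rfl⟩)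

theorem ideal_mem {a : Expn} (h : a.1 = 0) (h1 : a.2.1 ∈ sphereIdeal) (h2 : a.2.2 ∈ sphereIdeal) :
    a ∈ expansions :=
  Submodule.subset_span (Or.inr ⟨h, h1, h2⟩)

theorem shift_mem {a : Expn} (ha : a ∈ expansions) : shift a ∈ expansions := by
  induction ha using Submodule.span_induction with
  | mem a ha =>
    rcases ha with ⟨r, l, k, rfl⟩ | ⟨h, h1, h2⟩
    · exact Submodule.subset_span (Or.inl ⟨r + 1, l, k, (Function.iterate_succ_apply' _ _ _).symm⟩)
    · refine ideal_mem ?_ ?_ ?_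
      · funext n; simp [shift_apply, h]
      · exact sphereIdeal.zero_mem
      · exact h1
  | zero => rw [map_zero]; exact zero_mem _
  | add a b _ _ iha ihb => rw [map_add]; exact add_mem iha ihb
  | smul r a _ iha => rw [map_smul]; exact Submodule.smul_mem _ _ iha

theorem shift_iterate_mem {a : Expn} (ha : a ∈ expansions) (r : ℕ) :
    shift^[r] a ∈ expansions := by
  induction r with
  | zero => exact ha
  | succ r ih => rw [Function.iterate_succ_apply']; exact shift_mem ih

theorem lower_shift_iterate (r : ℕ) (a : Expn) :
    lower (shift^[r] a) = shift^[r] (lower a) := by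
  induction r with
  | zero => rfl
  | succ r ih => rw [Function.iterate_succ_apply', Function.iterate_succ_apply', lower_shift, ih]

theorem mul_shift_iterate (r : ℕ) (a b : Expn) :
    mul a (shift^[r] b) = shift^[r] (mul a b) := by
  induction r with
  | zero => rfl
  | succ r ih => rw [Function.iterate_succ_apply', Function.iterate_succ_apply', mul_shift, ih]

theorem shift_iterate_mul (r : ℕ) (a b : Expn) :
    mul (shift^[r] a) b = shift^[r] (mul a b) := by
  induction r with
  | zero => rfl
  | succ r ih => rw [Function.iterate_succ_apply', Function.iterate_succ_apply', shift_mul, ih]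

theorem lower_mem {a : Expn} (ha : a ∈ expansions) : lower a ∈ expansions := by
  induction ha using Submodule.span_induction with
  | mem a ha =>
    rcases ha with ⟨r, l, k, rfl⟩ | ⟨h, h1, h2⟩
    · rw [lower_shift_iterate, lower_basis]
      exact shift_iterate_mem (basis_mem _ _) r
    · refine ideal_mem ?_ (lowering_mem_sphereIdeal h1) (lowering_mem_sphereIdeal h2)
      funext n; simp [lower_apply, h]
  | zero => rw [map_zero]; exact zero_mem _
  | add a b _ _ iha ihb => rw [map_add]; exact add_mem iha ihb
  | smul r a _ iha => rw [map_smul]; exact Submodule.smul_mem _ _ iha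

theorem mul_zero (a : Expn) : mul a 0 = 0 := by
  simpa using mul_smul 0 a 0

theorem zero_mul (a : Expn) : mul 0 a = 0 := by
  simpa using smul_mul 0 0 a

theorem mul_mem_of_basis {a : Expn} (ha : ∀ l k, mul a (basis l k) ∈ expansions) {b : Expn}
    (hb : b ∈ expansions) : mul a b ∈ expansions := by
  induction hb using Submodule.span_induction with
  | mem b hb =>
    rcases hb with ⟨r, l, k, rfl⟩ | ⟨h, h1, h2⟩
    · rw [mul_shift_iterate]
      exact shift_iterate_mem (ha l k) r
    · refine ideal_mem ?_ (sphereIdeal.mul_mem_left _ h1) ?_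
      · funext n; simp [mul_def, h]
      · refine add_mem (add_mem (sphereIdeal.mul_mem_left _ h2) (sphereIdeal.mul_mem_left _ h1)) ?_
        exact Submodule.smul_of_tower_mem _ _ (poissonPoly_mem_right h1 _)
  | zero => rw [mul_zero]; exact zero_mem _
  | add b c _ _ ihb ihc => rw [mul_add]; exact add_mem ihb ihc
  | smul r b _ ihb => rw [mul_smul]; exact Submodule.smul_mem _ _ ihb

theorem mul_mem_of_basis_left (H : ∀ l k, ∀ b ∈ expansions, mul (basis l k) b ∈ expansions)
    {a b : Expn} (ha : a ∈ expansions) (hb : b ∈ expansions) : mul a b ∈ expansions := by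
  induction ha using Submodule.span_induction with
  | mem a ha =>
    rcases ha with ⟨r, l, k, rfl⟩ | ⟨h, h1, h2⟩
    · rw [shift_iterate_mul]
      exact shift_iterate_mem (H l k b hb) r
    · refine ideal_mem ?_ (sphereIdeal.mul_mem_right _ h1) ?_
      · funext n; simp [mul_def, h]
      · refine add_mem (add_mem (sphereIdeal.mul_mem_right _ h1)
          (sphereIdeal.mul_mem_right _ h2)) ?_
        exact Submodule.smul_of_tower_mem _ _ (poissonPoly_mem_left h1 _)
  | zero => rw [zero_mul]; exact zero_mem _
  | add a c _ _ iha ihc => rw [add_mul]; exact add_mem iha ihc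
  | smul r a _ iha => rw [smul_mul]; exact Submodule.smul_mem _ _ iha

end Expn

/-! ### Products with the operators of degree one. -/

section LevelOne

variable (n : ℕ)

theorem bOp_one_one : bOp n 1 1 = (2 / ((n : ℂ) + 1) * (-2)) • Jthree n := by
  rw [bOp_eq, pow_one, pow_one, Function.iterate_one, innerDer_raise (Jplus_mul_Jminus_comm n),
    smul_smul]

theorem bOp_one_two : bOp n 1 2 = (2 / ((n : ℂ) + 1) * (-2)) • Jminus n := by
  rw [← adMinus_bOp, bOp_one_one, map_smul, innerDer_cartan (Jthree_mul_Jminus n)]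

theorem bOp_one_three (k : ℕ) : bOp n 1 (k + 3) = 0 := by
  rw [bOp_eq, adMinus_iterate_eq_zero n (by omega), smul_zero]

theorem bPoly_one_one : bPoly 1 1 = (-2 : ℂ) • MvPolynomial.X 2 := by
  rw [bPoly, Function.iterate_one, pow_one, lowering_xplus]

theorem bPoly_one_two : bPoly 1 2 = (-2 : ℂ) • xminus := by
  rw [← lowering_bPoly, bPoly_one_one, Derivation.map_smul, lowering_z]

theorem bPoly_one_three (k : ℕ) : bPoly 1 (k + 3) = 0 := by
  induction k with
  | zero => rw [zero_add, ← lowering_bPoly, bPoly_one_two, Derivation.map_smul, lowering_xminus,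
      smul_zero]
  | succ k ih => rw [add_right_comm, ← lowering_bPoly, ih, map_zero]

theorem bPoly_zero_succ (k : ℕ) : bPoly 0 (k + 1) = 0 := by
  induction k with
  | zero => simp [bPoly]
  | succ k ih => rw [← lowering_bPoly, ih, map_zero]

theorem bOp_zero_succ (k : ℕ) : bOp n 0 (k + 1) = 0 := by
  rw [bOp_eq, adMinus_iterate_eq_zero n (by omega), smul_zero]

theorem bPoly_one (l : ℕ) :
    bPoly l 1 = (-2 * (l : ℂ)) • (MvPolynomial.X 2 * xplus ^ (l - 1)) := by
  rw [bPoly, Function.iterate_one, Derivation.leibniz_pow, lowering_xplus]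
  simp only [smul_eq_mul, MvPolynomial.smul_eq_C_mul, nsmul_eq_mul, map_mul, map_natCast]
  ring

end LevelOne

theorem xminus_mul_xplus :
    xminus * xplus = (MvPolynomial.X 0 ^ 2 + MvPolynomial.X 1 ^ 2 : MvPolynomial (Fin 3) ℂ) := by
  simp only [xminus, xplus, MvPolynomial.smul_eq_C_mul]
  linear_combination -(MvPolynomial.X 1 : MvPolynomial (Fin 3) ℂ) ^ 2 * C_I_sq

theorem bPoly_two (l : ℕ) :
    bPoly (l + 1) 2 = (-2 * ((l : ℂ) + 1)) • (xminus * xplus ^ l) +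
      (4 * ((l : ℂ) + 1) * l) • (MvPolynomial.X 2 ^ 2 * xplus ^ (l - 1)) := by
  rw [← lowering_bPoly, bPoly_one, Derivation.map_smul, Derivation.leibniz, lowering_z,
    Derivation.leibniz_pow, lowering_xplus, Nat.add_sub_cancel]
  simp only [smul_eq_mul, MvPolynomial.smul_eq_C_mul, nsmul_eq_mul, map_mul, map_add, map_neg,
    map_natCast, Nat.cast_add, map_one, Nat.cast_one, map_ofNat]
  ring

namespace Expn

theorem basis_mul_zero (l : ℕ) : mul (basis 1 0) (basis l 0) = basis (l + 1) 0 := by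
  refine Prod.ext (funext fun n => ?_) (Prod.ext ?_ ?_)
  · simp only [mul_def, basis, bOp, Function.iterate_zero, id, pow_one, pow_succ' _ l]
  · simp only [mul_def, basis, bPoly, Function.iterate_zero, id, pow_one, pow_succ' _ l]
  · simp only [mul_def, basis, bPoly, Function.iterate_zero, id, pow_one, poissonPoly_pow_right,
      poissonPoly_self]
    simp

/-- The component of degree `l` in `J₃ J₊^l` has relative size `1/(n+1)` and is matched by the
Poisson bracket of `z` with `(x+iy)^l`. -/
theorem basis_mul_one (l : ℕ) : mul (basis 1 1) (basis l 0) =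
    (1 / ((l : ℂ) + 1)) • basis (l + 1) 1 - (2 * (l : ℂ)) • shift (basis l 0) := by
  have hl : (l : ℂ) + 1 ≠ 0 := Nat.cast_add_one_ne_zero l
  refine Prod.ext (funext fun n => ?_) (Prod.ext ?_ ?_)
  · simp only [mul_def, basis, bOp_one_one, Prod.fst_sub, Prod.smul_fst, Pi.sub_apply,
      Pi.smul_apply, shift_apply]
    rw [bOp_eq n l 0, bOp_eq n (l + 1) 1, Function.iterate_zero, id, Function.iterate_one,
      smul_mul_assoc, mul_smul_comm,
      cartan_mul_pow_eq (Jthree_mul_Jplus n) (Jplus_mul_Jminus_comm n) l]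
    have hN : (n : ℂ) + 1 ≠ 0 := Nat.cast_add_one_ne_zero n
    simp only [pow_succ _ l]
    match_scalars <;> field_simp
  · simp only [mul_def, basis, bPoly_one_one, Prod.snd_sub, Prod.fst_sub, Prod.smul_fst,
      Prod.smul_snd, shift_apply, smul_zero, sub_zero, bPoly_one (l + 1), Nat.add_sub_cancel]
    rw [bPoly, Function.iterate_zero, id, smul_mul_assoc, smul_smul]
    congr 1
    push_cast
    field_simp
  · simp only [mul_def, basis, bPoly_one_one, Prod.snd_sub, Prod.smul_snd, shift_apply,
      MulZeroClass.mul_zero, MulZeroClass.zero_mul, zero_add, smul_zero, zero_sub,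
      poissonPoly_smul_left]
    rw [bPoly, Function.iterate_zero, id, poissonPoly_pow_right, poissonPoly_xplus_right]
    cases l with
    | zero => simp
    | succ l =>
      rw [Nat.add_sub_cancel, mul_smul_comm, ← pow_succ, smul_smul, smul_smul, smul_smul, ← neg_smul]
      congr 1
      linear_combination (2 * ((l + 1 : ℕ) : ℂ)) * Complex.I_sq

/-- This is the decomposition of `J₋ J₊^l` into degrees `l+1`, `l`, `l-1`. The factor `1 -
l²/(n+1)²` of the last one splits into a leading term and a double shift. The polynomial parts agree
only modulo `x² + y² + z² = 1`. -/
theorem basis_mul_two_sub_mem (l : ℕ) : mul (basis 1 2) (basis l 0) -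
    ((1 / ((2 * (l : ℂ) + 1) * (l + 1))) • basis (l + 1) 2 - (2 : ℂ) • shift (basis l 1) -
      (4 * (l : ℂ) / (2 * l + 1)) • (basis (l - 1) 0 -
        ((l : ℂ) ^ 2) • shift (shift (basis (l - 1) 0)))) ∈ expansions := by
  have hl : (l : ℂ) + 1 ≠ 0 := Nat.cast_add_one_ne_zero l
  have hl' : 2 * (l : ℂ) + 1 ≠ 0 := by
    have : ((2 * l + 1 : ℕ) : ℂ) ≠ 0 := Nat.cast_ne_zero.mpr (by omega)
    simpa using this
  have hl'' : 4 * (l : ℂ) + 2 = 2 * (2 * l + 1) := by ring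
  refine ideal_mem (funext fun n => ?_) ?_ ?_
  · simp only [mul_def, basis, bOp_one_two, Prod.fst_sub, Prod.smul_fst, Pi.sub_apply,
      Pi.smul_apply, shift_apply, Pi.zero_apply]
    rw [bOp_eq n l 0, bOp_eq n l 1, bOp_eq n (l + 1) 2, bOp_eq n (l - 1) 0, Function.iterate_zero,
      id, Function.iterate_one, smul_mul_assoc, mul_smul_comm,
      lower_mul_pow_eq (Jthree_mul_Jplus n) (Jthree_mul_Jminus n) (Jplus_mul_Jminus_comm n)
        (casimir n) l, hl'']
    have hN : (n : ℂ) + 1 ≠ 0 := Nat.cast_add_one_ne_zero n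
    generalize (n : ℂ) + 1 = N at hN
    simp only [Function.iterate_succ, Function.iterate_zero, Function.comp, id]
    cases l with
    | zero =>
      simp only [Nat.cast_zero, MulZeroClass.mul_zero, zero_add]
      match_scalars <;> field_simp <;> ring
    | succ l =>
      simp only [Nat.add_sub_cancel, pow_succ (2 / N)]
      generalize (2 / N) ^ l = H
      generalize ((l + 1 : ℕ) : ℂ) = M at *
      match_scalars <;> field_simp <;> ring
  · simp only [mul_def, basis, bPoly_one_two, Prod.snd_sub, Prod.fst_sub, Prod.smul_fst,
      Prod.smul_snd, shift_apply, smul_zero, sub_zero, bPoly_two l]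
    cases l with
    | zero => simp [bPoly]
    | succ l =>
      refine mem_sphereIdeal.mpr
        ⟨(-(4 * ((l + 1 : ℕ) : ℂ) / (2 * ((l + 1 : ℕ) : ℂ) + 1))) • xplus ^ l, ?_⟩
      have h : (MvPolynomial.X 0 ^ 2 + MvPolynomial.X 1 ^ 2 + MvPolynomial.X 2 ^ 2 - 1 :
          MvPolynomial (Fin 3) ℂ) * xplus ^ l =
          xminus * xplus ^ (l + 1) + MvPolynomial.X 2 ^ 2 * xplus ^ l - xplus ^ l := by
        rw [← xminus_mul_xplus]; ring
      rw [mul_smul_comm, h, Nat.add_sub_cancel, bPoly, Function.iterate_zero, id, bPoly,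
        Function.iterate_zero, id]
      generalize ((l + 1 : ℕ) : ℂ) = M at *
      simp only [smul_mul_assoc]
      match_scalars <;> field_simp
      ring
  · simp only [mul_def, basis, bPoly_one_two, Prod.snd_sub, Prod.smul_snd, shift_apply,
      MulZeroClass.mul_zero, MulZeroClass.zero_mul, zero_add, smul_zero,
      sub_zero, poissonPoly_smul_left, zero_sub, bPoly_one l]
    rw [bPoly, Function.iterate_zero, id, poissonPoly_pow_right, poissonPoly_xminus_xplus]
    convert sphereIdeal.zero_mem using 1
    rw [mul_smul_comm, mul_comm (xplus ^ (l - 1))]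
    match_scalars
    linear_combination (-4 * (l : ℂ)) * Complex.I_sq

/-- The Leibniz rule expresses a product with `basis l (k' + 1)` by the lowered product with `basis
l k'` and a product with `k + 1` in the first factor. This reduces everything to `k' = 0`. -/
theorem basis_one_mul_mem (k l k' : ℕ) : mul (basis 1 k) (basis l k') ∈ expansions := by
  induction k' generalizing k with
  | zero =>
    match k with
    | 0 => rw [basis_mul_zero]; exact basis_mem _ _
    | 1 =>
      rw [basis_mul_one]
      exact sub_mem (Submodule.smul_mem _ _ (basis_mem _ _))
        (Submodule.smul_mem _ _ (shift_mem (basis_mem _ _)))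
    | 2 =>
      refine (Submodule.sub_mem_iff_left _ ?_).mp (basis_mul_two_sub_mem l)
      refine sub_mem (sub_mem ?_ ?_) ?_
      · exact Submodule.smul_mem _ _ (basis_mem _ _)
      · exact Submodule.smul_mem _ _ (shift_mem (basis_mem _ _))
      · exact Submodule.smul_mem _ _ (sub_mem (basis_mem _ _)
          (Submodule.smul_mem _ _ (shift_mem (shift_mem (basis_mem _ _)))))
    | k + 3 =>
      have : basis 1 (k + 3) = 0 :=
        Prod.ext (funext fun n => bOp_one_three n k) (Prod.ext (bPoly_one_three k) rfl)
      rw [this, zero_mul]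
      exact zero_mem _
  | succ k' ih =>
    have h := lower_mul (basis 1 k) (basis l k')
    rw [lower_basis, lower_basis, add_comm] at h
    rw [eq_sub_of_add_eq h.symm]
    exact sub_mem (lower_mem (ih k)) (ih (k + 1))

theorem basis_zero_zero_mul (a : Expn) : mul (basis 0 0) a = a := by
  refine Prod.ext (funext fun n => ?_) (Prod.ext ?_ ?_)
  · simp [mul_def, basis, bOp]
  · simp [mul_def, basis, bPoly]
  · simp [mul_def, basis, bPoly, poissonPoly_one_left]

theorem basis_zero_succ (k : ℕ) : basis 0 (k + 1) = 0 :=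
  Prod.ext (funext fun n => bOp_zero_succ n k) (Prod.ext (bPoly_zero_succ k) rfl)

/-- `basis (l + 1) 0` is the product of `basis 1 0` and `basis l 0`, so associativity raises `l`;
the Leibniz rule then raises `k`. -/
theorem basis_mul_mem (l k : ℕ) {a : Expn} (ha : a ∈ expansions) :
    mul (basis l k) a ∈ expansions := by
  induction l generalizing k a with
  | zero =>
    cases k with
    | zero => rwa [basis_zero_zero_mul]
    | succ k => rw [basis_zero_succ, zero_mul]; exact zero_mem _
  | succ l ih =>
    induction k generalizing a with
    | zero =>
      rw [← basis_mul_zero, mul_assoc]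
      exact mul_mem_of_basis (basis_one_mul_mem 0) (ih 0 ha)
    | succ k ihk =>
      have h := lower_mul (basis (l + 1) k) a
      rw [lower_basis] at h
      rw [eq_sub_of_add_eq h.symm]
      exact sub_mem (lower_mem (ihk ha)) (ihk (lower_mem ha))

theorem mul_mem {a b : Expn} (ha : a ∈ expansions) (hb : b ∈ expansions) :
    mul a b ∈ expansions :=
  mul_mem_of_basis_left (fun l k _ hb => basis_mul_mem l k hb) ha hb

/-- The commutator of expansions. -/
def comm (a b : Expn) : Expn := mul a b - mul b a

theorem lower_comm (a b : Expn) : lower (comm a b) = comm (lower a) b + comm a (lower b) := by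
  simp only [comm, map_sub, lower_mul]; abel

theorem mul_sub (a b c : Expn) : mul a (b - c) = mul a b - mul a c := by
  rw [eq_sub_iff_add_eq, ← mul_add, sub_add_cancel]

theorem sub_mul (a b c : Expn) : mul (a - b) c = mul a c - mul b c := by
  rw [eq_sub_iff_add_eq, ← add_mul, sub_add_cancel]

theorem comm_mul (a b c : Expn) : comm (mul a b) c = mul a (comm b c) + mul (comm a c) b := by
  simp only [comm, mul_sub, sub_mul, mul_assoc]; abel

/-- The expansions that are divisible by `1/(n+1)`. -/
def shifted : Submodule ℂ Expn := expansions.map shift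

theorem lower_mem_shifted {a : Expn} (ha : a ∈ shifted) : lower a ∈ shifted := by
  obtain ⟨b, hb, rfl⟩ := ha
  exact ⟨lower b, lower_mem hb, (lower_shift b).symm⟩

theorem mul_mem_shifted {a b : Expn} (ha : a ∈ expansions) (hb : b ∈ shifted) :
    mul a b ∈ shifted := by
  obtain ⟨c, hc, rfl⟩ := hb
  exact ⟨mul a c, mul_mem ha hc, (mul_shift a c).symm⟩

theorem shifted_mul_mem {a b : Expn} (ha : a ∈ shifted) (hb : b ∈ expansions) :
    mul a b ∈ shifted := by
  obtain ⟨c, hc, rfl⟩ := ha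
  exact ⟨mul c b, mul_mem hc hb, (shift_mul c b).symm⟩

theorem comm_basis_one_one (l : ℕ) :
    comm (basis 1 1) (basis l 0) = shift ((-4 * (l : ℂ)) • basis l 0) := by
  refine Prod.ext (funext fun n => ?_) (Prod.ext ?_ ?_)
  · simp only [comm, mul_def, basis, bOp_one_one, Prod.fst_sub, Prod.smul_fst, Pi.sub_apply,
      Pi.smul_apply, shift_apply]
    rw [bOp_eq n l 0, Function.iterate_zero, id, smul_mul_smul_comm, smul_mul_smul_comm,
      cartan_mul_pow (Jthree_mul_Jplus n)]
    match_scalars <;> ring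
  · simp only [comm, mul_def, basis, Prod.snd_sub, Prod.fst_sub, shift_apply]
    ring
  · simp only [comm, mul_def, basis, Prod.snd_sub, Prod.smul_snd, Prod.smul_fst, shift_apply,
      MulZeroClass.mul_zero, MulZeroClass.zero_mul, zero_add]
    rw [poissonPoly_comm (bPoly l 0), bPoly_one_one, poissonPoly_smul_left, bPoly,
      Function.iterate_zero, id, poissonPoly_pow_right, poissonPoly_xplus_right]
    cases l with
    | zero => simp
    | succ l =>
      rw [Nat.add_sub_cancel, mul_smul_comm, ← pow_succ]
      match_scalars
      linear_combination (4 * ((l : ℂ) + 1)) * Complex.I_sq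

theorem comm_basis_one_two (l : ℕ) :
    comm (basis 1 2) (basis l 0) = shift ((-4 : ℂ) • basis l 1) := by
  refine Prod.ext (funext fun n => ?_) (Prod.ext ?_ ?_)
  · simp only [comm, mul_def, basis, bOp_one_two, Prod.fst_sub, Prod.smul_fst, Pi.sub_apply,
      Pi.smul_apply, shift_apply]
    rw [← adMinus_bOp, innerDer_apply, smul_mul_assoc, mul_smul_comm]
    match_scalars <;> ring
  · simp only [comm, mul_def, basis, Prod.snd_sub, Prod.fst_sub, shift_apply]
    ring
  · simp only [comm, mul_def, basis, Prod.snd_sub, Prod.smul_snd, Prod.smul_fst, shift_apply,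
      MulZeroClass.mul_zero, MulZeroClass.zero_mul, zero_add]
    rw [poissonPoly_comm (bPoly l 0), bPoly_one_two, poissonPoly_smul_left, bPoly_one, bPoly,
      Function.iterate_zero, id, poissonPoly_pow_right, poissonPoly_xminus_xplus, mul_smul_comm,
      mul_comm (xplus ^ (l - 1))]
    match_scalars
    linear_combination (-8 * (l : ℂ)) * Complex.I_sq

/-- Exact divisibility by `1/(n+1)` is what lets `n` times a commutator converge without any rate
for the characteristic numbers. It holds in degree one by explicit computation and propagates
because commutators are derivations. -/
theorem comm_basis_mem (l k l' k' : ℕ) : comm (basis l k) (basis l' k') ∈ shifted := by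
  have smem : ∀ a ∈ expansions, shift a ∈ shifted := fun a ha => ⟨a, ha, rfl⟩
  have one : ∀ k l' k', comm (basis 1 k) (basis l' k') ∈ shifted := by
    intro k l' k'
    induction k' generalizing k with
    | zero =>
      match k with
      | 0 =>
        have : comm (basis 1 0) (basis l' 0) = 0 := by
          rw [comm, sub_eq_zero]
          refine Prod.ext (funext fun n => ?_) (Prod.ext (mul_comm _ _) ?_)
          · simp only [mul_def, basis, bOp, Function.iterate_zero, id, pow_one, ← pow_succ,
              ← pow_succ']
          · simp only [mul_def, basis]
            rw [poissonPoly_comm]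
            simp only [bPoly, Function.iterate_zero, id, pow_one]
            rw [poissonPoly_comm, poissonPoly_pow_right, poissonPoly_self]
            simp
        rw [this]
        exact zero_mem _
      | 1 =>
        rw [comm_basis_one_one]
        exact smem _ (Submodule.smul_mem _ _ (basis_mem _ _))
      | 2 =>
        rw [comm_basis_one_two]
        exact smem _ (Submodule.smul_mem _ _ (basis_mem _ _))
      | k + 3 =>
        have : basis 1 (k + 3) = 0 :=
          Prod.ext (funext fun n => bOp_one_three n k) (Prod.ext (bPoly_one_three k) rfl)
        rw [this, comm, zero_mul, mul_zero, sub_zero]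
        exact zero_mem _
    | succ k' ih =>
      have h := lower_comm (basis 1 k) (basis l' k')
      rw [lower_basis, lower_basis, add_comm] at h
      rw [eq_sub_of_add_eq h.symm]
      exact sub_mem (lower_mem_shifted (ih k)) (ih (k + 1))
  induction l generalizing k l' k' with
  | zero =>
    cases k with
    | zero =>
      have : comm (basis 0 0) (basis l' k') = 0 := by
        rw [comm, sub_eq_zero, basis_zero_zero_mul]
        refine Prod.ext (funext fun n => ?_) (Prod.ext ?_ ?_)
        · simp [mul_def, basis, bOp]
        · simp [mul_def, basis, bPoly]
        · simp only [mul_def, basis]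
          rw [poissonPoly_comm]
          simp [bPoly, poissonPoly_one_left]
      rw [this]
      exact zero_mem _
    | succ k => rw [basis_zero_succ, comm, zero_mul, mul_zero, sub_zero]; exact zero_mem _
  | succ l ih =>
    induction k generalizing l' k' with
    | zero =>
      rw [← basis_mul_zero, comm_mul]
      exact add_mem (mul_mem_shifted (basis_mem _ _) (ih _ _ _))
        (shifted_mul_mem (one _ _ _) (basis_mem _ _))
    | succ k ihk =>
      have h := lower_comm (basis (l + 1) k) (basis l' k')
      rw [lower_basis, lower_basis] at h
      rw [eq_sub_of_add_eq h.symm]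
      exact sub_mem (lower_mem_shifted (ihk _ _)) (ihk _ _)

end Expn

/-! ### The Poisson bracket of polynomial functions on the sphere -/

theorem differentiableAt_eval {E : Type*} [NormedAddCommGroup E] [NormedSpace ℝ E]
    {u : E → Fin 3 → ℂ} {p : E} (hu : ∀ j, DifferentiableAt ℝ (fun x => u x j) p)
    (F : MvPolynomial (Fin 3) ℂ) :
    DifferentiableAt ℝ (fun x => MvPolynomial.eval (u x) F) p := by
  induction F using MvPolynomial.induction_on with
  | C a => simp
  | add F G hF hG => simp only [map_add]; exact hF.add hG
  | mul_X F i hF => simp only [map_mul, MvPolynomial.eval_X]; exact hF.mul (hu i)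

/-- At a unit vector `p` the derivative of `‖x‖⁻¹` in the `k`-th direction is `-p k`, which removes
the radial part of the gradient. -/
theorem grad_eval (F : MvPolynomial (Fin 3) ℂ) (p : S2) (k : Fin 3) :
    grad (fun q => MvPolynomial.eval (pt q) F) p k =
      MvPolynomial.eval (pt p) (MvPolynomial.pderiv k F) -
        pt p k * ∑ j, pt p j * MvPolynomial.eval (pt p) (MvPolynomial.pderiv j F) := by
  have hp : ‖(p : E3)‖ = 1 := mem_sphere_zero_iff_norm.mp p.2
  have hp0 : (p : E3) ≠ 0 := by
    intro h; rw [h, norm_zero] at hp; exact zero_ne_one hp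
  set u : E3 → Fin 3 → ℂ := fun x j => ((‖x‖⁻¹ * x j : ℝ) : ℂ) with hu
  have heq : (fun x : E3 => MvPolynomial.eval (pt (radialProj x)) F) =ᶠ[𝓝 (p : E3)]
      fun x => MvPolynomial.eval (u x) F := by
    filter_upwards [isOpen_ne.mem_nhds hp0] with x hx
    congr 2
    funext j
    simp only [pt, radialProj, dif_neg (show ¬ x = 0 from hx), hu]
    rfl
  rw [grad, heq.fderiv_eq]
  have hd : DifferentiableAt ℝ (fun x => MvPolynomial.eval (u x) F) (p : E3) := by
    refine differentiableAt_eval (fun j => ?_) F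
    refine Complex.ofRealCLM.differentiableAt.comp _ (DifferentiableAt.mul ?_ ?_)
    · exact ((contDiffAt_norm ℝ hp0).differentiableAt (n := 1) one_ne_zero).inv (by simp)
    · fun_prop
  set v : E3 := EuclideanSpace.single k 1 with hv
  have h1 := hd.hasFDerivAt.hasLineDerivAt v
  rw [HasLineDerivAt] at h1
  have hline : HasDerivAt (fun t : ℝ => (p : E3) + t • v) v 0 := by
    simpa using ((hasDerivAt_id (0 : ℝ)).smul_const v).const_add (p : E3)
  have hn : HasDerivAt (fun t : ℝ => ‖(p : E3) + t • v‖⁻¹) (-(p : E3) k) 0 := by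
    have e1 := hline.norm_sq
    simp only [zero_smul, add_zero] at e1
    have e2 := (e1.sqrt (by simp [hp])).inv (by simp [hp])
    simp only [zero_smul, add_zero, Real.sqrt_sq (norm_nonneg _), hp] at e2
    refine e2.congr_deriv ?_
    simp [hv, EuclideanSpace.inner_single_right]
  have h2 : HasDerivAt (fun t : ℝ => MvPolynomial.eval (u ((p : E3) + t • v)) F)
      (∑ j, ((-(p : E3) k * (p : E3) j + v j : ℝ) : ℂ) *
        MvPolynomial.eval (u ((p : E3) + (0 : ℝ) • v)) (MvPolynomial.pderiv j F)) 0 := by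
    refine hasDerivAt_eval (fun j => ?_) F
    have hj : HasDerivAt (fun t : ℝ => ((p : E3) + t • v) j) (v j) 0 := by
      simpa using ((hasDerivAt_id (0 : ℝ)).mul_const (v j)).const_add ((p : E3) j)
    refine ((hn.mul hj).congr_deriv ?_).ofReal_comp
    simp [hp]
  rw [h1.unique h2]
  have hu0 : u ((p : E3) + (0 : ℝ) • v) = pt p := by
    funext j
    simp [hu, hp, pt]
  rw [hu0]
  simp only [Complex.ofReal_add, Complex.ofReal_mul, Complex.ofReal_neg, add_mul,
    Finset.sum_add_distrib]
  rw [add_comm, sub_eq_add_neg]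
  congr 1
  · rw [Finset.sum_eq_single k]
    · simp [hv]
    · intro j _ hj
      simp [hv, hj]
    · simp
  · rw [← neg_mul, Finset.mul_sum]
    exact Finset.sum_congr rfl fun j _ => by simp only [pt]; ring

/-- The radial parts of the two gradients drop out of the triple product with `p`. -/
theorem poisson_eval (F G : MvPolynomial (Fin 3) ℂ) (p : S2) :
    poisson (fun q => MvPolynomial.eval (pt q) F) (fun q => MvPolynomial.eval (pt q) G) p =
      MvPolynomial.eval (pt p) (poissonPoly F G) := by
  have hpt : (fun k => ((p : E3) k : ℂ)) = pt p := rfl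
  rw [poisson, hpt]
  simp only [cross_apply, dotProduct, Fin.sum_univ_three, grad_eval, poissonPoly, map_add, map_mul,
    map_sub, MvPolynomial.eval_X, Matrix.cons_val_zero, Matrix.cons_val_one, Matrix.cons_val]
  ring

/-! ### Behaviour of spherical harmonics under dilations -/

section Dilation

open MvPolynomial

/-- The substitution `x ↦ s x`. -/
def dilate (s : ℂ) : MvPolynomial (Fin 3) ℂ →ₐ[ℂ] MvPolynomial (Fin 3) ℂ :=
  aeval fun i => s • X i

theorem eval_dilate (s : ℂ) (u : Fin 3 → ℂ) (F : MvPolynomial (Fin 3) ℂ) :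
    eval u (dilate s F) = eval (fun k => s * u k) F := by
  induction F using MvPolynomial.induction_on with
  | C a => simp [dilate, algebraMap_eq]
  | add F G hF hG => simp [hF, hG]
  | mul_X F i hF =>
    have h : dilate s (X i) = s • X i := by simp [dilate]
    rw [map_mul, map_mul, hF, h, map_mul, smul_eval, eval_X, eval_X]

theorem pderiv_dilate (s : ℂ) (i : Fin 3) (F : MvPolynomial (Fin 3) ℂ) :
    pderiv i (dilate s F) = s • dilate s (pderiv i F) := by
  induction F using MvPolynomial.induction_on with
  | C a => simp [dilate, algebraMap_eq]
  | add F G hF hG => simp only [map_add, hF, hG, smul_add]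
  | mul_X F j hF =>
    have h : dilate s (X j) = s • X j := by simp [dilate]
    rw [map_mul, h, Derivation.leibniz, Derivation.leibniz, Derivation.map_smul, hF]
    simp only [smul_eq_mul, map_add, map_mul, h]
    by_cases hij : i = j
    · subst hij
      simp only [pderiv_X_self, map_one, smul_eq_C_mul]
      ring
    · simp only [pderiv_X_of_ne (Ne.symm hij), map_zero, smul_eq_C_mul]
      ring

theorem lowering_dilate (s : ℂ) (F : MvPolynomial (Fin 3) ℂ) :
    lowering (dilate s F) = dilate s (lowering F) := by
  have h : ∀ j, dilate s (X j) = s • X j := fun j => by simp [dilate]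
  rw [lowering_eq, lowering_eq]
  simp only [pderiv_dilate, map_add, map_mul, map_neg, map_sub, map_smul, h]
  simp only [smul_eq_C_mul]
  ring

theorem dilate_bPoly (s : ℂ) (l k : ℕ) : dilate s (bPoly l k) = s ^ l • bPoly l k := by
  induction k with
  | zero =>
    have h : ∀ j, dilate s (X j) = s • X j := fun j => by simp [dilate]
    have : dilate s xplus = s • xplus := by
      simp only [xplus, map_add, map_smul, h, smul_add, smul_comm s]
    rw [bPoly, Function.iterate_zero, id, map_pow, this, smul_pow]
  | succ k ih => rw [← lowering_bPoly, ← lowering_dilate, ih, Derivation.map_smul]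

theorem poissonPoly_dilate (s : ℂ) (F G : MvPolynomial (Fin 3) ℂ) :
    poissonPoly (dilate s F) (dilate s G) = s • dilate s (poissonPoly F G) := by
  have h : ∀ j, dilate s (X j) = s • X j := fun j => by simp [dilate]
  simp only [poissonPoly, pderiv_dilate, map_add, map_mul, map_sub, h]
  simp only [smul_eq_C_mul]
  ring

/-- The point `s p` of `ℂ³`. -/
def spt (s : ℂ) (p : S2) : Fin 3 → ℂ := fun k => s * pt p k

theorem eval_spt_bPoly (s : ℂ) (p : S2) (l k : ℕ) :
    eval (spt s p) (bPoly l k) = s ^ l * eval (pt p) (bPoly l k) := by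
  rw [show spt s p = fun k => s * pt p k from rfl, ← eval_dilate, dilate_bPoly, smul_eval]

/-- Beyond the degrees of its arguments the bracket contributes one factor `s`: two derivatives
against one explicit coordinate. For `s = -1` this is the anti-Poisson sign. -/
theorem eval_spt_poissonPoly {s : ℂ} (hs : s * s = 1) (p : S2) (l k l' k' : ℕ) :
    eval (spt s p) (poissonPoly (bPoly l k) (bPoly l' k')) =
      s * (s ^ l * s ^ l') * eval (pt p) (poissonPoly (bPoly l k) (bPoly l' k')) := by
  have h := congrArg (eval (pt p)) (poissonPoly_dilate s (bPoly l k) (bPoly l' k'))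
  rw [dilate_bPoly, dilate_bPoly, poissonPoly_smul_left, poissonPoly_smul_right, smul_eval,
    smul_eval, smul_eval, eval_dilate] at h
  rw [show spt s p = fun k => s * pt p k from rfl]
  linear_combination -s * h - eval (fun k => s * pt p k)
    (poissonPoly (bPoly l k) (bPoly l' k')) * hs

theorem spt_sq {s : ℂ} (hs : s * s = 1) (p : S2) :
    spt s p 0 ^ 2 + spt s p 1 ^ 2 + spt s p 2 ^ 2 = 1 := by
  have := sum_pt_sq p
  simp only [spt]
  linear_combination s * s * this + hs

theorem exists_bound_eval (s : ℂ) (F : MvPolynomial (Fin 3) ℂ) :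
    ∃ C, ∀ p : S2, ‖eval (spt s p) F‖ ≤ C := by
  have hc : Continuous fun p : S2 => eval (spt s p) F := by
    refine (MvPolynomial.continuous_eval F).comp (continuous_pi fun k => ?_)
    simp only [spt, pt]
    fun_prop
  obtain ⟨C, hC⟩ := isCompact_univ.exists_bound_of_continuousOn hc.continuousOn
  exact ⟨C, fun p => hC p trivial⟩

end Dilation

/-- The product of a convergent scalar sequence with a uniformly convergent sequence of functions
whose limit is bounded. -/
theorem tendstoUniformly_mul {X : Type*} {u : ℕ → ℂ} {u₀ : ℂ} (hu : Tendsto u atTop (𝓝 u₀))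
    {f : ℕ → X → ℂ} {g : X → ℂ} (hf : TendstoUniformly f g atTop) {C : ℝ} (hg : ∀ x, ‖g x‖ ≤ C) :
    TendstoUniformly (fun n x => u n * f n x) (fun x => u₀ * g x) atTop := by
  rw [Metric.tendstoUniformly_iff] at hf ⊢
  intro ε hε
  have hC : 0 < |C| + 1 := by positivity
  have h1 := (Metric.tendsto_nhds.mp hu) (ε / 2 / (|C| + 1)) (by positivity)
  have h2 := (Metric.tendsto_nhds.mp hu) 1 one_pos
  filter_upwards [h1, h2, hf (ε / 2 / (‖u₀‖ + 1)) (by positivity)] with n h1 h2 h3 x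
  rw [dist_comm, dist_eq_norm]
  rw [dist_eq_norm] at h1 h2
  have h3' := h3 x
  rw [dist_comm, dist_eq_norm] at h3'
  have hun : ‖u n‖ ≤ ‖u₀‖ + 1 := by
    have := norm_add_le (u n - u₀) u₀
    rw [sub_add_cancel] at this
    linarith
  have hgx : ‖g x‖ ≤ |C| + 1 := by linarith [hg x, le_abs_self C]
  calc ‖u n * f n x - u₀ * g x‖ = ‖u n * (f n x - g x) + (u n - u₀) * g x‖ := by ring_nf
    _ ≤ ‖u n‖ * ‖f n x - g x‖ + ‖u n - u₀‖ * ‖g x‖ := by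
      rw [← norm_mul, ← norm_mul]; exact norm_add_le _ _
    _ < (‖u₀‖ + 1) * (ε / 2 / (‖u₀‖ + 1)) + ε / 2 / (|C| + 1) * (|C| + 1) := by
      have hpos : 0 < ‖u₀‖ + 1 := by positivity
      refine add_lt_add_of_lt_of_le ?_ (mul_le_mul h1.le hgx (norm_nonneg _) (by positivity))
      exact (mul_le_mul_of_nonneg_right hun (norm_nonneg _)).trans_lt
        (mul_lt_mul_of_pos_left h3' hpos)
    _ = ε := by field_simp; ring

theorem tendstoUniformly_const {X : Type*} (g : X → ℂ) :
    TendstoUniformly (fun _ : ℕ => g) g atTop := by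
  rw [Metric.tendstoUniformly_iff]
  intro ε hε
  exact Eventually.of_forall fun n x => by simpa using hε

/-! ### Uniform limits of the symbols of expansions. -/

section Limits

variable {W : ∀ n, SymbolCorrespondence n} {d : ℕ → ℕ → ℂ} {s : ℂ}

theorem shift_iterate_fst (r : ℕ) (a : Expn) (n : ℕ) :
    (Expn.shift^[r] a).1 n = (1 / ((n : ℂ) + 1)) ^ r • a.1 n := by
  induction r with
  | zero => simp
  | succ r ih =>
    rw [Function.iterate_succ_apply', Expn.shift_apply]
    simp only
    rw [ih, pow_succ', mul_smul]

theorem tendsto_inv_succ : Tendsto (fun n : ℕ => 1 / ((n : ℂ) + 1)) atTop (𝓝 0) :=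
  tendsto_one_div_add_atTop_nhds_zero_nat

theorem tendsto_div_succ : Tendsto (fun n : ℕ => (n : ℂ) * (1 / ((n : ℂ) + 1))) atTop (𝓝 1) := by
  have := tendsto_inv_succ.const_sub 1
  rw [sub_zero] at this
  refine this.congr fun n => ?_
  have : (n : ℂ) + 1 ≠ 0 := Nat.cast_add_one_ne_zero n
  field_simp
  ring

/-- `bPoly l k` is homogeneous of degree `l`, so the limits `s ^ l` are absorbed by evaluation at `s
p`; shifted terms vanish in the limit. -/
theorem tendstoUniformly_symbol (hs : s * s = 1)
    (hd : ∀ n l k x, (W n).symbol (bOp n l k) x = d n l * MvPolynomial.eval (pt x) (bPoly l k))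
    (hlim : ∀ l, Tendsto (fun n => d n l) atTop (𝓝 (s ^ l))) {a : Expn} (ha : a ∈ Expn.expansions) :
    TendstoUniformly (fun n p => (W n).symbol (a.1 n) p)
      (fun p => MvPolynomial.eval (spt s p) a.2.1) atTop := by
  induction ha using Submodule.span_induction with
  | mem a ha =>
    rcases ha with ⟨r, l, k, rfl⟩ | ⟨h, h1, h2⟩
    · obtain ⟨C, hC⟩ := exists_bound_eval 1 (bPoly l k)
      have hC' : ∀ p : S2, ‖MvPolynomial.eval (pt p) (bPoly l k)‖ ≤ C := fun p => by
        simpa [eval_spt_bPoly] using hC p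
      have e : ∀ n p, (W n).symbol ((Expn.shift^[r] (Expn.basis l k)).1 n) p =
          ((1 / ((n : ℂ) + 1)) ^ r * d n l) * MvPolynomial.eval (pt p) (bPoly l k) := fun n p => by
        rw [shift_iterate_fst, map_smul, Pi.smul_apply, smul_eq_mul]
        simp only [Expn.basis]
        rw [hd, mul_assoc]
      simp only [e]
      have hu := (tendsto_inv_succ.pow r).mul (hlim l)
      convert tendstoUniformly_mul hu (tendstoUniformly_const _) hC' using 2 with p
      cases r with
      | zero => simp [Expn.basis, eval_spt_bPoly]
      | succ r =>
        rw [Function.iterate_succ_apply', Expn.shift_apply]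
        simp
    · have e : ∀ n p, (W n).symbol (a.1 n) p = 0 := fun n p => by simp [h]
      simp only [e, fun p => eval_eq_zero_of_mem h1 (spt_sq hs p)]
      exact tendstoUniformly_const _
  | zero =>
    simp only [Prod.fst_zero, Prod.snd_zero, Pi.zero_apply, map_zero]
    exact tendstoUniformly_const _
  | add a b _ _ iha ihb =>
    simp only [Prod.fst_add, Prod.snd_add, Pi.add_apply, map_add]
    exact iha.add ihb
  | smul r a _ iha =>
    obtain ⟨C, hC⟩ := exists_bound_eval s a.2.1
    simp only [Prod.smul_fst, Prod.smul_snd, Pi.smul_apply, map_smul, MvPolynomial.smul_eval,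
      smul_eq_mul]
    exact tendstoUniformly_mul tendsto_const_nhds iha hC

theorem tendsto_of_tendsto_mul {u : ℕ → ℂ} {u₀ : ℂ}
    (h : Tendsto (fun n : ℕ => (n : ℂ) * (u n - u₀)) atTop (𝓝 0)) : Tendsto u atTop (𝓝 u₀) := by
  have hi : Tendsto (fun n : ℕ => (n : ℂ)⁻¹) atTop (𝓝 0) := tendsto_inv_atTop_nhds_zero_nat
  have := (hi.mul h).add_const u₀
  simp only [mul_zero, zero_add] at this
  refine this.congr' ?_
  filter_upwards [eventually_ne_atTop 0] with n hn
  have : (n : ℂ) ≠ 0 := Nat.cast_ne_zero.mpr hn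
  field_simp
  ring

/-- A basis term contributes `n (d n l - s ^ l)`, which tends to zero. A single shift contributes
its leading polynomial since `n/(n+1) → 1`, and further shifts vanish. -/
theorem tendstoUniformly_symbol_first_order (hs : s * s = 1)
    (hd : ∀ n l k x, (W n).symbol (bOp n l k) x = d n l * MvPolynomial.eval (pt x) (bPoly l k))
    (hlim : ∀ l, Tendsto (fun n : ℕ => (n : ℂ) * (d n l - s ^ l)) atTop (𝓝 0))
    {a : Expn} (ha : a ∈ Expn.expansions) :
    TendstoUniformly (fun (n : ℕ) p => (n : ℂ) * ((W n).symbol (a.1 n) p -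
        MvPolynomial.eval (spt s p) a.2.1))
      (fun p => MvPolynomial.eval (spt s p) a.2.2) atTop := by
  induction ha using Submodule.span_induction with
  | mem a ha =>
    rcases ha with ⟨r, l, k, rfl⟩ | ⟨h, h1, h2⟩
    · obtain ⟨C, hC⟩ := exists_bound_eval 1 (bPoly l k)
      have hC' : ∀ p : S2, ‖MvPolynomial.eval (pt p) (bPoly l k)‖ ≤ C := fun p => by
        simpa [eval_spt_bPoly] using hC p
      have e : ∀ n p, (W n).symbol ((Expn.shift^[r] (Expn.basis l k)).1 n) p =
          ((1 / ((n : ℂ) + 1)) ^ r * d n l) * MvPolynomial.eval (pt p) (bPoly l k) := fun n p => by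
        rw [shift_iterate_fst, map_smul, Pi.smul_apply, smul_eq_mul]
        simp only [Expn.basis]
        rw [hd, mul_assoc]
      simp only [e]
      cases r with
      | zero =>
        convert tendstoUniformly_mul (hlim l) (tendstoUniformly_const _) hC' using 3 with n p p
        · simp only [Function.iterate_zero, id, Expn.basis, eval_spt_bPoly]; ring
        · simp [Expn.basis]
      | succ r =>
        have hu := ((tendsto_div_succ.mul (tendsto_inv_succ.pow r)).mul
          (tendsto_of_tendsto_mul (hlim l)))
        convert tendstoUniformly_mul hu (tendstoUniformly_const _) hC' using 3 with n p p
        · rw [Function.iterate_succ_apply', Expn.shift_apply]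
          simp only [map_zero]
          ring
        · rw [Function.iterate_succ_apply', Expn.shift_apply]
          cases r with
          | zero => simp [Expn.basis, eval_spt_bPoly]
          | succ r =>
            rw [Function.iterate_succ_apply', Expn.shift_apply]
            simp
    · have e : ∀ n p, (W n).symbol (a.1 n) p = 0 := fun n p => by simp [h]
      simp only [e, fun p => eval_eq_zero_of_mem h1 (spt_sq hs p),
        fun p => eval_eq_zero_of_mem h2 (spt_sq hs p), sub_zero, mul_zero]
      exact tendstoUniformly_const _
  | zero =>
    simp only [Prod.fst_zero, Prod.snd_zero, Pi.zero_apply, map_zero, sub_zero, mul_zero]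
    exact tendstoUniformly_const _
  | add a b _ _ iha ihb =>
    convert iha.add ihb using 3 with n p
    · simp only [Prod.fst_add, Prod.snd_add, Pi.add_apply, map_add]
      ring
    · simp only [Prod.snd_add, Pi.add_apply, map_add]
  | smul r a _ iha =>
    obtain ⟨C, hC⟩ := exists_bound_eval s a.2.2
    convert tendstoUniformly_mul (tendsto_const_nhds (x := r)) iha hC using 3 with n p
    · simp only [Prod.smul_fst, Prod.smul_snd, Pi.smul_apply, map_smul, MvPolynomial.smul_eval,
        smul_eq_mul]
      ring
    · simp only [Prod.smul_snd, MvPolynomial.smul_eval]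

end Limits

/-! ### Asymptotics of the twisted products -/

theorem Y_eq (l : ℕ) (m : ℤ) : Y l m = fun p =>
    (harmonicCoef l ((l : ℤ) - m).toNat : ℂ) *
      MvPolynomial.eval (pt p) (bPoly l ((l : ℤ) - m).toNat) := by
  funext p
  have h : (fun k => ((p : E3) k : ℂ)) = pt p := rfl
  rw [Y, h, harmonicAux_eq, MvPolynomial.smul_eval]

/-- The uniform convergence is not affected by finitely many terms. -/
theorem tendstoUniformly_of_eventually_eq {X : Type*} {f f' : ℕ → X → ℂ} {g g' : X → ℂ}
    (hf : TendstoUniformly f g atTop) (h : ∀ᶠ n in atTop, ∀ x, f n x = f' n x)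
    (hg : ∀ x, g x = g' x) : TendstoUniformly f' g' atTop := by
  obtain rfl : g = g' := funext hg
  rw [Metric.tendstoUniformly_iff] at hf ⊢
  intro ε hε
  filter_upwards [hf ε hε, h] with n h1 h2 x
  rw [← h2]
  exact h1 x

section Twisted

variable {W : ∀ n, SymbolCorrespondence n} {d : ℕ → ℕ → ℂ} {s : ℂ}

/-- A harmonic of degree `l` is the symbol of `bOp` divided by `d l`; injectivity guarantees that
`Function.invFun` returns that operator. -/
theorem star_bPoly {n : ℕ} {W : SymbolCorrespondence n} {d : ℕ → ℂ}
    (hd : ∀ l k x, W.symbol (bOp n l k) x = d l * MvPolynomial.eval (pt x) (bPoly l k))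
    {l l' : ℕ} (hl : d l ≠ 0) (hl' : d l' ≠ 0) (k k' : ℕ) (γ γ' : ℂ) (p : S2) :
    W.star (fun p => γ * MvPolynomial.eval (pt p) (bPoly l k))
      (fun p => γ' * MvPolynomial.eval (pt p) (bPoly l' k')) p =
      γ * γ' / (d l * d l') * W.symbol (bOp n l k * bOp n l' k') p := by
  have h : ∀ {l : ℕ} (_ : d l ≠ 0) (k : ℕ) (γ : ℂ), Function.invFun W.symbol
      (fun p => γ * MvPolynomial.eval (pt p) (bPoly l k)) = (γ / d l) • bOp n l k := by
    intro l hl k γ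
    have : (fun p => γ * MvPolynomial.eval (pt p) (bPoly l k)) =
        W.symbol ((γ / d l) • bOp n l k) := by
      funext p
      rw [map_smul, Pi.smul_apply, hd, smul_eq_mul]
      field_simp
    rw [this]
    exact Function.leftInverse_invFun W.injective _
  rw [SymbolCorrespondence.star, h hl, h hl', smul_mul_smul_comm, map_smul, Pi.smul_apply,
    smul_eq_mul]
  congr 1
  field_simp

/-- A shift moves the leading polynomial into the third coordinate, so the leading polynomial of `a`
is the first-order term of the commutator. -/
theorem comm_symbol
    (l k l' k' : ℕ) : ∃ a ∈ Expn.expansions,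
      a.2.1 = (2 * Complex.I) • poissonPoly (bPoly l k) (bPoly l' k') ∧
      ∀ (n : ℕ), bOp n l k * bOp n l' k' - bOp n l' k' * bOp n l k =
        (1 / ((n : ℂ) + 1)) • a.1 n := by
  obtain ⟨a, ha, h⟩ := Expn.comm_basis_mem l k l' k'
  refine ⟨a, ha, ?_, fun n => ?_⟩
  · have h2 := congrArg (fun b : Expn => b.2.2) h
    simp only [Expn.shift_apply, Expn.comm, Expn.mul_def, Expn.basis, Prod.snd_sub, mul_zero,
      zero_mul, zero_add] at h2
    rw [h2, poissonPoly_comm (bPoly l' k')]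
    module
  · have h1 := congrFun (congrArg (fun b : Expn => b.1) h) n
    simp only [Expn.shift_apply, Expn.comm, Expn.mul_def, Expn.basis, Prod.fst_sub,
      Pi.sub_apply] at h1
    exact h1.symm

theorem isPoissonTypeWithSign_of_tendsto (hs : s * s = 1)
    (hd : ∀ n l k x, (W n).symbol (bOp n l k) x = d n l * MvPolynomial.eval (pt x) (bPoly l k))
    (hne : ∀ n l, l ≤ n → d n l ≠ 0)
    (hlim : ∀ l, Tendsto (fun n => d n l) atTop (𝓝 (s ^ l))) : IsPoissonTypeWithSign s W := by
  have hs0 : s ≠ 0 := fun h => by simp [h] at hs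
  have hsl : ∀ l : ℕ, s ^ l * s ^ l = 1 := fun l => by rw [← mul_pow, hs, one_pow]
  have hcoef : ∀ (γ γ' : ℂ) (l l' : ℕ), Tendsto (fun n => γ * γ' / (d n l * d n l')) atTop
      (𝓝 (γ * γ' / (s ^ l * s ^ l'))) := fun γ γ' l l' =>
    tendsto_const_nhds.div ((hlim l).mul (hlim l'))
      (mul_ne_zero (pow_ne_zero _ hs0) (pow_ne_zero _ hs0))
  have hinv : ∀ l l' : ℕ, (s ^ l * s ^ l')⁻¹ = s ^ l * s ^ l' := fun l l' => by
    rw [inv_eq_iff_eq_inv, eq_comm, inv_eq_of_mul_eq_one_left]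
    linear_combination (s ^ l' * s ^ l') * hsl l + hsl l'
  have hstar : ∀ (l l' : ℕ) (m m' : ℤ), ∀ᶠ n in atTop, ∀ p,
      (W n).star (Y l m) (Y l' m') p =
        (harmonicCoef l ((l : ℤ) - m).toNat : ℂ) * (harmonicCoef l' ((l' : ℤ) - m').toNat : ℂ) /
          (d n l * d n l') * (W n).symbol (bOp n l ((l : ℤ) - m).toNat *
            bOp n l' ((l' : ℤ) - m').toNat) p := by
    intro l l' m m'
    filter_upwards [eventually_ge_atTop l, eventually_ge_atTop l'] with n h h' p
    rw [Y_eq, Y_eq, star_bPoly (hd n) (hne n l h) (hne n l' h')]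
  -- The weight `t` covers two properties at once: `t = 1` with limit `0` gives (i), and `t = n`
  -- with limit `1` gives (iii).
  have hcomm : ∀ (l l' : ℕ) (m m' : ℤ) (t : ℕ → ℂ) (t₀ : ℂ),
      Tendsto (fun n => t n * (1 / ((n : ℂ) + 1))) atTop (𝓝 t₀) →
      TendstoUniformly (fun n p => t n * ((W n).star (Y l m) (Y l' m') p -
        (W n).star (Y l' m') (Y l m) p))
        (fun p => t₀ * (s * (2 * Complex.I * poisson (Y l m) (Y l' m') p))) atTop := by
    intro l l' m m' t t₀ ht
    set k := ((l : ℤ) - m).toNat with hk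
    set k' := ((l' : ℤ) - m').toNat with hk'
    obtain ⟨a, ha, ha1, ha2⟩ := comm_symbol l k l' k'
    obtain ⟨C, hC⟩ := exists_bound_eval s a.2.1
    refine tendstoUniformly_of_eventually_eq (tendstoUniformly_mul (ht.mul
      (hcoef (harmonicCoef l k) (harmonicCoef l' k') l l'))
      (tendstoUniformly_symbol hs hd hlim ha) hC) ?_ ?_
    · filter_upwards [hstar l l' m m', hstar l' l m' m] with n h1 h2 p
      rw [h1, h2]
      have e := congrArg (fun A => (W n).symbol A p) (ha2 n)
      simp only [map_sub, map_smul, Pi.sub_apply, Pi.smul_apply, smul_eq_mul] at e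
      rw [mul_comm (d n l') (d n l), mul_comm (harmonicCoef l' _ : ℂ) (harmonicCoef l _ : ℂ)]
      linear_combination (-(t n) * ((harmonicCoef l k : ℂ) * (harmonicCoef l' k') /
        (d n l * d n l'))) * e
    · intro p
      have hP : poisson (Y l m) (Y l' m') p = (harmonicCoef l k : ℂ) * harmonicCoef l' k' *
          MvPolynomial.eval (pt p) (poissonPoly (bPoly l k) (bPoly l' k')) := by
        have e : ∀ (l : ℕ) (m : ℤ), Y l m = fun p => MvPolynomial.eval (pt p)
            ((harmonicCoef l ((l : ℤ) - m).toNat : ℂ) • bPoly l ((l : ℤ) - m).toNat) :=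
          fun l m => by rw [Y_eq]; funext p; rw [MvPolynomial.smul_eval]
        rw [e, e, poisson_eval, poissonPoly_smul_left, poissonPoly_smul_right,
          MvPolynomial.smul_eval, MvPolynomial.smul_eval, mul_assoc]
      -- The signs `s ^ l * s ^ l'` from dividing by `d n l * d n l'` cancel those from homogeneity,
      -- leaving a single `s` in front of the bracket.
      rw [hP, ha1, MvPolynomial.smul_eval, eval_spt_poissonPoly hs, div_eq_mul_inv, hinv]
      have h := hsl l
      have h' := hsl l'
      linear_combination (t₀ * (harmonicCoef l k : ℂ) * (harmonicCoef l' k') * s * 2 * Complex.I *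
        MvPolynomial.eval (pt p) (poissonPoly (bPoly l k) (bPoly l' k'))) *
        ((s ^ l' * s ^ l') * h + h')
  constructor
  · intro l l' m m' _ _
    refine tendstoUniformly_of_eventually_eq (hcomm l l' m m' (fun _ => 1) 0 (by simpa using tendsto_inv_succ))
      (Eventually.of_forall fun n p => by rw [one_mul]) fun p => by rw [zero_mul]
  · intro l l' m m' _ _
    set k := ((l : ℤ) - m).toNat with hk
    set k' := ((l' : ℤ) - m').toNat with hk'
    have ha := add_mem (Expn.mul_mem (Expn.basis_mem l k) (Expn.basis_mem l' k'))
      (Expn.mul_mem (Expn.basis_mem l' k') (Expn.basis_mem l k))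
    obtain ⟨C, hC⟩ := exists_bound_eval s (Expn.mul (Expn.basis l k) (Expn.basis l' k') +
      Expn.mul (Expn.basis l' k') (Expn.basis l k)).2.1
    refine tendstoUniformly_of_eventually_eq (tendstoUniformly_mul
      (hcoef (harmonicCoef l k) (harmonicCoef l' k') l l')
      (tendstoUniformly_symbol hs hd hlim ha) hC) ?_ ?_
    · filter_upwards [hstar l l' m m', hstar l' l m' m] with n h1 h2 p
      rw [h1, h2, mul_comm (d n l') (d n l), mul_comm (harmonicCoef l' _ : ℂ) (harmonicCoef l _ : ℂ)]
      simp only [Expn.mul_def, Expn.basis, Prod.fst_add, Pi.add_apply, map_add]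
      ring
    · intro p
      rw [Y_eq, Y_eq]
      simp only [Expn.mul_def, Expn.basis, Prod.snd_add, Prod.fst_add, map_add, map_mul,
        eval_spt_bPoly, div_eq_mul_inv, hinv]
      have h := hsl l
      have h' := hsl l'
      linear_combination (2 * (harmonicCoef l k : ℂ) * (harmonicCoef l' k') *
        MvPolynomial.eval (pt p) (bPoly l k) * MvPolynomial.eval (pt p) (bPoly l' k')) *
        ((s ^ l' * s ^ l') * h + h')
  · intro l l' m m' _ _
    refine tendstoUniformly_of_eventually_eq (hcomm l l' m m' (fun n => n) 1 tendsto_div_succ)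
      (Eventually.of_forall fun n p => rfl) fun p => by rw [one_mul]

theorem isPure_of_tendsto (hs : s * s = 1)
    (hd : ∀ n l k x, (W n).symbol (bOp n l k) x = d n l * MvPolynomial.eval (pt x) (bPoly l k))
    (hne : ∀ n l, l ≤ n → d n l ≠ 0)
    (hlim : ∀ l, Tendsto (fun n : ℕ => (n : ℂ) * (d n l - s ^ l)) atTop (𝓝 0)) : IsPure W := by
  have hs0 : s ≠ 0 := fun h => by simp [h] at hs
  have hsl : ∀ l : ℕ, s ^ l * s ^ l = 1 := fun l => by rw [← mul_pow, hs, one_pow]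
  have hlim' := fun l => tendsto_of_tendsto_mul (hlim l)
  intro l l' m m' _ _
  set k := ((l : ℤ) - m).toNat with hk
  set k' := ((l' : ℤ) - m').toNat with hk'
  set a := Expn.mul (Expn.basis l k) (Expn.basis l' k') +
    Expn.mul (Expn.basis l' k') (Expn.basis l k) with ha'
  have ha : a ∈ Expn.expansions :=
    add_mem (Expn.mul_mem (Expn.basis_mem l k) (Expn.basis_mem l' k'))
      (Expn.mul_mem (Expn.basis_mem l' k') (Expn.basis_mem l k))
  -- The bracket is antisymmetric, so the anticommutator has no first-order term.
  have ha2 : a.2.2 = 0 := by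
    simp only [ha', Expn.mul_def, Expn.basis, Prod.snd_add]
    rw [poissonPoly_comm (bPoly l' k')]
    simp
  obtain ⟨C, hC⟩ := exists_bound_eval s a.2.2
  obtain ⟨C₁, hC₁⟩ := exists_bound_eval s a.2.1
  set γ : ℂ := (harmonicCoef l k : ℂ) * harmonicCoef l' k'
  have hden : Tendsto (fun n => d n l * d n l') atTop (𝓝 (s ^ l * s ^ l')) :=
    (hlim' l).mul (hlim' l')
  have hden0 : s ^ l * s ^ l' ≠ 0 := mul_ne_zero (pow_ne_zero _ hs0) (pow_ne_zero _ hs0)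
  have h1 := tendstoUniformly_mul ((tendsto_const_nhds (x := γ)).div hden hden0)
    (tendstoUniformly_symbol_first_order hs hd hlim ha) hC
  -- The other error of order `1/n` comes from the factor `1/(d n l * d n l')`, whose limit is its
  -- own inverse `s ^ l * s ^ l'`.
  have hn : Tendsto (fun n : ℕ => γ * ((n : ℂ) * (1 / (d n l * d n l') - s ^ l * s ^ l'))) atTop
      (𝓝 0) := by
    have e1 : Tendsto (fun n : ℕ => (n : ℂ) * (d n l * d n l' - s ^ l * s ^ l')) atTop (𝓝 0) := by
      have := ((hlim l).mul (hlim' l')).add ((hlim l').const_mul (s ^ l))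
      rw [zero_mul, mul_zero, zero_add] at this
      exact this.congr fun n => by ring
    have e2 := ((e1.mul (hden.inv₀ hden0)).const_mul (-(s ^ l * s ^ l'))).const_mul γ
    rw [zero_mul, mul_zero, mul_zero] at e2
    refine e2.congr' ?_
    filter_upwards [eventually_ge_atTop l, eventually_ge_atTop l'] with n h h'
    have n1 := hne n l h
    have n2 := hne n l' h'
    field_simp
    linear_combination (γ * n) * ((s ^ l' * s ^ l') * hsl l + hsl l')
  have h2 := tendstoUniformly_mul hn (tendstoUniformly_const
    (fun p => MvPolynomial.eval (spt s p) a.2.1)) hC₁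
  refine tendstoUniformly_of_eventually_eq (h1.add h2) ?_ fun p => ?_
  · filter_upwards [eventually_ge_atTop l, eventually_ge_atTop l'] with n h h' p
    have n1 := hne n l h
    have n2 := hne n l' h'
    rw [Y_eq, Y_eq, star_bPoly (hd n) n1 n2, star_bPoly (hd n) n2 n1]
    simp only [Pi.add_apply, Pi.div_apply, ha', Expn.mul_def, Expn.basis, Prod.snd_add,
      Prod.fst_add, map_add, map_mul, eval_spt_bPoly, γ, ← hk, ← hk']
    field_simp
    linear_combination -(2 * (n : ℂ) * d n l * d n l' * (harmonicCoef l k : ℂ) * (harmonicCoef l' k') *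
        MvPolynomial.eval (pt p) (bPoly l k) * MvPolynomial.eval (pt p) (bPoly l' k')) *
        ((s ^ l' * s ^ l') * hsl l + hsl l')
  · simp [ha2]

end Twisted

/-! ### Necessary conditions -/

/-- The point `(1,0,0)` of the sphere. -/
def eastPole : S2 := ⟨!₂[1, 0, 0], by simp [EuclideanSpace.norm_eq, Fin.sum_univ_three]⟩

theorem pt_eastPole : pt eastPole = ![1, 0, 0] := by
  funext k
  fin_cases k <;> simp [pt, eastPole]

theorem eval_eastPole_pow (l : ℕ) : MvPolynomial.eval (pt eastPole) (bPoly l 0) = 1 := by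
  simp [bPoly, eval_xplus, pt_eastPole]

/-- This quantizes `x² + y² + z² = 1`: the left side is `4 J²/(n+1)²`. Its defect is of second
order, so it controls `d n 1` to first order. -/
theorem bOp_casimir (n : ℕ) :
    (-1 / 4 : ℂ) • (bOp n 1 0 * bOp n 1 2 + bOp n 1 2 * bOp n 1 0) +
      (1 / 4 : ℂ) • (bOp n 1 1 * bOp n 1 1) = (1 - 1 / ((n : ℂ) + 1) ^ 2) • bOp n 0 0 := by
  have hN : (n : ℂ) + 1 ≠ 0 := Nat.cast_add_one_ne_zero n
  have h0 : bOp n 1 0 = (2 / ((n : ℂ) + 1)) • Jplus n := by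
    rw [bOp, Function.iterate_zero, id, pow_one]
  have h1 : bOp n 0 0 = 1 := by rw [bOp, Function.iterate_zero, id, pow_zero]
  have hc : Jthree n * Jthree n = ((((n : ℂ) + 1) ^ 2 - 1) / 4) • (1 : Op n) -
      Jminus n * Jplus n - Jthree n := by rw [← casimir n]; abel
  rw [h0, h1, bOp_one_one, bOp_one_two]
  simp only [smul_mul_smul_comm, Jplus_mul_Jminus_comm, hc]
  match_scalars <;> field_simp <;> ring

section Necessary

variable {W : ∀ n, SymbolCorrespondence n} {d : ℕ → ℕ → ℂ} {s : ℂ}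

/-- The commutator of `bOp n 1 0` and `bOp n 1 1` is exactly `4/(n+1)` times `bOp n 1 0`. At
`(1,0,0)`, where `x+iy = 1`, the bracket condition becomes `n/((n+1) d n 1) → s`. -/
theorem tendsto_one_of_isPoissonTypeWithSign (hs : s * s = 1)
    (hd : ∀ n l k x, (W n).symbol (bOp n l k) x = d n l * MvPolynomial.eval (pt x) (bPoly l k))
    (hne : ∀ n l, l ≤ n → d n l ≠ 0) (hW : IsPoissonTypeWithSign s W) :
    Tendsto (fun n => d n 1) atTop (𝓝 s) := by
  have hs0 : s ≠ 0 := fun h => by simp [h] at hs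
  have h := (hW.bracket 1 1 1 0 (by simp) (by simp)).tendsto_at eastPole
  set γ : ℂ := (harmonicCoef 1 0 : ℂ) with hγ
  set γ' : ℂ := (harmonicCoef 1 1 : ℂ) with hγ'
  have hγ0 : γ ≠ 0 := Complex.ofReal_ne_zero.mpr (harmonicCoef_ne_zero (by norm_num))
  have hγ0' : γ' ≠ 0 := Complex.ofReal_ne_zero.mpr (harmonicCoef_ne_zero (by norm_num))
  have hY : Y 1 1 = fun p => MvPolynomial.eval (pt p) (γ • bPoly 1 0) := by
    rw [Y_eq]; funext p; rw [MvPolynomial.smul_eval]; rfl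
  have hY' : Y 1 0 = fun p => MvPolynomial.eval (pt p) (γ' • bPoly 1 1) := by
    rw [Y_eq]; funext p; rw [MvPolynomial.smul_eval]; rfl
  have hPB : poissonPoly (bPoly 1 0) (bPoly 1 1) = (-2 * Complex.I) • bPoly 1 0 := by
    rw [poissonPoly_comm, bPoly_one_one, poissonPoly_smul_left, bPoly, Function.iterate_zero, id,
      pow_one, poissonPoly_xplus_right]
    module
  rw [hY, hY', poisson_eval, poissonPoly_smul_left, poissonPoly_smul_right, hPB] at h
  simp only [MvPolynomial.smul_eval, eval_eastPole_pow] at h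
  have hcomm : ∀ n : ℕ, bOp n 1 0 * bOp n 1 1 - bOp n 1 1 * bOp n 1 0 =
      (4 * (1 / ((n : ℂ) + 1))) • bOp n 1 0 := fun n => by
    have e := congrFun (congrArg (fun b : Expn => b.1) (Expn.comm_basis_one_one 1)) n
    simp only [Expn.comm, Expn.mul_def, Expn.basis, Prod.fst_sub, Pi.sub_apply, Expn.shift_apply,
      Prod.smul_fst, Pi.smul_apply] at e
    rw [← neg_sub, e]
    push_cast
    module
  have h2 : Tendsto (fun n : ℕ => (n : ℂ) * (1 / ((n : ℂ) + 1)) / d n 1) atTop (𝓝 s) := by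
    have h3 := h.const_mul (1 / (4 * γ * γ'))
    have e : 1 / (4 * γ * γ') * (s * (2 * Complex.I * (γ * (γ' * (-2 * Complex.I * 1))))) = s := by
      field_simp
      linear_combination (-4) * Complex.I_sq
    rw [e] at h3
    refine h3.congr' ?_
    filter_upwards [eventually_ge_atTop 1] with n hn
    have hdn := hne n 1 hn
    rw [star_bPoly (hd n) hdn hdn, star_bPoly (hd n) hdn hdn, mul_comm γ' γ, ← mul_sub,
      ← Pi.sub_apply, ← map_sub, hcomm, map_smul, Pi.smul_apply, hd, eval_eastPole_pow, smul_eq_mul]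
    field_simp
  have h4 := tendsto_div_succ.div h2 hs0
  have e : 1 / s = s := by field_simp; linear_combination -hs
  rw [e] at h4
  refine h4.congr' ?_
  filter_upwards [eventually_ge_atTop 1] with n hn
  have hdn := hne n 1 hn
  have : (n : ℂ) ≠ 0 := Nat.cast_ne_zero.mpr (by omega)
  have hN : (n : ℂ) + 1 ≠ 0 := Nat.cast_add_one_ne_zero n
  simp only [Pi.div_apply]
  field_simp

/-- Both products are the same power of `J₊`. The value isolates `d n (l+1) / (d n 1 * d n l)`, from
which all limits follow by induction on `l`. -/
theorem star_highest {n l : ℕ}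
    (hd : ∀ n l k x, (W n).symbol (bOp n l k) x = d n l * MvPolynomial.eval (pt x) (bPoly l k))
    (h1 : d n 1 ≠ 0) (hl : d n l ≠ 0) :
    (W n).star (Y 1 1) (Y l l) eastPole + (W n).star (Y l l) (Y 1 1) eastPole =
      2 * ((harmonicCoef 1 0 : ℂ) * (harmonicCoef l 0 : ℂ)) * (d n (l + 1) / (d n 1 * d n l)) := by
  have e1 : bOp n 1 0 * bOp n l 0 = bOp n (l + 1) 0 := by
    simp only [bOp, Function.iterate_zero, id, pow_one, pow_succ' _ l]
  have e2 : bOp n l 0 * bOp n 1 0 = bOp n (l + 1) 0 := by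
    simp only [bOp, Function.iterate_zero, id, pow_one, pow_succ _ l]
  have k1 : (((1 : ℕ) : ℤ) - 1).toNat = 0 := rfl
  have kl : ((l : ℤ) - l).toNat = 0 := by simp
  rw [Y_eq, Y_eq, star_bPoly (hd n) h1 hl, star_bPoly (hd n) hl h1, k1, kl, e1, e2, hd,
    eval_eastPole_pow]
  field_simp
  ring

theorem Y_highest_eastPole (l : ℕ) : Y l l eastPole = (harmonicCoef l 0 : ℂ) := by
  have kl : ((l : ℤ) - l).toNat = 0 := by simp
  rw [Y_eq, kl]
  beta_reduce
  rw [eval_eastPole_pow, mul_one]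

theorem tendsto_of_isPoissonTypeWithSign (hs : s * s = 1)
    (hd : ∀ n l k x, (W n).symbol (bOp n l k) x = d n l * MvPolynomial.eval (pt x) (bPoly l k))
    (hd0 : ∀ n, d n 0 = 1) (hne : ∀ n l, l ≤ n → d n l ≠ 0) (hW : IsPoissonTypeWithSign s W)
    (l : ℕ) : Tendsto (fun n => d n l) atTop (𝓝 (s ^ l)) := by
  have h1 := tendsto_one_of_isPoissonTypeWithSign hs hd hne hW
  induction l with
  | zero => simp [hd0]
  | succ l ih =>
    have h := (hW.anticommutator 1 l 1 l (by simp) (by simp)).tendsto_at eastPole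
    have hy1 : Y 1 1 eastPole = _ := Y_highest_eastPole 1
    rw [Y_highest_eastPole, hy1] at h
    set γ : ℂ := (harmonicCoef 1 0 : ℂ)
    set γ' : ℂ := (harmonicCoef l 0 : ℂ)
    have hγ0 : γ ≠ 0 := Complex.ofReal_ne_zero.mpr (harmonicCoef_ne_zero (by norm_num))
    have hγ0' : γ' ≠ 0 := Complex.ofReal_ne_zero.mpr (harmonicCoef_ne_zero (by norm_num))
    have h2 := ((h.const_mul (1 / (2 * γ * γ'))).mul h1).mul ih
    have e : 1 / (2 * γ * γ') * (2 * γ * γ') * s * s ^ l = s ^ (l + 1) := by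
      field_simp
      ring
    rw [e] at h2
    refine h2.congr' ?_
    filter_upwards [eventually_ge_atTop 1, eventually_ge_atTop l] with n n1 nl
    have hd1 := hne n 1 n1
    have hdl := hne n l nl
    rw [star_highest hd hd1 hdl]
    change 1 / (2 * γ * γ') * (2 * (γ * γ') * _) * _ * _ = _
    field_simp

theorem tendsto_mul_one_of_isPure (hs : s * s = 1)
    (hd : ∀ n l k x, (W n).symbol (bOp n l k) x = d n l * MvPolynomial.eval (pt x) (bPoly l k))
    (hd0 : ∀ n, d n 0 = 1) (hne : ∀ n l, l ≤ n → d n l ≠ 0)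
    (h1 : Tendsto (fun n => d n 1) atTop (𝓝 s)) (hW : IsPure W) :
    Tendsto (fun n : ℕ => (n : ℂ) * (d n 1 - s)) atTop (𝓝 0) := by
  have hs0 : s ≠ 0 := fun h => by simp [h] at hs
  have hA := (hW 1 1 1 (-1) (by simp) (by simp)).tendsto_at eastPole
  have hB := (hW 1 1 0 0 (by simp) (by simp)).tendsto_at eastPole
  set γ0 : ℂ := (harmonicCoef 1 0 : ℂ) with hγ0'
  set γ1 : ℂ := (harmonicCoef 1 1 : ℂ) with hγ1'
  set γ2 : ℂ := (harmonicCoef 1 2 : ℂ) with hγ2'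
  have hγ0 : γ0 ≠ 0 := Complex.ofReal_ne_zero.mpr (harmonicCoef_ne_zero (by norm_num))
  have hγ1 : γ1 ≠ 0 := Complex.ofReal_ne_zero.mpr (harmonicCoef_ne_zero (by norm_num))
  have hγ2 : γ2 ≠ 0 := Complex.ofReal_ne_zero.mpr (harmonicCoef_ne_zero (by norm_num))
  have hY0 : Y 1 1 = fun p => γ0 * MvPolynomial.eval (pt p) (bPoly 1 0) := Y_eq 1 1
  have hY1 : Y 1 0 = fun p => γ1 * MvPolynomial.eval (pt p) (bPoly 1 1) := Y_eq 1 0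
  have hY2 : Y 1 (-1) = fun p => γ2 * MvPolynomial.eval (pt p) (bPoly 1 2) := Y_eq 1 (-1)
  have v1 : MvPolynomial.eval (pt eastPole) (bPoly 1 1) = 0 := by
    simp [bPoly_one_one, MvPolynomial.smul_eval, pt_eastPole]
  have v2 : MvPolynomial.eval (pt eastPole) (bPoly 1 2) = -2 := by
    simp [bPoly_one_two, MvPolynomial.smul_eval, eval_xminus, pt_eastPole]
  rw [hY0, hY2] at hA
  rw [hY1] at hB
  simp only [eval_eastPole_pow, v1, v2] at hA hB
  have h2 : Tendsto (fun n : ℕ => (n : ℂ) * ((1 - 1 / ((n : ℂ) + 1) ^ 2) / (d n 1 * d n 1) - 1))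
      atTop (𝓝 0) := by
    -- The weights undo the normalizations of the harmonics and assemble the two anticommutators
    -- into the left side of `bOp_casimir`, divided by `(d n 1)²`.
    have h3 := (hA.const_mul (-1 / (4 * γ0 * γ2))).add (hB.const_mul (1 / (8 * γ1 * γ1)))
    have e0 : -1 / (4 * γ0 * γ2) * 0 + 1 / (8 * γ1 * γ1) * 0 = (0 : ℂ) := by ring
    rw [e0] at h3
    refine h3.congr' ?_
    filter_upwards [eventually_ge_atTop 1] with n hn
    have hdn := hne n 1 hn
    have hcas := congrArg (fun A => (W n).symbol A eastPole) (bOp_casimir n)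
    simp only [map_add, map_smul, Pi.add_apply, Pi.smul_apply, smul_eq_mul, hd, hd0,
      eval_eastPole_pow, mul_one] at hcas
    rw [star_bPoly (hd n) hdn hdn, star_bPoly (hd n) hdn hdn, star_bPoly (hd n) hdn hdn, ← hcas]
    field_simp
    ring
  have h3 : Tendsto (fun n : ℕ => (n : ℂ) * (1 / ((n : ℂ) + 1)) * (1 / ((n : ℂ) + 1))) atTop
      (𝓝 0) := by
    have := tendsto_div_succ.mul tendsto_inv_succ
    rwa [mul_zero] at this
  have hsum : Tendsto (fun n => d n 1 + s) atTop (𝓝 (s + s)) := h1.add_const s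
  have hss : s + s ≠ 0 := by rw [← two_mul]; exact mul_ne_zero two_ne_zero hs0
  -- The bracketed limit is that of `n ((d n 1)² - 1) = n (d n 1 - s)(d n 1 + s)`, whose last factor
  -- tends to `2s ≠ 0`.
  have h4 := (((h2.mul (h1.mul h1)).add h3).neg).div hsum hss
  simp only [zero_mul, add_zero, neg_zero, zero_div] at h4
  refine h4.congr' ?_
  filter_upwards [eventually_ge_atTop 1, hsum.eventually_ne hss] with n hn hns
  have hdn := hne n 1 hn
  have hN : (n : ℂ) + 1 ≠ 0 := Nat.cast_add_one_ne_zero n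
  simp only [Pi.div_apply]
  rw [div_eq_iff hns]
  field_simp
  linear_combination (n : ℂ) * ((n : ℂ) + 1) ^ 2 * hs

theorem tendsto_mul_of_isPure (hs : s * s = 1)
    (hd : ∀ n l k x, (W n).symbol (bOp n l k) x = d n l * MvPolynomial.eval (pt x) (bPoly l k))
    (hd0 : ∀ n, d n 0 = 1) (hne : ∀ n l, l ≤ n → d n l ≠ 0)
    (hlim : ∀ l, Tendsto (fun n => d n l) atTop (𝓝 (s ^ l))) (hW : IsPure W) (l : ℕ) :
    Tendsto (fun n : ℕ => (n : ℂ) * (d n l - s ^ l)) atTop (𝓝 0) := by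
  have h1 := tendsto_mul_one_of_isPure hs hd hd0 hne (by simpa using hlim 1) hW
  induction l with
  | zero => simp [hd0]
  | succ l ih =>
    have h := (hW 1 l 1 l (by simp) (by simp)).tendsto_at eastPole
    have hy1 : Y 1 1 eastPole = _ := Y_highest_eastPole 1
    rw [Y_highest_eastPole, hy1] at h
    set γ : ℂ := (harmonicCoef 1 0 : ℂ)
    set γ' : ℂ := (harmonicCoef l 0 : ℂ)
    have hγ0 : γ ≠ 0 := Complex.ofReal_ne_zero.mpr (harmonicCoef_ne_zero (by norm_num))
    have hγ0' : γ' ≠ 0 := Complex.ofReal_ne_zero.mpr (harmonicCoef_ne_zero (by norm_num))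
    -- With `ρ = d n (l+1) / (d n 1 * d n l)`, the error `d n (l+1) - s^(l+1)` telescopes as `(ρ -
    -- 1) d n 1 d n l + (d n 1 - s) d n l + s (d n l - s^l)`.
    have h2 := (((h.const_mul (1 / (2 * γ * γ'))).mul ((hlim 1).mul (hlim l))).add
      (h1.mul (hlim l))).add (ih.const_mul s)
    simp only [mul_zero, zero_mul, add_zero] at h2
    refine h2.congr' ?_
    filter_upwards [eventually_ge_atTop 1, eventually_ge_atTop l] with n n1 nl
    have hd1 := hne n 1 n1
    have hdl := hne n l nl
    rw [star_highest hd hd1 hdl]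
    change 1 / (2 * γ * γ') * (_ * (2 * (γ * γ') * _ - _)) * _ + _ + _ = _
    field_simp
    ring

end Necessary

/-! ### Characteristic numbers -/

/-- The product under the root is `1 + O(1/n²)`, and `|√Q - 1| ≤ |Q - 1|` because `√Q + 1 ≥ 1`. -/
theorem tendsto_mul_ratioNum_sub_one (l : ℕ) :
    Tendsto (fun n : ℕ => (n : ℝ) * (ratioNum n l - 1)) atTop (𝓝 0) := by
  have hinv : Tendsto (fun n : ℕ => 1 / ((n : ℝ) + 1)) atTop (𝓝 0) :=
    tendsto_one_div_add_atTop_nhds_zero_nat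
  have hdiv : Tendsto (fun n : ℕ => (n : ℝ) * (1 / ((n : ℝ) + 1))) atTop (𝓝 1) := by
    have := hinv.const_sub 1
    rw [sub_zero] at this
    refine this.congr fun n => ?_
    field_simp
    ring
  have hQ : Tendsto (fun n : ℕ => (n : ℝ) *
      (∏ k ∈ Finset.range l, (1 - ((k : ℝ) + 1) ^ 2 / ((n : ℝ) + 1) ^ 2) - 1)) atTop (𝓝 0) := by
    induction l with
    | zero => simp
    | succ l ih =>
      have ha : Tendsto (fun n : ℕ => ((l : ℝ) + 1) ^ 2 * ((1 / ((n : ℝ) + 1)) *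
          (1 / ((n : ℝ) + 1)))) atTop (𝓝 0) := by
        simpa using (hinv.mul hinv).const_mul (((l : ℝ) + 1) ^ 2)
      have hb : Tendsto (fun n : ℕ => ((l : ℝ) + 1) ^ 2 * ((n : ℝ) * (1 / ((n : ℝ) + 1)) *
          (1 / ((n : ℝ) + 1)))) atTop (𝓝 0) := by
        simpa using (hdiv.mul hinv).const_mul (((l : ℝ) + 1) ^ 2)
      have := (ih.mul (ha.const_sub 1)).sub hb
      simp only [zero_mul, sub_zero] at this
      refine this.congr fun n => ?_
      rw [Finset.prod_range_succ]
      field_simp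
      ring
  refine squeeze_zero_norm' ?_ (tendsto_zero_iff_norm_tendsto_zero.mp hQ)
  filter_upwards [eventually_ge_atTop l] with n hn
  have hpos := Real.sqrt_pos.mp (ratioNum_pos hn)
  rw [norm_mul, norm_mul, ratioNum]
  set Q := ∏ k ∈ Finset.range l, (1 - ((k : ℝ) + 1) ^ 2 / ((n : ℝ) + 1) ^ 2)
  refine mul_le_mul_of_nonneg_left ?_ (norm_nonneg _)
  have e : Q - 1 = (√Q - 1) * (√Q + 1) := by
    linear_combination -(Real.mul_self_sqrt hpos.le)
  rw [e, norm_mul]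
  refine le_mul_of_one_le_right (norm_nonneg _) ?_
  rw [Real.norm_eq_abs]
  exact (by linarith [Real.sqrt_nonneg Q] : (1 : ℝ) ≤ √Q + 1).trans (le_abs_self _)

theorem tendsto_of_tendsto_mul_real {u : ℕ → ℝ} {u₀ : ℝ}
    (h : Tendsto (fun n : ℕ => (n : ℝ) * (u n - u₀)) atTop (𝓝 0)) : Tendsto u atTop (𝓝 u₀) := by
  have hi : Tendsto (fun n : ℕ => (n : ℝ)⁻¹) atTop (𝓝 0) := tendsto_inv_atTop_nhds_zero_nat
  have := (hi.mul h).add_const u₀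
  simp only [mul_zero, zero_add] at this
  refine this.congr' ?_
  filter_upwards [eventually_ne_atTop 0] with n hn
  have : (n : ℝ) ≠ 0 := Nat.cast_ne_zero.mpr hn
  field_simp
  ring

theorem tendsto_ratioNum (l : ℕ) : Tendsto (fun n => ratioNum n l) atTop (𝓝 1) :=
  tendsto_of_tendsto_mul_real (tendsto_mul_ratioNum_sub_one l)

theorem tendsto_mul_ratioNum_iff {u : ℕ → ℝ} {u₀ : ℝ} (l : ℕ) :
    Tendsto (fun n => u n * ratioNum n l) atTop (𝓝 u₀) ↔ Tendsto u atTop (𝓝 u₀) := by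
  constructor
  · intro h
    have := h.div (tendsto_ratioNum l) one_ne_zero
    rw [div_one] at this
    refine this.congr' ?_
    filter_upwards [eventually_ge_atTop l] with n hn
    exact mul_div_cancel_right₀ _ (ratioNum_pos hn).ne'
  · intro h
    simpa using h.mul (tendsto_ratioNum l)

theorem tendsto_first_order_mul_ratioNum_iff {u : ℕ → ℝ} {u₀ : ℝ} (l : ℕ) :
    Tendsto (fun n : ℕ => (n : ℝ) * (u n * ratioNum n l - u₀)) atTop (𝓝 0) ↔
      Tendsto (fun n : ℕ => (n : ℝ) * (u n - u₀)) atTop (𝓝 0) := by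
  have hr := tendsto_mul_ratioNum_sub_one l
  constructor
  · intro h
    have := (h.sub (hr.const_mul u₀)).div (tendsto_ratioNum l) one_ne_zero
    simp only [mul_zero, sub_zero, zero_div] at this
    refine this.congr' ?_
    filter_upwards [eventually_ge_atTop l] with n hn
    have := (ratioNum_pos hn).ne'
    simp only [Pi.div_apply]
    field_simp
    ring
  · intro h
    have := (h.mul (tendsto_ratioNum l)).add (hr.const_mul u₀)
    simp only [mul_zero, zero_mul, add_zero] at this
    exact this.congr fun n => by ring

theorem tendsto_ofReal_iff {u : ℕ → ℝ} {u₀ : ℝ} :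
    Tendsto (fun n => (u n : ℂ)) atTop (𝓝 (u₀ : ℂ)) ↔ Tendsto u atTop (𝓝 u₀) :=
  ⟨fun h => (Complex.continuous_re.tendsto _).comp h,
    fun h => (Complex.continuous_ofReal.tendsto _).comp h⟩

/-! ### The criteria for both signs, and an obstruction read off from `c_1^n`. -/

section Main

variable {C : DeltaPlus → ℝˣ} {W : ∀ n, SymbolCorrespondence n}

theorem charNum_zero (n : ℕ) : charNum C n 0 = 1 := by simp [charNum]

theorem charNum_ne_zero (n l : ℕ) : charNum C n l ≠ 0 := by
  rw [charNum]
  split_ifs <;> simp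

theorem isPoissonTypeWithSign_iff (hW : IsSequenceOf W C) {σ : ℝ} (hσ : σ * σ = 1) :
    (IsPoissonTypeWithSign (σ : ℂ) W ↔
      ∀ l : ℕ, Tendsto (fun n => charNum C n l) atTop (𝓝 (σ ^ l))) ∧
    (IsPoissonTypeWithSign (σ : ℂ) W ∧ IsPure W ↔
      ∀ l : ℕ, Tendsto (fun n : ℕ => (n : ℝ) * (charNum C n l - σ ^ l)) atTop (𝓝 0)) := by
  choose d hd hdc using fun n => exists_symbol_bOp (W n) (charNum_zero n) (hW n)
  have hs : (σ : ℂ) * σ = 1 := by exact_mod_cast hσ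
  have hne : ∀ n l, l ≤ n → d n l ≠ 0 := fun n l hl => by
    rw [hdc n l hl, Complex.ofReal_ne_zero]
    exact mul_ne_zero (charNum_ne_zero n l) (ratioNum_pos hl).ne'
  have hd0 : ∀ n, d n 0 = 1 := fun n => by
    rw [hdc n 0 (Nat.zero_le n), charNum_zero]
    simp [ratioNum]
  have t0 : ∀ l : ℕ, Tendsto (fun n => d n l) atTop (𝓝 ((σ : ℂ) ^ l)) ↔
      Tendsto (fun n => charNum C n l) atTop (𝓝 (σ ^ l)) := fun l => by
    rw [← tendsto_mul_ratioNum_iff l, ← tendsto_ofReal_iff, Complex.ofReal_pow]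
    refine tendsto_congr' ?_
    filter_upwards [eventually_ge_atTop l] with n hn
    exact hdc n l hn
  have t1 : ∀ l : ℕ, Tendsto (fun n : ℕ => (n : ℂ) * (d n l - (σ : ℂ) ^ l)) atTop (𝓝 0) ↔
      Tendsto (fun n : ℕ => (n : ℝ) * (charNum C n l - σ ^ l)) atTop (𝓝 0) := fun l => by
    rw [← tendsto_first_order_mul_ratioNum_iff l, ← tendsto_ofReal_iff, Complex.ofReal_zero]
    refine tendsto_congr' ?_
    filter_upwards [eventually_ge_atTop l] with n hn
    rw [hdc n l hn]
    push_cast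
    ring
  constructor
  · exact ⟨fun h l => (t0 l).mp (tendsto_of_isPoissonTypeWithSign hs hd hd0 hne h l),
      fun h => isPoissonTypeWithSign_of_tendsto hs hd hne fun l => (t0 l).mpr (h l)⟩
  · constructor
    · rintro ⟨h, h'⟩ l
      exact (t1 l).mp (tendsto_mul_of_isPure hs hd hd0 hne
        (tendsto_of_isPoissonTypeWithSign hs hd hd0 hne h) h' l)
    · intro h
      have h1 := fun l => (t1 l).mpr (h l)
      exact ⟨isPoissonTypeWithSign_of_tendsto hs hd hne fun l => tendsto_of_tendsto_mul (h1 l),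
        isPure_of_tendsto hs hd hne h1⟩

/-- Each type would force `c_1^n` to converge to `1` or to `-1`, hence eventually to leave any
closed set missing that value. -/
theorem not_types_of_frequently (hW : IsSequenceOf W C) {U V : Set ℝ} (hU : IsClosed U)
    (hV : IsClosed V) (h1 : (1 : ℝ) ∉ U) (h1' : (-1 : ℝ) ∉ V)
    (hfU : ∃ᶠ n in atTop, charNum C n 1 ∈ U) (hfV : ∃ᶠ n in atTop, charNum C n 1 ∈ V) :
    ¬ IsPoissonType W ∧ ¬ IsAntiPoissonType W := by
  constructor
  · intro h
    have := ((isPoissonTypeWithSign_iff hW (σ := 1) (by norm_num)).1.mp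
      (by simpa [IsPoissonType] using h)) 1
    rw [one_pow] at this
    exact hfU ((this.eventually (hU.isOpen_compl.mem_nhds h1)).mono fun n hn => hn)
  · intro h
    have := ((isPoissonTypeWithSign_iff hW (σ := -1) (by norm_num)).1.mp
      (by simpa [IsAntiPoissonType] using h)) 1
    rw [pow_one] at this
    exact hfV ((this.eventually (hV.isOpen_compl.mem_nhds h1')).mono fun n hn => hn)

end Main

/-! ### Generic characteristic numbers -/

/-- The index of the number `c_1^{n+1}`. -/
def dipoleIndex (n : ℕ) : DeltaPlus := ⟨(n + 1, 1), Nat.one_pos, Nat.succ_pos n⟩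

theorem dipoleIndex_injective : Function.Injective dipoleIndex := fun m n h => by
  simpa [dipoleIndex] using h

/-- For each `N`, having an index beyond `N` with value in `U` is an open dense condition. Density
holds because changing one coordinate far out converges to no change in the product topology. -/
theorem residual_frequently_mem {ι X : Type*} [TopologicalSpace X] {q : ℕ → ι}
    (hq : Function.Injective q) {U : Set X} (hU : IsOpen U) (hne : U.Nonempty) :
    ∀ᶠ f in residual (ι → X), ∃ᶠ n in atTop, f (q n) ∈ U := by
  classical
  obtain ⟨u, hu⟩ := hne
  simp only [frequently_atTop]
  refine eventually_countable_forall.mpr fun N => ?_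
  refine residual_of_dense_open ?_ fun f => ?_
  · have : {f : ι → X | ∃ n, n ≥ N ∧ f (q n) ∈ U} = ⋃ n ≥ N, {f | f (q n) ∈ U} := by
      ext f; simp
    change IsOpen {f : ι → X | ∃ n, n ≥ N ∧ f (q n) ∈ U}
    rw [this]
    exact isOpen_biUnion fun n _ => hU.preimage (continuous_apply (q n))
  · have h : Tendsto (fun n => Function.update f (q n) u) atTop (𝓝 f) := by
      refine tendsto_pi_nhds.mpr fun i => tendsto_const_nhds.congr' ?_
      have hfin : {n | q n = i}.Finite :=
        Set.Subsingleton.finite fun a ha b hb => hq (ha.trans hb.symm)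
      have hev : ∀ᶠ n in atTop, ¬ q n = i := by
        rw [← Nat.cofinite_eq_atTop]
        exact hfin.eventually_cofinite_notMem
      filter_upwards [hev] with n hn
      rw [Function.update_of_ne fun h => hn h.symm]
    refine mem_closure_of_tendsto h ?_
    filter_upwards [eventually_ge_atTop N] with n hn
    exact ⟨n, hn, by simpa using hu⟩

theorem singleton_sign_eq (e : ℤˣ) : ({e} : Set ℤˣ) = Units.val ⁻¹' {(e : ℤ)} := by
  ext u
  exact Units.ext_iff

theorem isOpen_singleton_sign (e : ℤˣ) : IsOpen ({e} : Set ℤˣ) := by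
  rw [singleton_sign_eq]
  exact (isOpen_discrete _).preimage Units.continuous_val

theorem measurableSet_compl_singleton_sign (e : ℤˣ) : MeasurableSet ({e}ᶜ : Set ℤˣ) := by
  rw [singleton_sign_eq]
  exact ⟨{(e : ℤ)}ᶜ, MeasurableSet.of_discrete, rfl⟩

/-- Missing the sign `e` at all indices from `N` on implies missing it at `m` independent places,
which has probability `2⁻¹ ^ m` for every `m`. -/
theorem ae_frequently_eq (e : ℤˣ) :
    ∀ᵐ ε ∂randomSigns, ∃ᶠ n in atTop, ε (dipoleIndex n) = e := by
  simp only [frequently_atTop]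
  refine ae_all_iff.mpr fun N => ?_
  have hhalf : (PMF.uniformOfFintype ℤˣ).toMeasure ({e}ᶜ : Set ℤˣ) = 2⁻¹ := by
    rw [PMF.toMeasure_uniformOfFintype_apply _ (measurableSet_compl_singleton_sign e)]
    have : Fintype.card ({e}ᶜ : Set ℤˣ) = 1 := by
      rw [Fintype.card_compl_set]; simp
    simp [this]
  have hle : ∀ m : ℕ, randomSigns {ε | ¬ ∃ n, n ≥ N ∧ ε (dipoleIndex n) = e} ≤ 2⁻¹ ^ m :=
      fun m => by
    have hsub : {ε : DeltaPlus → ℤˣ | ¬ ∃ n, n ≥ N ∧ ε (dipoleIndex n) = e} ⊆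
        Set.pi ((Finset.Ico N (N + m)).map ⟨dipoleIndex, dipoleIndex_injective⟩ : Finset DeltaPlus)
          fun _ => ({e}ᶜ : Set ℤˣ) := by
      intro ε hε q hq
      obtain ⟨n, hn, rfl⟩ := Finset.mem_map.mp (Finset.mem_coe.mp hq)
      exact fun h => hε ⟨n, (Finset.mem_Ico.mp hn).1, h⟩
    refine (measure_mono hsub).trans_eq ?_
    rw [randomSigns, Measure.infinitePi_pi _ fun _ _ => measurableSet_compl_singleton_sign e]
    simp only [hhalf, Finset.prod_const, Finset.card_map, Nat.card_Ico, Nat.add_sub_cancel_left]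
  change randomSigns {ε | ¬ ∃ n, n ≥ N ∧ ε (dipoleIndex n) = e} = 0
  exact le_antisymm (ge_of_tendsto'
    (ENNReal.tendsto_pow_atTop_nhds_zero_of_lt_one (by simp)) hle) bot_le

theorem charNum_dipoleIndex (C : DeltaPlus → ℝˣ) (n : ℕ) :
    charNum C (n + 1) 1 = (C (dipoleIndex n) : ℝ) := by
  simp [charNum, dipoleIndex]

theorem frequently_charNum_mem {C : DeltaPlus → ℝˣ} {U : Set ℝ}
    (h : ∃ᶠ n in atTop, (C (dipoleIndex n) : ℝ) ∈ U) : ∃ᶠ n in atTop, charNum C n 1 ∈ U := by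
  refine (tendsto_add_atTop_nat 1).frequently (h.mono fun n hn => ?_)
  rwa [charNum_dipoleIndex]

theorem frequently_charNum_ofSigns {ε : DeltaPlus → ℤˣ} {e : ℤˣ}
    (h : ∃ᶠ n in atTop, ε (dipoleIndex n) = e) :
    ∃ᶠ n in atTop, charNum (ofSigns ε) n 1 ∈ ({((e : ℤ) : ℝ)} : Set ℝ) :=
  frequently_charNum_mem (h.mono fun n hn => by simp [ofSigns, hn])

theorem not_types_of_frequently_signs {ε : DeltaPlus → ℤˣ} {W : ∀ n, SymbolCorrespondence n}
    (hW : IsSequenceOf W (ofSigns ε)) (h1 : ∃ᶠ n in atTop, ε (dipoleIndex n) = 1)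
    (h2 : ∃ᶠ n in atTop, ε (dipoleIndex n) = -1) : ¬ IsPoissonType W ∧ ¬ IsAntiPoissonType W :=
  not_types_of_frequently hW isClosed_singleton isClosed_singleton (by norm_num) (by norm_num)
    (frequently_charNum_ofSigns h2) (frequently_charNum_ofSigns h1)

end SpinSymbol

end

theorem theorem8p2p1 :
    (∀ (C : DeltaPlus → ℝˣ) (W : ∀ n, SymbolCorrespondence n), IsSequenceOf W C →
      (IsPoissonType W ↔
        ∀ l : ℕ, Tendsto (fun n => charNum C n l) atTop (𝓝 1)) ∧
      (IsAntiPoissonType W ↔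
        ∀ l : ℕ, Tendsto (fun n => charNum C n l) atTop (𝓝 ((-1) ^ l))) ∧
      (IsPurePoissonType W ↔
        ∀ l : ℕ, Tendsto (fun n : ℕ => (n : ℝ) * (charNum C n l - 1)) atTop (𝓝 0)) ∧
      (IsPureAntiPoissonType W ↔
        ∀ l : ℕ, Tendsto (fun n : ℕ => (n : ℝ) * (charNum C n l - (-1) ^ l)) atTop (𝓝 0))) ∧
    (∀ᶠ C in residual (DeltaPlus → ℝˣ), ∀ W : ∀ n, SymbolCorrespondence n, IsSequenceOf W C →
      ¬ IsPoissonType W ∧ ¬ IsAntiPoissonType W) ∧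
    (∀ᶠ ε in residual (DeltaPlus → ℤˣ), ∀ W : ∀ n, SymbolCorrespondence n,
      IsSequenceOf W (ofSigns ε) → ¬ IsPoissonType W ∧ ¬ IsAntiPoissonType W) ∧
    (∀ᵐ ε ∂randomSigns, ∀ W : ∀ n, SymbolCorrespondence n,
      IsSequenceOf W (ofSigns ε) → ¬ IsPoissonType W ∧ ¬ IsAntiPoissonType W) := by
  refine ⟨fun C W hW => ?_, ?_, ?_, ?_⟩
  · have hp := isPoissonTypeWithSign_iff hW (σ := 1) (by norm_num)
    have ha := isPoissonTypeWithSign_iff hW (σ := -1) (by norm_num)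
    simp only [one_pow, Complex.ofReal_one] at hp
    simp only [Complex.ofReal_neg, Complex.ofReal_one] at ha
    exact ⟨hp.1, ha.1, hp.2, ha.2⟩
  · have hU : IsOpen {u : ℝˣ | 2 < (u : ℝ)} := isOpen_Ioi.preimage Units.continuous_val
    filter_upwards [residual_frequently_mem dipoleIndex_injective hU
      ⟨Units.mk0 3 (by norm_num), by simp; norm_num⟩] with C hC W hW
    have hfr : ∃ᶠ n in atTop, charNum C n 1 ∈ Set.Ici 2 :=
      frequently_charNum_mem (hC.mono fun n hn => le_of_lt hn)
    exact not_types_of_frequently hW isClosed_Ici isClosed_Ici (by norm_num) (by norm_num) hfr hfr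
  · filter_upwards [residual_frequently_mem dipoleIndex_injective (isOpen_singleton_sign 1)
      (Set.singleton_nonempty _), residual_frequently_mem dipoleIndex_injective
      (isOpen_singleton_sign (-1)) (Set.singleton_nonempty _)] with ε h1 h2 W hW
    exact not_types_of_frequently_signs hW h1 h2
  · filter_upwards [ae_frequently_eq 1, ae_frequently_eq (-1)] with ε h1 h2 W hW
    exact not_types_of_frequently_signs hW h1 h2
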